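/- Let $H\in(\tfrac12,1)$. Let $\omega=(\omega_n)_{n\ge1}$ be a centred Gaussian family with $\mathbb E[\omega_n\omega_{n'}]=\gamma(n-n')$, where $\gamma:\mathbb Z\to\mathbb R$ satisfies $\gamma(n)\le C(|n|^{2H-2}\wedge1)$ for some constant $C>0$ and all $n\in\mathbb Z$ (the minimum being $1$ at $n=0$), and $\lim_{N\to\infty}N^{2-2H}\gamma(\lfloor Nt\rfloor)=|t|^{2H-2}$ for every $t\ne0$. For $m\ge1$ let $|\mathcal H|^{\otimes m}$ be the space of measurable functions $f$ on $[0,1]^m$ with $$\int_{[0,1]^m}\int_{[0,1]^m}|f(\mathbf s)f(\mathbf t)|\prod_{i=1}^m|s_i-t_i|^{2H-2}\,d\mathbf s\,d\mathbf t<\infty ,$$ write $|\mathcal H|$ for the case $m=1$, and let $\|f\|^2_{\mathcal H^{\otimes m}}$ (and, for $m=1$, the inner product $\langle f,g\rangle_{\mathcal H}$) be given by the same double integral without the absolute value around $f(\mathbf s)f(\mathbf t)$ (respectively, with $f(s)g(t)$). Let $W$ be a centred Gaussian process indexed by $|\mathcal H|$ (possibly on another probability space) with $\mathbb E[W(f)W(g)]=\langle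 f,g\rangle_{\mathcal H}$. For a centred Gaussian variable $X$ of variance $\sigma^2$ put $X^{\diamond m}:=\sigma^mH_m(X/\sigma)$ (and $X^{\diamond m}:=0$ if $\sigma=0$), where $H_m(x)=(-1)^me^{x^2/2}\frac{d^m}{dx^m}e^{-x^2/2}$ is the Hermite polynomial; for jointly Gaussian centred $X_1,\dots,X_m$ the Wick product is $X_1\diamond\cdots\diamond X_m:=\frac1{m!}\sum_{S\subseteq\{1,\dots,m\}}(-1)^{m-|S|}\big(\sum_{i\in S}X_i\big)^{\diamond m}$, the symmetric multilinear extension of the Wick power. The multiple Wiener integral of $\sum_jc_jh_j^{\otimes m}$ (finite sum, $h_j\in|\mathcal H|$) is $\sum_jc_jW(h_j)^{\diamond m}$; for $f\in|\mathcal H|^{\otimes m}$ the integral $\mathbf I_m(f)$ is the $L^2$ limit of the integrals of such sums converging in $\|\cdot\|_{\mathcal H^{\otimes m}}$ to the symmetrization $\hat f$ of $f$. For $N\ge1$ let $$\mathbf I^{(N)}_m(f):=N^{-mH}\sum_{\mathbf n\in\{1,\dots,N\}^m}\mathcal A_N(f)\Big(\frac{\mathbf n}N\Big)\,\omega_{n_1}\diamond\cdots\diamond\omega_{n_m},$$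 where $\mathcal A_N(f)$ is the function which, on each box $B=\prod_k(\frac{i_k-1}N,\frac{i_k}N]$, $\mathbf i\in\{1,\dots,N\}^m$, equals $|B|^{-1}\int_Bf$. **Proposition.** For every $m\ge1$ and $f\in|\mathcal H|^{\otimes m}$ the integral $\mathbf I_m(f)$ is well defined (the limit exists and is unique almost surely) and $\mathbf I^{(N)}_m(f)\to\mathbf I_m(f)$ in distribution as $N\to\infty$. Moreover, for all $k\ge1$, $l_1,\dots,l_k\ge1$ and $f_i\in|\mathcal H|^{\otimes l_i}$, jointly in distribution as $N\to\infty$, $$\big(\mathbf I^{(N)}_{l_1}(f_1),\dots,\mathbf I^{(N)}_{l_k}(f_k)\big)\to\big(\mathbf I_{l_1}(f_1),\dots,\mathbf I_{l_k}(f_k)\big).$$ -/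

import Mathlib

open MeasureTheory ProbabilityTheory Filter Topology
open scoped ENNReal

noncomputable section

/-! ### The Gaussian disorder -/

/-- `ω = (ω_n)_{n ≥ 1}` is a centred Gaussian family with covariance `E[ω_n ω_{n'}] = γ (n - n')`,
where `γ n ≲ |n|^{2H-2} ∧ 1` (at `n = 0` the minimum is `1`) and
`N^{2-2H} γ ([N t]) → |t|^{2H-2}` for every `t ≠ 0`. -/
structure IsCorrelatedDisorder {Ω : Type*} [MeasurableSpace Ω] (P : Measure Ω) (H : ℝ)
    (γ : ℤ → ℝ) (ω : ℕ+ → Ω → ℝ) : Prop where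
  gaussian : IsGaussianProcess ω P
  mean_zero : ∀ n, ∫ x, ω n x ∂P = 0
  covariance : ∀ n n' : ℕ+, ∫ x, ω n x * ω n' x ∂P = γ ((n : ℤ) - (n' : ℤ))
  decay : ∃ C : ℝ, 0 < C ∧ ∀ n : ℤ,
    γ n ≤ C * (if n = 0 then 1 else min (|(n : ℝ)| ^ (2 * H - 2)) 1)
  scaling : ∀ t : ℝ, t ≠ 0 →
    Tendsto (fun N : ℕ => (N : ℝ) ^ (2 - 2 * H) * γ ⌊(N : ℝ) * t⌋) atTop
      (𝓝 (|t| ^ (2 * H - 2)))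

/-! ### The spaces `|𝓗|` and `|𝓗|^{⊗ m}` -/

/-- Membership in `|𝓗|`: measurable functions on `[0,1]` (values outside `[0,1]` play no role) with
`∫₀¹∫₀¹ |f(s) f(t)| |s - t|^{2H-2} ds dt < ∞`. -/
def MemAbsH (H : ℝ) (f : ℝ → ℝ) : Prop :=
  AEMeasurable f (volume.restrict (Set.Icc 0 1)) ∧
    ∫⁻ s in Set.Icc (0 : ℝ) 1, ∫⁻ t in Set.Icc (0 : ℝ) 1,
      ENNReal.ofReal (|f s * f t| * |s - t| ^ (2 * H - 2)) < ∞

/-- The space `|𝓗|`. -/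
abbrev AbsH (H : ℝ) : Type := {f : ℝ → ℝ // MemAbsH H f}

/-- The inner product `⟨f, g⟩_𝓗 = ∫₀¹∫₀¹ f(s) g(t) |s - t|^{2H-2} ds dt`. -/
def innerH (H : ℝ) (f g : ℝ → ℝ) : ℝ :=
  ∫ s in Set.Icc (0 : ℝ) 1, ∫ t in Set.Icc (0 : ℝ) 1, f s * g t * |s - t| ^ (2 * H - 2)

/-- The product kernel `∏ᵢ |sᵢ - tᵢ|^{2H-2}`. -/
def tensorKernel (H : ℝ) {m : ℕ} (s t : Fin m → ℝ) : ℝ :=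
  ∏ i, |s i - t i| ^ (2 * H - 2)

/-- Membership in `|𝓗|^{⊗ m}`: measurable functions on `[0,1]^m` with
`∫∫ |f(s) f(t)| ∏ᵢ |sᵢ - tᵢ|^{2H-2} ds dt < ∞`. -/
def MemAbsHTensor (H : ℝ) {m : ℕ} (f : (Fin m → ℝ) → ℝ) : Prop :=
  AEMeasurable f (volume.restrict (Set.Icc 0 1)) ∧
    ∫⁻ s in Set.Icc (0 : Fin m → ℝ) 1, ∫⁻ t in Set.Icc (0 : Fin m → ℝ) 1,
      ENNReal.ofReal (|f s * f t| * tensorKernel H s t) < ∞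

/-- The squared norm `‖f‖²_{𝓗^{⊗ m}} = ∫∫ f(s) f(t) ∏ᵢ |sᵢ - tᵢ|^{2H-2} ds dt` of an
element `f` of `|𝓗|^{⊗ m}`. -/
def normSqHTensor (H : ℝ) {m : ℕ} (f : (Fin m → ℝ) → ℝ) : ℝ :=
  ∫ s in Set.Icc (0 : Fin m → ℝ) 1, ∫ t in Set.Icc (0 : Fin m → ℝ) 1,
    f s * f t * tensorKernel H s t

/-- The symmetrization `f̂(t₁,…,t_m) = (1/m!) ∑_σ f(t_{σ(1)},…,t_{σ(m)})`. -/
def symmetrization {m : ℕ} (f : (Fin m → ℝ) → ℝ) (t : Fin m → ℝ) : ℝ :=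
  ((m.factorial : ℝ))⁻¹ * ∑ σ : Equiv.Perm (Fin m), f (fun i => t (σ i))

/-! ### Wick products of Gaussian variables -/

/-- The `m`-th Wick power `X^{⋄ m} = σ^m H_m(X / σ)`, `σ² = E[X²]`, of a centred Gaussian
variable `X`, with `H_m` the (probabilists') Hermite polynomial. If `X = W(h)` for an isonormal
process `W`, then `σ = ‖h‖` and this is the multiple integral of `h^{⊗ m} = σ^m (h/‖h‖)^{⊗ m}`. -/
def wickPower {Ω : Type*} [MeasurableSpace Ω] (P : Measure Ω) (X : Ω → ℝ) (m : ℕ) (x : Ω) : ℝ :=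
  √(∫ y, X y ^ 2 ∂P) ^ m *
    Polynomial.aeval (X x / √(∫ y, X y ^ 2 ∂P)) (Polynomial.hermite m)

/-- The Wick product `X₁ ⋄ ⋯ ⋄ X_m` of centred jointly Gaussian variables. With `Xᵢ = W(hᵢ)` it is
the multiple integral of `h₁ ⊗ ⋯ ⊗ h_m`, that is, of its symmetrization, which is
`(1/m!) ∑_{S ⊆ {1,…,m}} (-1)^{m-|S|} (∑_{i ∈ S} hᵢ)^{⊗ m}`. -/
def wickProduct {Ω : Type*} [MeasurableSpace Ω] (P : Measure Ω) {m : ℕ} (X : Fin m → Ω → ℝ)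
    (x : Ω) : ℝ :=
  ((m.factorial : ℝ))⁻¹ * ∑ S : Finset (Fin m),
    (-1 : ℝ) ^ (m - S.card) * wickPower P (fun y => ∑ i ∈ S, X i y) m x

/-! ### The U-statistics -/

/-- The box `((i - 1)/N, i/N]`, `i ∈ {1,…,N}^m`; a coordinate `i_k` is encoded as the element
`i_k - 1` of `Fin N`. -/
def gridBox (N : ℕ) {m : ℕ} (i : Fin m → Fin N) : Set (Fin m → ℝ) :=
  Set.univ.pi fun k => Set.Ioc (((i k : ℕ) : ℝ) / N) ((((i k : ℕ) : ℝ) + 1) / N)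

/-- The average `𝓐_N(f)(t) = ∑_B |B|⁻¹ (∫_B f) 1_B(t)` over the boxes of side `1/N`. -/
def gridAverage (N : ℕ) {m : ℕ} (f : (Fin m → ℝ) → ℝ) (t : Fin m → ℝ) : ℝ :=
  ∑ i : Fin m → Fin N,
    (gridBox N i).indicator (fun _ => (volume.real (gridBox N i))⁻¹ * ∫ s in gridBox N i, f s) t

/-- `𝐈_m^{(N)}(f) = N^{-mH} ∑_{n ∈ {1,…,N}^m} 𝓐_N(f)(n/N) ω_{n₁} ⋄ ⋯ ⋄ ω_{n_m}`. -/
def uStatistic {Ω : Type*} [MeasurableSpace Ω] (P : Measure Ω) (H : ℝ) (ω : ℕ+ → Ω → ℝ)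
    {m : ℕ} (f : (Fin m → ℝ) → ℝ) (N : ℕ) (x : Ω) : ℝ :=
  (N : ℝ) ^ (-((m : ℝ) * H)) * ∑ n : Fin m → Fin N,
    gridAverage N f (fun k => (((n k : ℕ) : ℝ) + 1) / N) *
      wickProduct P (fun k => ω (Nat.succPNat (n k))) x

/-! ### The Gaussian noise and its multiple Wiener integrals -/

/-- `W` is a centred Gaussian process indexed by `|𝓗|` with `E[W(f) W(g)] = ⟨f, g⟩_𝓗`. As `|𝓗|` is
dense in `𝓗`, these are exactly the restrictions to `|𝓗|` of isonormal processes on `𝓗`. -/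
structure IsGaussianNoise {Ω : Type*} [MeasurableSpace Ω] (P : Measure Ω) (H : ℝ)
    (W : AbsH H → Ω → ℝ) : Prop where
  gaussian : IsGaussianProcess W P
  mean_zero : ∀ f, ∫ x, W f x ∂P = 0
  covariance : ∀ f g, ∫ x, W f x * W g x ∂P = innerH H f.1 g.1

/-- The symmetric function `∑ⱼ cⱼ hⱼ^{⊗ m}` for a formal combination `c = ∑ⱼ cⱼ [hⱼ]`,
`hⱼ ∈ |𝓗|`. -/
def elementaryTensor {H : ℝ} (m : ℕ) (c : AbsH H →₀ ℝ) (t : Fin m → ℝ) : ℝ :=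
  c.sum fun h a => a * ∏ i, h.1 (t i)

/-- The multiple Wiener integral `∑ⱼ cⱼ W(hⱼ)^{⋄ m}` of `∑ⱼ cⱼ hⱼ^{⊗ m}`. -/
def elementaryIntegral {Ω : Type*} [MeasurableSpace Ω] (P : Measure Ω) {H : ℝ}
    (W : AbsH H → Ω → ℝ) (m : ℕ) (c : AbsH H →₀ ℝ) (x : Ω) : ℝ :=
  c.sum fun h a => a * wickPower P (W h) m x

/-- `X` is (a version of) the multiple Wiener integral of `f`: it is the `L²` limit of the integrals
of symmetric elementary functions that converge in `𝓗^{⊗ m}` to the symmetrization of `f`. -/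
def IsMultipleWienerIntegral {Ω : Type*} [MeasurableSpace Ω] (P : Measure Ω) {H : ℝ}
    (W : AbsH H → Ω → ℝ) {m : ℕ} (f : (Fin m → ℝ) → ℝ) (X : Ω → ℝ) : Prop :=
  MemLp X 2 P ∧ ∃ c : ℕ → (AbsH H →₀ ℝ),
    Tendsto (fun j => normSqHTensor H
      (fun t => elementaryTensor m (c j) t - symmetrization f t)) atTop (𝓝 0) ∧
    Tendsto (fun j => eLpNorm (fun x => elementaryIntegral P W m (c j) x - X x) 2 P) atTop (𝓝 0)

open Classical in
/-- The multiple Wiener integral `𝐈_m(f)` (a chosen version of it). -/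
def multipleWienerIntegral {Ω : Type*} [MeasurableSpace Ω] (P : Measure Ω) {H : ℝ}
    (W : AbsH H → Ω → ℝ) {m : ℕ} (f : (Fin m → ℝ) → ℝ) : Ω → ℝ :=
  if h : ∃ X, IsMultipleWienerIntegral P W f X then h.choose else 0

end

/-! The argument is an L² approximation around an isometry. For jointly Gaussian centred X and Y,
integration by parts gives E[X^{⋄m} Y^{⋄m}] = m! (E[XY])^m (`integral_wickPower_mul_wickPower`).
Polarization turns every Wick polynomial in finitely many Gaussian variables into a combination of
Wick powers of linear forms. Its second moment is therefore m! times a quadratic form in the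
symmetrized coefficients (`integral_sum_wickProduct_sub_sq`).

For the U-statistic of f the coefficients are rescaled box integrals. The quadratic form is then ∫∫
f̂(s) f̂(t) ∏ K_N(s_k, t_k) ds dt, where K_N is the step kernel built from N^{2-2H} γ(i - j). This
kernel converges to |s - t|^{2H-2} off the diagonal and is bounded by a constant multiple of it. As
f has finite energy, dominated convergence applies (`tendsto_sum_boxCoeff`). Hence the squared L²
distance between the U-statistic of f and the discrete version of an elementary integral ∑ c_j
W(h_j)^{⋄m} tends to m! times the squared norm of f̂ - ∑ c_j h_j^{⊗m}
(`tendsto_integral_uStatistic_sub_sq`).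

The discrete elementary integrals converge jointly. They are fixed continuous functions of finitely
many Gaussian variables and of their variances, and the covariances converge by the case m = 1 of
the same limit (`tendstoInDistribution_elementary`). On the other probability space, the isometry
makes the elementary integrals of approximants of f̂ Cauchy in L² and their limit unique. A
converging-together theorem, `tendstoInDistribution_of_forall_approx`, combines the two sides.

What remains is density of elementary tensors (`exists_elementaryTensor_normSq_lt`). The
approximation is carried out in the energy of absolute values, which dominates the signed form. The
quasi-triangle inequality for this energy comes from writing |s - t|^{2H-2} as a composition of
one-sided power kernels, so that the energy is a squared L² norm. -/

noncomputable section

/-! ### Hermite polynomials with a variance parameter -/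

/-- The Hermite polynomial `v^{n/2} H_n(x / √v)` of variance `v`. -/
def wickPoly (v : ℝ) : ℕ → Polynomial ℝ
  | 0 => 1
  | n + 1 => Polynomial.X * wickPoly v n - Polynomial.C v * Polynomial.derivative (wickPoly v n)

/-- The Appell property. It converts the defining recursion into the three-term recursion on which
the later inductions run, and drives the integration by parts in the isometry. -/
lemma derivative_wickPoly_succ (v : ℝ) (n : ℕ) :
    Polynomial.derivative (wickPoly v (n + 1)) = ((n : Polynomial ℝ) + 1) * wickPoly v n := by
  induction n with
  | zero => simp [wickPoly]
  | succ n ih =>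
    rw [wickPoly, Polynomial.derivative_sub, Polynomial.derivative_mul, ih,
      Polynomial.derivative_mul, Polynomial.derivative_mul]
    have h : Polynomial.derivative ((n : Polynomial ℝ) + 1) = 0 := by simp
    rw [h]
    simp only [Polynomial.derivative_X, Polynomial.derivative_C]
    conv_rhs => rw [wickPoly]
    push_cast
    conv_lhs => rw [wickPoly]
    ring

lemma wickPoly_add_two (v : ℝ) (n : ℕ) :
    wickPoly v (n + 2) = Polynomial.X * wickPoly v (n + 1)
      - Polynomial.C v * (((n : Polynomial ℝ) + 1) * wickPoly v n) := by
  rw [← derivative_wickPoly_succ, wickPoly]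

/-- Continuity is joint in the variance and the argument because the variance of the discrete noise
changes with N. -/
lemma continuous_eval_wickPoly (n : ℕ) :
    Continuous fun p : ℝ × ℝ => (wickPoly p.1 n).eval p.2 := by
  induction n using Nat.twoStepInduction with
  | zero => simpa [wickPoly] using continuous_const
  | one => simpa [wickPoly] using continuous_snd
  | more n h1 h2 =>
    simp only [wickPoly_add_two, Polynomial.eval_sub, Polynomial.eval_mul, Polynomial.eval_X,
      Polynomial.eval_C, Polynomial.eval_add, Polynomial.eval_natCast, Polynomial.eval_one]
    fun_prop

lemma map_hermite (n : ℕ) :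
    (Polynomial.hermite n).map (Int.castRingHom ℝ) = wickPoly 1 n := by
  induction n with
  | zero => simp [wickPoly]
  | succ n ih => simp [wickPoly, Polynomial.hermite_succ, ← ih, Polynomial.derivative_map]

lemma wickPoly_scale {σ : ℝ} (hσ : σ ≠ 0) (x : ℝ) (n : ℕ) :
    σ ^ n * (wickPoly 1 n).eval (x / σ) = (wickPoly (σ ^ 2) n).eval x := by
  induction n using Nat.twoStepInduction with
  | zero => simp [wickPoly]
  | one => simp [wickPoly]; field_simp
  | more n h1 h2 =>
    simp only [wickPoly_add_two, Polynomial.eval_sub, Polynomial.eval_mul, Polynomial.eval_X,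
      Polynomial.eval_C, Polynomial.eval_add, Polynomial.eval_natCast, Polynomial.eval_one,
      ← h1, ← h2]
    field_simp
    ring

lemma wickPoly_zero_var (n : ℕ) : wickPoly 0 n = Polynomial.X ^ n := by
  induction n with
  | zero => simp [wickPoly]
  | succ n ih => simp [wickPoly, ih, pow_succ']

/-! ### Wick powers of Gaussian variables -/

section Wick

variable {Ω : Type*} [MeasurableSpace Ω] {P : Measure Ω}

/-- The polynomial form involves no division by the standard deviation. When the variance is zero
the two sides agree only where X = 0, hence almost everywhere. -/
lemma wickPower_ae_eq {X : Ω → ℝ} (hX : MemLp X 2 P) (n : ℕ) :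
    wickPower P X n =ᵐ[P] fun x => (wickPoly (∫ y, X y ^ 2 ∂P) n).eval (X x) := by
  have h0 : 0 ≤ ∫ y, X y ^ 2 ∂P := integral_nonneg fun y => sq_nonneg _
  rcases h0.eq_or_lt with h | h
  · have hX0 : (fun y => X y ^ 2) =ᵐ[P] 0 :=
      (integral_eq_zero_iff_of_nonneg (fun y => sq_nonneg _) hX.integrable_sq).1 h.symm
    filter_upwards [hX0] with x hx
    have hx' : X x = 0 := by simpa using hx
    rcases n with _ | n
    · simp [wickPower, wickPoly]
    · simp [wickPower, ← h, wickPoly_zero_var, hx']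
  · refine Eventually.of_forall fun x => ?_
    have hs : √(∫ y, X y ^ 2 ∂P) ≠ 0 := (Real.sqrt_pos.2 h).ne'
    have := wickPoly_scale hs (X x) n
    rw [Real.sq_sqrt h0] at this
    simp only [wickPower]
    rw [← this, ← map_hermite, Polynomial.eval_map, Polynomial.aeval_def]
    rfl

lemma memLp_pow_of_hasGaussianLaw {X : Ω → ℝ} (hX : HasGaussianLaw X P) (n : ℕ) :
    MemLp (fun x => X x ^ n) 2 P := by
  have := hX.isProbabilityMeasure
  rcases Nat.eq_zero_or_pos n with rfl | hn
  · simpa using memLp_const (1 : ℝ)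
  have h := (hX.memLp (p := (n : ℝ≥0∞) * 2) (by finiteness)).norm_rpow_div (n : ℝ≥0∞)
  have h2 : (n : ℝ≥0∞) * 2 / n = 2 := by
    rw [mul_comm, ENNReal.mul_div_cancel_right (by simp; omega) (by simp)]
  rw [h2] at h
  refine h.congr_norm (by have := hX.aemeasurable; fun_prop) ?_
  filter_upwards with x
  simp

lemma memLp_eval_of_hasGaussianLaw {X : Ω → ℝ} (hX : HasGaussianLaw X P) (p : Polynomial ℝ) :
    MemLp (fun x => p.eval (X x)) 2 P := by
  simp only [Polynomial.eval_eq_sum_range]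
  exact memLp_finsetSum _ fun i _ => (memLp_pow_of_hasGaussianLaw hX i).const_mul _

lemma memLp_wickPower {X : Ω → ℝ} (hX : HasGaussianLaw X P) (n : ℕ) :
    MemLp (wickPower P X n) 2 P :=
  (memLp_congr_ae (wickPower_ae_eq hX.memLp_two n)).2 (memLp_eval_of_hasGaussianLaw hX _)

/-! ### Gaussian integration by parts -/

/-- Stein's identity: the derivative of density times polynomial integrates to zero. For v = 0 the
law is a Dirac mass at 0 and both sides vanish. -/
lemma integral_id_mul_eval_gaussianReal (v : NNReal) (p : Polynomial ℝ) :
    ∫ x, x * p.eval x ∂(gaussianReal 0 v) =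
      v * ∫ x, (Polynomial.derivative p).eval x ∂(gaussianReal 0 v) := by
  rcases eq_or_ne v 0 with rfl | hv
  · simp [gaussianReal_zero_var]
  have hint : ∀ q : Polynomial ℝ, Integrable (fun x => gaussianPDFReal 0 v x * q.eval x) := by
    intro q
    have hG : HasGaussianLaw (id : ℝ → ℝ) (gaussianReal 0 v) := IsGaussian.hasGaussianLaw_id
    have h1 := (memLp_eval_of_hasGaussianLaw hG q).integrable (by norm_num)
    rw [gaussianReal_of_var_ne_zero _ hv, gaussianPDF_def,
      integrable_withDensity_iff_integrable_smul₀' (by fun_prop) (by simp)] at h1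
    refine h1.congr (Eventually.of_forall fun x => ?_)
    simp [ENNReal.toReal_ofReal (gaussianPDFReal_nonneg 0 v x)]
  have hv' : (v : ℝ) ≠ 0 := by exact_mod_cast hv
  rw [integral_gaussianReal_eq_integral_smul hv, integral_gaussianReal_eq_integral_smul hv]
  simp only [smul_eq_mul]
  have hderiv : ∀ x, HasDerivAt (fun x => gaussianPDFReal 0 v x * p.eval x)
      (gaussianPDFReal 0 v x * (Polynomial.derivative p).eval x
        - (v : ℝ)⁻¹ * (gaussianPDFReal 0 v x * (Polynomial.X * p).eval x)) x := by
    intro x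
    have h1 : HasDerivAt (fun x => gaussianPDFReal 0 v x)
        (-(v : ℝ)⁻¹ * x * gaussianPDFReal 0 v x) x := by
      simp only [gaussianPDFReal]
      have : HasDerivAt (fun x : ℝ => -(x - 0) ^ 2 / (2 * (v : ℝ))) (-(v : ℝ)⁻¹ * x) x := by
        have := (((hasDerivAt_id x).sub_const 0).pow 2).neg.div_const (2 * (v : ℝ))
        refine this.congr_deriv ?_
        simp
        field_simp
      refine (this.exp.const_mul _).congr_deriv ?_
      ring
    refine (h1.mul (p.hasDerivAt x)).congr_deriv ?_
    simp
    ring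
  have h0 := integral_eq_zero_of_hasDerivAt_of_integrable hderiv
    ((hint _).sub ((hint _).const_mul _)) (hint p)
  rw [integral_sub (hint _) ((hint _).const_mul _), integral_const_mul] at h0
  have h2 : ∫ x, gaussianPDFReal 0 v x * (x * p.eval x) =
      ∫ x, gaussianPDFReal 0 v x * (Polynomial.X * p).eval x := by simp
  rw [h2]
  field_simp at h0
  linarith

lemma integrable_eval_mul_eval {X Y : Ω → ℝ} (hX : HasGaussianLaw X P) (hY : HasGaussianLaw Y P)
    (p q : Polynomial ℝ) : Integrable (fun x => p.eval (X x) * q.eval (Y x)) P :=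
  (memLp_eval_of_hasGaussianLaw hX p).integrable_mul (memLp_eval_of_hasGaussianLaw hY q)

lemma map_eq_gaussianReal_of_centred {X : Ω → ℝ} (hX : HasGaussianLaw X P)
    (h0 : ∫ x, X x ∂P = 0) : P.map X = gaussianReal 0 (∫ x, X x ^ 2 ∂P).toNNReal := by
  have := hX.isProbabilityMeasure
  rw [hX.map_eq_gaussianReal, h0, variance_of_integral_eq_zero hX.aemeasurable h0]

/-- Gaussian integration by parts for polynomials of two jointly Gaussian variables. -/
lemma integral_mul_eval_mul_eval {X Y : Ω → ℝ} (hXY : HasGaussianLaw (fun x => (X x, Y x)) P)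
    (hX0 : ∫ x, X x ∂P = 0) (p q : Polynomial ℝ) :
    ∫ x, X x * (p.eval (X x) * q.eval (Y x)) ∂P =
      (∫ x, X x ^ 2 ∂P) * ∫ x, (Polynomial.derivative p).eval (X x) * q.eval (Y x) ∂P +
      (∫ x, X x * Y x ∂P) * ∫ x, p.eval (X x) * (Polynomial.derivative q).eval (Y x) ∂P := by
  have := hXY.isProbabilityMeasure
  have hX := hXY.fst
  have hY := hXY.snd
  set a := ∫ x, X x ^ 2 ∂P with ha
  set c := ∫ x, X x * Y x ∂P with hc
  have ha0 : 0 ≤ a := integral_nonneg fun y => sq_nonneg _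
  rcases ha0.eq_or_lt with h | h
  · have hX2 : (fun y => X y ^ 2) =ᵐ[P] 0 :=
      (integral_eq_zero_iff_of_nonneg (fun y => sq_nonneg _) hX.memLp_two.integrable_sq).1 h.symm
    have hXz : X =ᵐ[P] 0 := by
      filter_upwards [hX2] with x hx
      simpa using hx
    have hc0 : c = 0 := by
      rw [hc, integral_eq_zero_of_ae]
      filter_upwards [hXz] with x hx
      simp [hx]
    rw [hc0, ← h, integral_eq_zero_of_ae]
    · simp
    · filter_upwards [hXz] with x hx
      simp [hx]
  -- Regression of Y on X: the residual Z = Y - bX is uncorrelated with X, hence independent of it.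
  -- With Z frozen, Stein's identity in X applies to p(x) q(bx + z), and ab = c.
  set b := c / a with hb
  set Z : Ω → ℝ := fun x => Y x - b * X x with hZ
  have hXZ : HasGaussianLaw (fun x => (X x, Z x)) P := by
    have := hXY.map_fun ((ContinuousLinearMap.fst ℝ ℝ ℝ).prod
      (ContinuousLinearMap.snd ℝ ℝ ℝ - b • ContinuousLinearMap.fst ℝ ℝ ℝ))
    simpa using this
  have hcov : cov[X, Z; P] = 0 := by
    have hZm := hXZ.snd.memLp_two
    rw [covariance_eq_sub hX.memLp_two hZm, hX0, zero_mul, sub_zero]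
    have : (X * Z) = fun x => X x * Y x - b * X x ^ 2 := by
      ext x; simp [hZ]; ring
    have hi : Integrable (fun x => X x * Y x) P := hX.memLp_two.integrable_mul hY.memLp_two
    simp only [this]
    rw [integral_sub hi (hX.memLp_two.integrable_sq.const_mul _), integral_const_mul, ← hc, ← ha,
      hb]
    field_simp
    ring
  have hind : IndepFun X Z P := hXZ.indepFun_of_covariance_eq_zero hcov
  have hlaw := (indepFun_iff_map_prod_eq_prod_map_map hX.aemeasurable hXZ.snd.aemeasurable).1 hind
  have hYZ : ∀ x, Y x = b * X x + Z x := fun x => by simp [hZ]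
  have hprod : ∀ r : ℝ × ℝ → ℝ, Continuous r → Integrable (fun x => r (X x, Z x)) P →
      Integrable r ((P.map X).prod (P.map Z)) ∧
      ∫ x, r (X x, Z x) ∂P = ∫ z, ∫ y, r (y, z) ∂(P.map X) ∂(P.map Z) := by
    intro r hr hi
    have h1 : Integrable r ((P.map X).prod (P.map Z)) := by
      rw [← hlaw, integrable_map_measure hr.aestronglyMeasurable hXZ.aemeasurable]
      exact hi
    refine ⟨h1, ?_⟩
    rw [← integral_prod_symm _ h1, ← hlaw,
      integral_map hXZ.aemeasurable hr.aestronglyMeasurable]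
  have hi1 : Integrable (fun x => X x * (p.eval (X x) * q.eval (Y x))) P := by
    refine (integrable_eval_mul_eval hX hY (Polynomial.X * p) q).congr
      (Eventually.of_forall fun x => ?_)
    simp; ring
  have hi2 := integrable_eval_mul_eval hX hY (Polynomial.derivative p) q
  have hi3 := integrable_eval_mul_eval hX hY p (Polynomial.derivative q)
  simp only [hYZ] at hi1 hi2 hi3 ⊢
  have e1 := (hprod (fun w => w.1 * (p.eval w.1 * q.eval (b * w.1 + w.2)))
    (by fun_prop) hi1).2
  have e2 := hprod (fun w => (Polynomial.derivative p).eval w.1 * q.eval (b * w.1 + w.2))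
    (by fun_prop) hi2
  have e3 := hprod (fun w => p.eval w.1 * (Polynomial.derivative q).eval (b * w.1 + w.2))
    (by fun_prop) hi3
  simp only at e1 e2 e3
  rw [e1, e2.2, e3.2, ← integral_const_mul, ← integral_const_mul, ← integral_add]
  · refine integral_congr_ae ?_
    have hz : ∀ᵐ z ∂(P.map Z),
        Integrable (fun y => (Polynomial.derivative p).eval y * q.eval (b * y + z)) (P.map X) ∧
        Integrable (fun y => p.eval y * (Polynomial.derivative q).eval (b * y + z)) (P.map X) := by
      filter_upwards [e2.1.prod_left_ae, e3.1.prod_left_ae] with z h2 h3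
      exact ⟨h2, h3⟩
    filter_upwards [hz] with z hz
    have hg : P.map X = gaussianReal 0 a.toNNReal := map_eq_gaussianReal_of_centred hX hX0
    have key := integral_id_mul_eval_gaussianReal a.toNNReal
      (p * q.comp (Polynomial.C b * Polynomial.X + Polynomial.C z))
    rw [← hg, Real.coe_toNNReal a ha0] at key
    simp only [Polynomial.eval_mul, Polynomial.eval_comp, Polynomial.eval_add, Polynomial.eval_C,
      Polynomial.eval_X, Polynomial.derivative_mul, Polynomial.derivative_comp,
      Polynomial.derivative_add, Polynomial.derivative_C, Polynomial.derivative_X,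
      zero_mul, zero_add, add_zero, mul_one] at key
    rw [key, ← integral_const_mul, ← integral_const_mul, ← integral_const_mul,
      ← integral_add (hz.1.const_mul _) (hz.2.const_mul _)]
    congr 1
    ext y
    have hca : c = a * b := by
      rw [hb]
      field_simp
    rw [hca]
    ring
  · exact (e2.1.integral_prod_right).const_mul _
  · exact (e3.1.integral_prod_right).const_mul _

/-- Induction on the degree: integrating by parts the factor X of the recursion, the term with the
derivative of the left polynomial cancels the correction term of the recursion. The other term
lowers both degrees by one and contributes (n + 1) E[XY]. -/
lemma integral_wickPoly_mul_wickPoly {X Y : Ω → ℝ}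
    (hXY : HasGaussianLaw (fun x => (X x, Y x)) P)
    (hX0 : ∫ x, X x ∂P = 0) (n : ℕ) :
    ∫ x, (wickPoly (∫ y, X y ^ 2 ∂P) n).eval (X x) *
        (wickPoly (∫ y, Y y ^ 2 ∂P) n).eval (Y x) ∂P =
      n.factorial * (∫ x, X x * Y x ∂P) ^ n := by
  have := hXY.isProbabilityMeasure
  induction n with
  | zero => simp [wickPoly]
  | succ n ih =>
    set a := ∫ y, X y ^ 2 ∂P
    set b := ∫ y, Y y ^ 2 ∂P
    have h := integral_mul_eval_mul_eval hXY hX0 (wickPoly a n) (wickPoly b (n + 1))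
    have e : ∀ x, (wickPoly a (n + 1)).eval (X x) * (wickPoly b (n + 1)).eval (Y x) =
        X x * ((wickPoly a n).eval (X x) * (wickPoly b (n + 1)).eval (Y x)) -
        a * ((Polynomial.derivative (wickPoly a n)).eval (X x) *
          (wickPoly b (n + 1)).eval (Y x)) := by
      intro x
      rw [wickPoly]
      simp only [Polynomial.eval_sub, Polynomial.eval_mul, Polynomial.eval_X, Polynomial.eval_C]
      ring
    simp_rw [e]
    have hi1 : Integrable
        (fun x => X x * ((wickPoly a n).eval (X x) * (wickPoly b (n + 1)).eval (Y x))) P := by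
      refine (integrable_eval_mul_eval hXY.fst hXY.snd (Polynomial.X * wickPoly a n)
        (wickPoly b (n + 1))).congr (Eventually.of_forall fun x => ?_)
      simp; ring
    rw [integral_sub hi1 ((integrable_eval_mul_eval hXY.fst hXY.snd _ _).const_mul _),
      integral_const_mul, h, derivative_wickPoly_succ]
    have e2 : ∀ x, (wickPoly a n).eval (X x) *
        (((n : Polynomial ℝ) + 1) * wickPoly b n).eval (Y x) =
        (n + 1) * ((wickPoly a n).eval (X x) * (wickPoly b n).eval (Y x)) := by
      intro x; simp; ring
    simp_rw [e2]
    rw [integral_const_mul, ih, Nat.factorial_succ]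
    push_cast
    ring

lemma integral_wickPower_mul_wickPower {X Y : Ω → ℝ}
    (hXY : HasGaussianLaw (fun x => (X x, Y x)) P)
    (hX0 : ∫ x, X x ∂P = 0) (n : ℕ) :
    ∫ x, wickPower P X n x * wickPower P Y n x ∂P =
      n.factorial * (∫ x, X x * Y x ∂P) ^ n := by
  rw [← integral_wickPoly_mul_wickPoly hXY hX0 n]
  refine integral_congr_ae ?_
  filter_upwards [wickPower_ae_eq hXY.fst.memLp_two n, wickPower_ae_eq hXY.snd.memLp_two n]
    with x h1 h2
  rw [h1, h2]

/-- The second moment of a linear combination of Wick powers of the same degree. -/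
lemma integral_sum_wickPower_sq {ι : Type*} (s : Finset ι) (c : ι → ℝ) (X : ι → Ω → ℝ)
    (hX : ∀ i j, HasGaussianLaw (fun x => (X i x, X j x)) P) (hX0 : ∀ i, ∫ x, X i x ∂P = 0)
    (n : ℕ) :
    ∫ x, (∑ i ∈ s, c i * wickPower P (X i) n x) ^ 2 ∂P =
      n.factorial * ∑ i ∈ s, ∑ j ∈ s, c i * c j * (∫ x, X i x * X j x ∂P) ^ n := by
  have hm : ∀ i, MemLp (wickPower P (X i) n) 2 P := fun i => memLp_wickPower (hX i i).fst n
  have hint : ∀ i j, Integrable (fun x => c i * c j * (wickPower P (X i) n x *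
      wickPower P (X j) n x)) P := fun i j => ((hm i).integrable_mul (hm j)).const_mul _
  have e : ∀ x, (∑ i ∈ s, c i * wickPower P (X i) n x) ^ 2 =
      ∑ i ∈ s, ∑ j ∈ s, c i * c j * (wickPower P (X i) n x * wickPower P (X j) n x) := by
    intro x
    rw [sq, Finset.sum_mul_sum]
    refine Finset.sum_congr rfl fun i _ => Finset.sum_congr rfl fun j _ => by ring
  simp_rw [e]
  rw [integral_finsetSum _ fun i _ => integrable_finsetSum _ fun j _ => hint i j, Finset.mul_sum]
  refine Finset.sum_congr rfl fun i _ => ?_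
  rw [integral_finsetSum _ fun j _ => hint i j, Finset.mul_sum]
  refine Finset.sum_congr rfl fun j _ => ?_
  rw [integral_const_mul, integral_wickPower_mul_wickPower (hX i j) (hX0 i)]
  ring

end Wick

/-! ### Polarization -/

/-- Ryser's formula for the permanent. -/
lemma sum_neg_one_pow_prod_sum {m : ℕ} (x : Fin m → Fin m → ℝ) :
    ∑ S : Finset (Fin m), (-1 : ℝ) ^ (m - S.card) * ∏ k, ∑ i ∈ S, x i k =
      ∑ σ : Equiv.Perm (Fin m), ∏ k, x (σ k) k := by
  -- The product expands over the maps g with image inside S. The alternating sum over all S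
  -- containing that image vanishes unless the image is everything, so only bijections survive.
  have h1 : ∀ S : Finset (Fin m), ∏ k, ∑ i ∈ S, x i k =
      ∑ g : Fin m → Fin m, if Finset.univ.image g ⊆ S then ∏ k, x (g k) k else 0 := by
    intro S
    rw [Finset.prod_univ_sum, ← Finset.sum_filter]
    refine Finset.sum_congr ?_ fun _ _ => rfl
    ext g
    simp [Finset.image_subset_iff]
  have h2 : ∀ A : Finset (Fin m),
      ∑ S : Finset (Fin m), (if A ⊆ S then (-1 : ℝ) ^ (m - S.card) else 0) =
        if A = Finset.univ then 1 else 0 := by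
    intro A
    have e := Finset.sum_powerset_neg_one_pow_card (x := Aᶜ)
    rw [← Finset.sum_filter]
    have e' : ((∑ T ∈ Aᶜ.powerset, (-1 : ℤ) ^ T.card : ℤ) : ℝ) =
        ∑ S ∈ Finset.univ.filter (fun S => A ⊆ S), (-1 : ℝ) ^ (m - S.card) := by
      push_cast
      refine Finset.sum_nbij' (fun T => Tᶜ) (fun S => Sᶜ) ?_ ?_ ?_ ?_ ?_
      · intro T hT
        simp only [Finset.mem_powerset, Finset.mem_filter, Finset.mem_univ, true_and] at hT ⊢
        exact Finset.subset_compl_comm.1 hT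
      · intro S hS
        simp only [Finset.mem_powerset, Finset.mem_filter, Finset.mem_univ, true_and] at hS ⊢
        exact Finset.compl_subset_compl.2 hS
      · intro T _; simp
      · intro S _; simp
      · intro T _
        congr 1
        have := Finset.card_le_univ T
        rw [Finset.card_compl]
        simp only [Fintype.card_fin] at this ⊢
        omega
    rw [← e', e]
    simp [Finset.compl_eq_empty_iff]
  simp_rw [h1, Finset.mul_sum]
  rw [Finset.sum_comm]
  have h3 : ∀ g : Fin m → Fin m,
      ∑ S : Finset (Fin m), (-1 : ℝ) ^ (m - S.card) *
        (if Finset.univ.image g ⊆ S then ∏ k, x (g k) k else 0) =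
      if Function.Bijective g then ∏ k, x (g k) k else 0 := by
    intro g
    have : (Finset.univ.image g = Finset.univ) ↔ Function.Bijective g := by
      rw [Finset.eq_univ_iff_forall]
      have : (∀ x, x ∈ Finset.univ.image g) ↔ Function.Surjective g := by
        simp [Function.Surjective]
      rw [this]
      exact ⟨fun h => ⟨Finite.injective_iff_surjective.2 h, h⟩, fun h => h.2⟩
    rw [← if_congr this rfl rfl]
    have h := congrArg (· * ∏ k, x (g k) k) (h2 (Finset.univ.image g))
    simp only [Finset.sum_mul, ite_mul, zero_mul, one_mul] at h
    rw [← h]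
    refine Finset.sum_congr rfl fun S _ => ?_
    split_ifs <;> simp
  simp_rw [h3]
  rw [← Finset.sum_filter]
  symm
  refine Finset.sum_bij (fun σ _ => ⇑σ) ?_ ?_ ?_ ?_
  · intro σ _; exact Finset.mem_filter.2 ⟨Finset.mem_univ _, σ.bijective⟩
  · intro σ _ τ _ h; exact DFunLike.coe_injective h
  · intro g hg
    simp only [Finset.mem_filter, Finset.mem_univ, true_and] at hg
    exact ⟨Equiv.ofBijective g hg, Finset.mem_univ _, rfl⟩
  · intro σ _; rfl

/-! ### Second moments of Wick polynomials in finitely many Gaussian variables -/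

section Tensor

variable {Ω : Type*} [MeasurableSpace Ω] {P : Measure Ω} {κ : Type*} [Fintype κ]

lemma hasGaussianLaw_linear_pair {X : κ → Ω → ℝ} (hX : HasGaussianLaw (fun x n => X n x) P)
    (a b : κ → ℝ) :
    HasGaussianLaw (fun x => (∑ n, a n * X n x, ∑ n, b n * X n x)) P := by
  have := hX.map_fun
    ((∑ n, a n • ContinuousLinearMap.proj (R := ℝ) (φ := fun _ : κ => ℝ) n).prod
      (∑ n, b n • ContinuousLinearMap.proj (R := ℝ) (φ := fun _ : κ => ℝ) n))
  simpa [sum_apply] using this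

lemma integral_linear_mul_linear {X : κ → Ω → ℝ} (hX : HasGaussianLaw (fun x n => X n x) P)
    (a b : κ → ℝ) :
    ∫ x, (∑ n, a n * X n x) * (∑ n, b n * X n x) ∂P =
      ∑ n, ∑ n', a n * b n' * ∫ x, X n x * X n' x ∂P := by
  have hi : ∀ n n', Integrable (fun x => a n * b n' * (X n x * X n' x)) P := fun n n' =>
    ((hX.eval n).memLp_two.integrable_mul (hX.eval n').memLp_two).const_mul _
  have e : ∀ x, (∑ n, a n * X n x) * (∑ n, b n * X n x) =
      ∑ n, ∑ n', a n * b n' * (X n x * X n' x) := by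
    intro x
    rw [Finset.sum_mul_sum]
    refine Finset.sum_congr rfl fun i _ => Finset.sum_congr rfl fun j _ => by ring
  simp_rw [e]
  rw [integral_finsetSum _ fun i _ => integrable_finsetSum _ fun j _ => hi i j]
  refine Finset.sum_congr rfl fun i _ => ?_
  rw [integral_finsetSum _ fun j _ => hi i j]
  exact Finset.sum_congr rfl fun j _ => integral_const_mul _ _

lemma integral_linear {X : κ → Ω → ℝ} (hX : HasGaussianLaw (fun x n => X n x) P)
    (hX0 : ∀ n, ∫ x, X n x ∂P = 0) (a : κ → ℝ) : ∫ x, ∑ n, a n * X n x ∂P = 0 := by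
  rw [integral_finsetSum _ fun i _ => ((hX.eval i).integrable.const_mul _)]
  simp [integral_const_mul, hX0]

/-- The second moment of a combination of Wick powers of linear forms, through its tensor. -/
lemma integral_sum_wickPower_linear_sq {ι : Type*} (s : Finset ι) (c : ι → ℝ) (A : ι → κ → ℝ)
    {X : κ → Ω → ℝ} (hX : HasGaussianLaw (fun x n => X n x) P)
    (hX0 : ∀ n, ∫ x, X n x ∂P = 0) (m : ℕ) :
    ∫ x, (∑ i ∈ s, c i * wickPower P (fun y => ∑ n, A i n * X n y) m x) ^ 2 ∂P =
      m.factorial * ∑ n : Fin m → κ, ∑ n' : Fin m → κ,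
        (∑ i ∈ s, c i * ∏ k, A i (n k)) * (∑ i ∈ s, c i * ∏ k, A i (n' k)) *
          ∏ k, ∫ x, X (n k) x * X (n' k) x ∂P := by
  rw [integral_sum_wickPower_sq s c (fun i y => ∑ n, A i n * X n y)
    (fun i j => hasGaussianLaw_linear_pair hX _ _) (fun i => integral_linear hX hX0 _) m]
  congr 1
  simp_rw [integral_linear_mul_linear hX]
  have e : ∀ i j, (∑ n, ∑ n', A i n * A j n' * ∫ x, X n x * X n' x ∂P) ^ m =
      ∑ n : Fin m → κ, ∑ n' : Fin m → κ,
        (∏ k, A i (n k)) * (∏ k, A j (n' k)) * ∏ k, ∫ x, X (n k) x * X (n' k) x ∂P := by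
    intro i j
    rw [← Fin.prod_const, Finset.prod_univ_sum, Fintype.piFinset_univ]
    refine Finset.sum_congr rfl fun n _ => ?_
    rw [Finset.prod_univ_sum, Fintype.piFinset_univ]
    refine Finset.sum_congr rfl fun n' _ => ?_
    rw [Finset.prod_mul_distrib, Finset.prod_mul_distrib]
  simp_rw [e]
  calc _ = ∑ i ∈ s, ∑ j ∈ s, ∑ n : Fin m → κ, ∑ n' : Fin m → κ, (c i * ∏ k, A i (n k)) *
        (c j * ∏ k, A j (n' k)) * ∏ k, ∫ x, X (n k) x * X (n' k) x ∂P := by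
        refine Finset.sum_congr rfl fun i _ => Finset.sum_congr rfl fun j _ => ?_
        simp_rw [Finset.mul_sum]
        refine Finset.sum_congr rfl fun n _ => Finset.sum_congr rfl fun n' _ => by ring
    _ = _ := by
        simp_rw [Finset.sum_mul_sum, Finset.sum_mul]
        have h1 : ∀ i, ∑ j ∈ s, ∑ n : Fin m → κ, ∑ n' : Fin m → κ, (c i * ∏ k, A i (n k)) *
            (c j * ∏ k, A j (n' k)) * ∏ k, ∫ x, X (n k) x * X (n' k) x ∂P =
            ∑ n : Fin m → κ, ∑ n' : Fin m → κ, ∑ j ∈ s, (c i * ∏ k, A i (n k)) *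
            (c j * ∏ k, A j (n' k)) * ∏ k, ∫ x, X (n k) x * X (n' k) x ∂P := by
          intro i
          rw [Finset.sum_comm]
          exact Finset.sum_congr rfl fun n _ => Finset.sum_comm
        simp_rw [h1]
        rw [Finset.sum_comm]
        exact Finset.sum_congr rfl fun n _ => Finset.sum_comm

/-- The symmetrization of a finite tensor. -/
def symTensor {m : ℕ} (w : (Fin m → κ) → ℝ) (n : Fin m → κ) : ℝ :=
  ((m.factorial : ℝ))⁻¹ * ∑ σ : Equiv.Perm (Fin m), w (fun k => n (σ k))

/-- The linear form ∑_{i ∈ S} X_{n_i} has a sum of indicators as its coefficient vector. By Ryser's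
formula, the tensor of the polarized Wick polynomial with coefficients w is the symmetrization of w.
-/
lemma sum_polarized_tensor [DecidableEq κ] {m : ℕ} (w : (Fin m → κ) → ℝ) (n' : Fin m → κ) :
    ∑ p : (Fin m → κ) × Finset (Fin m),
      (w p.1 * (((m.factorial : ℝ))⁻¹ * (-1 : ℝ) ^ (m - p.2.card))) *
        ∏ k, ∑ i ∈ p.2, (if p.1 i = n' k then (1 : ℝ) else 0) = symTensor w n' := by
  rw [Fintype.sum_prod_type]
  have h : ∀ n : Fin m → κ, ∑ S : Finset (Fin m),
      (w n * (((m.factorial : ℝ))⁻¹ * (-1 : ℝ) ^ (m - S.card))) *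
        ∏ k, ∑ i ∈ S, (if n i = n' k then (1 : ℝ) else 0) =
      ((m.factorial : ℝ))⁻¹ * ∑ σ : Equiv.Perm (Fin m),
        if n = (fun k => n' (σ k)) then w n else 0 := by
    intro n
    have h1 := sum_neg_one_pow_prod_sum fun i k => if n i = n' k then (1 : ℝ) else 0
    have h2 : ∀ σ : Equiv.Perm (Fin m), ∏ k, (if n (σ k) = n' k then (1 : ℝ) else 0) =
        if n = (fun k => n' (σ⁻¹ k)) then 1 else 0 := by
      intro σ
      rw [Finset.prod_ite_zero]
      simp only [Finset.mem_univ, forall_const, Finset.prod_const_one]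
      refine if_congr ?_ rfl rfl
      constructor
      · intro h; ext k; simpa using h (σ⁻¹ k)
      · intro h k; rw [h]; simp
    simp_rw [h2] at h1
    calc _ = w n * ((m.factorial : ℝ))⁻¹ * ∑ S : Finset (Fin m), (-1 : ℝ) ^ (m - S.card) *
          ∏ k, ∑ i ∈ S, (if n i = n' k then (1 : ℝ) else 0) := by
          rw [Finset.mul_sum]
          exact Finset.sum_congr rfl fun S _ => by ring
      _ = _ := by
          rw [h1, ← Equiv.sum_comp (Equiv.inv (Equiv.Perm (Fin m)))]
          simp only [Equiv.inv_apply, inv_inv, Finset.mul_sum]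
          refine Finset.sum_congr rfl fun σ _ => ?_
          split_ifs <;> ring
  simp_rw [h]
  rw [← Finset.mul_sum, Finset.sum_comm, symTensor]
  simp

/-- The second moment of the difference between a Wick polynomial with coefficients `w` and a
combination of Wick powers of linear forms. -/
lemma integral_sum_wickProduct_sub_sq [DecidableEq κ] {ι : Type*} (s : Finset ι) (c : ι → ℝ) (A : ι → κ → ℝ)
    {X : κ → Ω → ℝ} (hX : HasGaussianLaw (fun x n => X n x) P)
    (hX0 : ∀ n, ∫ x, X n x ∂P = 0) {m : ℕ} (w : (Fin m → κ) → ℝ) :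
    ∫ x, (∑ n, w n * wickProduct P (fun k => X (n k)) x -
        ∑ i ∈ s, c i * wickPower P (fun y => ∑ n, A i n * X n y) m x) ^ 2 ∂P =
      m.factorial * ∑ n : Fin m → κ, ∑ n' : Fin m → κ,
        (symTensor w n - ∑ i ∈ s, c i * ∏ k, A i (n k)) *
        (symTensor w n' - ∑ i ∈ s, c i * ∏ k, A i (n' k)) *
          ∏ k, ∫ x, X (n k) x * X (n' k) x ∂P := by
  -- The difference is one combination of Wick powers over a disjoint union: the polarization terms
  -- on the left, the given terms with opposite sign on the right. The isometry then applies to it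
  -- as a whole.
  let c' : ((Fin m → κ) × Finset (Fin m)) ⊕ ι → ℝ :=
    Sum.elim (fun p => w p.1 * (((m.factorial : ℝ))⁻¹ * (-1 : ℝ) ^ (m - p.2.card)))
      (fun i => -c i)
  let A' : ((Fin m → κ) × Finset (Fin m)) ⊕ ι → κ → ℝ :=
    Sum.elim (fun p n => ∑ i ∈ p.2, (if p.1 i = n then (1 : ℝ) else 0)) A
  have key := integral_sum_wickPower_linear_sq
    ((Finset.univ : Finset ((Fin m → κ) × Finset (Fin m))).disjSum s) c' A' hX hX0 m
  have hv : ∀ n : Fin m → κ, ∑ i ∈ (Finset.univ :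
      Finset ((Fin m → κ) × Finset (Fin m))).disjSum s, c' i * ∏ k, A' i (n k) =
      symTensor w n - ∑ i ∈ s, c i * ∏ k, A i (n k) := by
    intro n
    rw [Finset.sum_disjSum, ← sum_polarized_tensor w n]
    simp [c', A', sub_eq_add_neg]
  simp_rw [hv] at key
  rw [← key]
  refine integral_congr_ae (Eventually.of_forall fun x => ?_)
  refine congrArg (fun z : ℝ => z ^ 2) ?_
  rw [Finset.sum_disjSum, Fintype.sum_prod_type, sub_eq_add_neg]
  congr 1
  · refine Finset.sum_congr rfl fun n _ => ?_
    rw [wickProduct, Finset.mul_sum, Finset.mul_sum]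
    refine Finset.sum_congr rfl fun S _ => ?_
    have : (fun y => ∑ n', A' (Sum.inl (n, S)) n' * X n' y) = fun y => ∑ i ∈ S, X (n i) y := by
      ext y
      simp only [A', Sum.elim_inl, Finset.sum_mul]
      rw [Finset.sum_comm]
      simp
    rw [this]
    simp only [c', Sum.elim_inl]
    ring
  · simp [c', A']

lemma memLp_wickProduct {m : ℕ} {X : Fin m → Ω → ℝ} (hX : HasGaussianLaw (fun x n => X n x) P) :
    MemLp (wickProduct P X) 2 P := by
  have h : ∀ S : Finset (Fin m), MemLp (wickPower P (fun y => ∑ i ∈ S, X i y) m) 2 P := by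
    intro S
    refine memLp_wickPower ?_ m
    have := hX.map_fun
      (∑ n ∈ S, ContinuousLinearMap.proj (R := ℝ) (φ := fun _ : Fin m => ℝ) n)
    simpa [sum_apply] using this
  have h2 := memLp_finsetSum (Finset.univ : Finset (Finset (Fin m)))
    (fun S _ => (h S).const_mul ((-1 : ℝ) ^ (m - S.card)))
  exact h2.const_mul _

end Tensor

/-! ### Fubini for lower integrals of product functions -/

lemma lintegral_fin_prod_eq_prod {m : ℕ} {E : Type*} [MeasurableSpace E] (μ : Measure E)
    [SigmaFinite μ] (f : Fin m → E → ℝ≥0∞) (hf : ∀ i, AEMeasurable (f i) μ) :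
    ∫⁻ x, ∏ i, f i (x i) ∂(Measure.pi fun _ : Fin m => μ) = ∏ i, ∫⁻ x, f i x ∂μ := by
  induction m with
  | zero => simp
  | succ m ih =>
    have h := (measurePreserving_piFinSuccAbove (fun _ : Fin (m + 1) => μ) 0).symm
    rw [← h.lintegral_comp_emb (MeasurableEquiv.measurableEmbedding _)]
    have e : ∀ x : E × (Fin m → E), ∏ i, f i
        (((MeasurableEquiv.piFinSuccAbove (fun _ : Fin (m + 1) => E) 0).symm x) i) =
        f 0 x.1 * ∏ i : Fin m, f i.succ (x.2 i) := by
      intro x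
      rw [Fin.prod_univ_succ]
      simp [MeasurableEquiv.piFinSuccAbove_symm_apply, Fin.insertNthEquiv]
    simp_rw [e]
    have hm : AEMeasurable (fun y : Fin m → E => ∏ i : Fin m, f i.succ (y i))
        (Measure.pi fun _ : Fin m => μ) := by
      refine Finset.aemeasurable_fun_prod _ fun i _ => ?_
      exact (hf i.succ).comp_quasiMeasurePreserving (Measure.quasiMeasurePreserving_eval _ i)
    rw [lintegral_prod_mul (hf 0) hm, ih _ fun i => hf i.succ, Fin.prod_univ_succ]

/-! ### The kernel -/

section Kernel

variable {H : ℝ}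

/-- The one-sided power `r₊^{H-3/2}`. -/
def rieszFactor (H r : ℝ) : ℝ≥0∞ := if 0 < r then ENNReal.ofReal (r ^ (H - 3 / 2)) else 0

@[fun_prop]
lemma measurable_rieszFactor (H : ℝ) : Measurable (rieszFactor H) := by
  unfold rieszFactor
  exact Measurable.ite measurableSet_Ioi (by fun_prop) measurable_const

lemma rieszFactor_mul {d : ℝ} (hd : 0 < d) (w : ℝ) :
    rieszFactor H (d * w) = ENNReal.ofReal (d ^ (H - 3 / 2)) * rieszFactor H w := by
  unfold rieszFactor
  by_cases hw : 0 < w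
  · rw [if_pos (mul_pos hd hw), if_pos hw, Real.mul_rpow hd.le hw.le,
      ENNReal.ofReal_mul (by positivity)]
  · rw [if_neg hw, if_neg, mul_zero]
    rwa [mul_pos_iff_of_pos_left hd]

/-- The constant `∫ w₊^{H-3/2} (1+w)₊^{H-3/2} dw`. -/
def rieszConst (H : ℝ) : ℝ≥0∞ := ∫⁻ w, rieszFactor H w * rieszFactor H (1 + w)

/-- Near 0 the integrand is at most w^{H-3/2}, integrable since H > 1/2; beyond 1 it is at most
w^{2H-3}, integrable since H < 1. -/
lemma rieszConst_ne_top (hH : 1 / 2 < H) (hH' : H < 1) : rieszConst H ≠ ∞ := by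
  have h1 : IntegrableOn (fun w : ℝ => w ^ (H - 3 / 2)) (Set.Ioc 0 1) :=
    (intervalIntegrable_iff_integrableOn_Ioc_of_le zero_le_one).1
      (intervalIntegral.intervalIntegrable_rpow' (by linarith))
  have h2 : IntegrableOn (fun w : ℝ => w ^ (2 * H - 3)) (Set.Ioi 1) :=
    integrableOn_Ioi_rpow_of_lt (by linarith) one_pos
  have hle : ∀ w, rieszFactor H w * rieszFactor H (1 + w) ≤
      (Set.Ioc (0 : ℝ) 1).indicator (fun w => ENNReal.ofReal (w ^ (H - 3 / 2))) w +
      (Set.Ioi (1 : ℝ)).indicator (fun w => ENNReal.ofReal (w ^ (2 * H - 3))) w := by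
    intro w
    unfold rieszFactor
    by_cases hw : 0 < w
    · rw [if_pos hw, if_pos (by linarith), ← ENNReal.ofReal_mul (by positivity)]
      by_cases hw1 : w ≤ 1
      · rw [Set.indicator_of_mem (show w ∈ Set.Ioc (0 : ℝ) 1 from ⟨hw, hw1⟩)]
        refine le_trans (ENNReal.ofReal_le_ofReal ?_) le_self_add
        refine mul_le_of_le_one_right (by positivity) ?_
        exact Real.rpow_le_one_of_one_le_of_nonpos (by linarith) (by linarith)
      · rw [Set.indicator_of_mem (show w ∈ Set.Ioi (1 : ℝ) from not_le.1 hw1)]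
        refine le_trans (ENNReal.ofReal_le_ofReal ?_) le_add_self
        have : w ^ (2 * H - 3) = w ^ (H - 3 / 2) * w ^ (H - 3 / 2) := by
          rw [← Real.rpow_add hw]; congr 1; ring
        rw [this]
        exact mul_le_mul_of_nonneg_left
          (Real.rpow_le_rpow_of_nonpos hw (by linarith) (by linarith)) (by positivity)
    · rw [if_neg hw, zero_mul]
      exact zero_le
  refine ne_of_lt (lt_of_le_of_lt (lintegral_mono hle) ?_)
  rw [lintegral_add_left ((by fun_prop : Measurable fun w : ℝ =>
      ENNReal.ofReal (w ^ (H - 3 / 2))).indicator measurableSet_Ioc),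
    lintegral_indicator measurableSet_Ioc, lintegral_indicator measurableSet_Ioi]
  exact ENNReal.add_lt_top.2 ⟨Integrable.lintegral_lt_top h1, Integrable.lintegral_lt_top h2⟩

lemma rieszConst_ne_zero : rieszConst H ≠ 0 := by
  unfold rieszConst
  rw [← pos_iff_ne_zero, lintegral_pos_iff_support (by fun_prop)]
  refine lt_of_lt_of_le (b := volume (Set.Ioi (0 : ℝ))) (by simp) (measure_mono fun w hw => ?_)
  have hw : 0 < w := hw
  have hw' : 0 < 1 + w := by linarith
  simp only [Function.mem_support, rieszFactor, if_pos hw, if_pos hw', ne_eq, mul_eq_zero,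
    ENNReal.ofReal_eq_zero, not_or, not_le]
  exact ⟨by positivity, by positivity⟩

/-- The kernel `|s - t|^{2H-2}` as a composition of one-sided power kernels. -/
lemma lintegral_rieszFactor_mul {s t : ℝ} (hst : s ≠ t) :
    ∫⁻ u, rieszFactor H (s - u) * rieszFactor H (t - u) =
      rieszConst H * ENNReal.ofReal (|s - t| ^ (2 * H - 2)) := by
  wlog h : s < t generalizing s t
  · have := this hst.symm (lt_of_le_of_ne (not_lt.1 h) hst.symm)
    rw [abs_sub_comm, ← this]
    exact lintegral_congr fun u => mul_comm _ _
  -- The substitution u = s - dw pulls out d · d^{2H-3} = d^{2H-2} and leaves the integral defining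
  -- the constant.
  set d := t - s with hd
  have hd0 : 0 < d := by rw [hd]; linarith
  have h1 : ∫⁻ u, rieszFactor H (s - u) * rieszFactor H (t - u) =
      ∫⁻ v, rieszFactor H v * rieszFactor H (d + v) := by
    rw [← lintegral_sub_left_eq_self _ s]
    refine lintegral_congr fun u => ?_
    congr 2 <;> ring
  have h2 : ∫⁻ v, rieszFactor H v * rieszFactor H (d + v) =
      ENNReal.ofReal d * ∫⁻ w, rieszFactor H (d * w) * rieszFactor H (d + d * w) := by
    conv_lhs => rw [← Real.smul_map_volume_mul_left hd0.ne']
    rw [lintegral_smul_measure, lintegral_map (by fun_prop) (by fun_prop), abs_of_pos hd0]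
    rfl
  have h3 : ∀ w, rieszFactor H (d * w) * rieszFactor H (d + d * w) =
      ENNReal.ofReal (d ^ (2 * H - 3)) * (rieszFactor H w * rieszFactor H (1 + w)) := by
    intro w
    have : d + d * w = d * (1 + w) := by ring
    rw [this, rieszFactor_mul hd0, rieszFactor_mul hd0]
    have : d ^ (2 * H - 3) = d ^ (H - 3 / 2) * d ^ (H - 3 / 2) := by
      rw [← Real.rpow_add hd0]; congr 1; ring
    rw [this, ENNReal.ofReal_mul (by positivity)]
    ring
  rw [h1, h2]
  simp_rw [h3]
  rw [lintegral_const_mul _ (by fun_prop), ← mul_assoc, ← ENNReal.ofReal_mul hd0.le, mul_comm]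
  have : |s - t| = d := by rw [abs_sub_comm, abs_of_pos hd0]
  rw [rieszConst, this]
  congr 2
  nth_rw 1 [← Real.rpow_one d]
  rw [← Real.rpow_add hd0]
  congr 1; ring

/-- Uniform bound for the integrals of the kernel over the unit interval. -/
lemma exists_lintegral_kernel_le (hH : 1 / 2 < H) :
    ∃ B : ℝ≥0∞, B ≠ ∞ ∧ ∀ s ∈ Set.Icc (0 : ℝ) 1,
      ∫⁻ t in Set.Icc (0 : ℝ) 1, ENNReal.ofReal (|s - t| ^ (2 * H - 2)) ≤ B := by
  have hi : IntegrableOn (fun v : ℝ => |v| ^ (2 * H - 2)) (Metric.ball 0 2) := by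
    refine integrableOn_ball_of_norm_le_rpow (C := 1) (α := 2 - 2 * H) (by simp) (by simp; linarith)
      ?_ (by fun_prop : Measurable fun v : ℝ => |v| ^ (2 * H - 2)).aestronglyMeasurable
    refine Eventually.of_forall fun x => ?_
    rw [one_mul, Real.norm_of_nonneg (by positivity), Real.norm_eq_abs]
    apply le_of_eq
    congr 1; ring
  refine ⟨∫⁻ v in Metric.ball (0 : ℝ) 2, ENNReal.ofReal (|v| ^ (2 * H - 2)),
    (Integrable.lintegral_lt_top hi).ne, fun s hs => ?_⟩
  rw [← lintegral_indicator measurableSet_Icc, ← lintegral_indicator Metric.isOpen_ball.measurableSet,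
    ← lintegral_sub_left_eq_self _ s]
  refine lintegral_mono fun v => ?_
  by_cases h : s - v ∈ Set.Icc (0 : ℝ) 1
  · rw [Set.indicator_of_mem h, Set.indicator_of_mem]
    · simp
    · rw [Metric.mem_ball, dist_zero_right, Real.norm_eq_abs, abs_lt]
      constructor <;> linarith [hs.1, hs.2, h.1, h.2]
  · rw [Set.indicator_of_notMem h]
    exact zero_le

end Kernel

/-! ### The cube -/

/-- Lebesgue measure on `[0,1]^m`. -/
abbrev cubeMeasure (m : ℕ) : Measure (Fin m → ℝ) := volume.restrict (Set.Icc 0 1)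

lemma cubeMeasure_eq_pi (m : ℕ) :
    cubeMeasure m = Measure.pi fun _ => volume.restrict (Set.Icc (0 : ℝ) 1) := by
  rw [← Measure.restrict_pi_pi, cubeMeasure, ← Set.pi_univ_Icc]
  rfl

instance (m : ℕ) : IsProbabilityMeasure (cubeMeasure m) := by
  have : IsProbabilityMeasure (volume.restrict (Set.Icc (0 : ℝ) 1)) := ⟨by simp⟩
  rw [cubeMeasure_eq_pi]
  infer_instance

lemma ae_cubeMeasure_ne {m : ℕ} (s : Fin m → ℝ) : ∀ᵐ t ∂(cubeMeasure m), ∀ i, s i ≠ t i := by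
  rw [ae_all_iff, cubeMeasure_eq_pi]
  intro i
  filter_upwards [Measure.ae_eval_ne (μ := fun _ : Fin m => volume.restrict (Set.Icc (0 : ℝ) 1))
    i (s i)] with t ht
  exact ht.symm

/-- The faces t_i = 0 are discarded because the half-open grid cells cover only (0,1]. -/
lemma ae_cubeMeasure_mem (m : ℕ) : ∀ᵐ t ∂(cubeMeasure m), ∀ i, t i ∈ Set.Ioc (0 : ℝ) 1 := by
  filter_upwards [ae_cubeMeasure_ne (0 : Fin m → ℝ),
    ae_restrict_mem (μ := volume) (measurableSet_Icc (a := (0 : Fin m → ℝ)) (b := 1))] with t h1 h2 i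
  exact ⟨lt_of_le_of_ne (h2.1 i) (h1 i), h2.2 i⟩

lemma measurePreserving_perm_cubeMeasure {m : ℕ} (σ : Equiv.Perm (Fin m)) :
    MeasurePreserving (fun (t : Fin m → ℝ) i => t (σ i)) (cubeMeasure m) (cubeMeasure m) := by
  rw [cubeMeasure_eq_pi]
  have := measurePreserving_arrowCongr'
    (fun _ : Fin m => volume.restrict (Set.Icc (0 : ℝ) 1))
    (fun _ : Fin m => volume.restrict (Set.Icc (0 : ℝ) 1)) σ.symm (MeasurableEquiv.refl ℝ)
    (fun i => MeasurePreserving.id _)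
  exact this

/-! ### The energy of a nonnegative function -/

section Energy

variable {H : ℝ} {m : ℕ}

lemma tensorKernel_nonneg (s t : Fin m → ℝ) : 0 ≤ tensorKernel H s t :=
  Finset.prod_nonneg fun _ _ => by positivity

lemma measurable_tensorKernel :
    Measurable fun p : (Fin m → ℝ) × (Fin m → ℝ) => tensorKernel H p.1 p.2 := by
  unfold tensorKernel
  fun_prop

lemma measurable_tensorKernel_left (s : Fin m → ℝ) : Measurable fun t => tensorKernel H s t := by
  unfold tensorKernel
  fun_prop

lemma tensorKernel_perm (σ : Equiv.Perm (Fin m)) (s t : Fin m → ℝ) :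
    tensorKernel H (fun i => s (σ i)) (fun i => t (σ i)) = tensorKernel H s t :=
  Equiv.prod_comp σ fun i => |s i - t i| ^ (2 * H - 2)

lemma tensorKernel_comm (s t : Fin m → ℝ) : tensorKernel H s t = tensorKernel H t s :=
  Finset.prod_congr rfl fun _ _ => by rw [abs_sub_comm]

/-- The energy `∫∫ F(s) F(t) ∏ |sᵢ - tᵢ|^{2H-2} ds dt` of `F : [0,1]^m → [0,∞]`. -/
def kernelEnergy (H : ℝ) (F : (Fin m → ℝ) → ℝ≥0∞) : ℝ≥0∞ :=
  ∫⁻ s, ∫⁻ t, F s * F t * ENNReal.ofReal (tensorKernel H s t) ∂(cubeMeasure m) ∂(cubeMeasure m)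

lemma kernelEnergy_mono {F G : (Fin m → ℝ) → ℝ≥0∞} (h : F ≤ᵐ[cubeMeasure m] G) :
    kernelEnergy H F ≤ kernelEnergy H G := by
  refine lintegral_mono_ae ?_
  filter_upwards [h] with s hs
  refine lintegral_mono_ae ?_
  filter_upwards [h] with t ht
  gcongr

lemma kernelEnergy_congr {F G : (Fin m → ℝ) → ℝ≥0∞} (h : F =ᵐ[cubeMeasure m] G) :
    kernelEnergy H F = kernelEnergy H G :=
  le_antisymm (kernelEnergy_mono h.le) (kernelEnergy_mono h.symm.le)

lemma kernelEnergy_const_mul (a : ℝ≥0∞) (ha : a ≠ ∞) (F : (Fin m → ℝ) → ℝ≥0∞) :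
    kernelEnergy H (fun s => a * F s) = a ^ 2 * kernelEnergy H F := by
  unfold kernelEnergy
  have h : ∀ s t, a * F s * (a * F t) * ENNReal.ofReal (tensorKernel H s t) =
      a ^ 2 * (F s * F t * ENNReal.ofReal (tensorKernel H s t)) := fun s t => by ring
  simp_rw [h]
  rw [← lintegral_const_mul' _ _ (by finiteness)]
  exact lintegral_congr fun s => lintegral_const_mul' _ _ (by finiteness)

lemma lintegral_prod_rieszFactor {s t : Fin m → ℝ} (hst : ∀ i, s i ≠ t i) :
    ∫⁻ u : Fin m → ℝ, (∏ i, rieszFactor H (s i - u i)) * ∏ i, rieszFactor H (t i - u i) =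
      rieszConst H ^ m * ENNReal.ofReal (tensorKernel H s t) := by
  simp_rw [← Finset.prod_mul_distrib]
  rw [volume_pi, lintegral_fin_prod_eq_prod volume
    (fun i u => rieszFactor H (s i - u) * rieszFactor H (t i - u))
    fun i => (by fun_prop : Measurable _).aemeasurable]
  simp_rw [lintegral_rieszFactor_mul (hst _)]
  rw [Finset.prod_mul_distrib, tensorKernel, ENNReal.ofReal_prod_of_nonneg]
  · simp
  · intro i _; positivity

/-- Factoring the kernel through one-sided powers and applying Tonelli displays the energy as the
squared L² norm of the potential of F. This is the source of its positive definiteness. -/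
lemma kernelEnergy_eq_lintegral_sq {F : (Fin m → ℝ) → ℝ≥0∞}
    (hF : AEMeasurable F (cubeMeasure m)) :
    rieszConst H ^ m * kernelEnergy H F =
      ∫⁻ u : Fin m → ℝ, (∫⁻ s, F s * ∏ i, rieszFactor H (s i - u i) ∂(cubeMeasure m)) ^ 2 := by
  wlog hFm : Measurable F generalizing F
  · rw [kernelEnergy_congr hF.ae_eq_mk, this hF.measurable_mk.aemeasurable hF.measurable_mk]
    refine lintegral_congr fun u => ?_
    congr 1
    refine lintegral_congr_ae ?_
    filter_upwards [hF.ae_eq_mk] with s hs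
    rw [hs]
  have hK := measurable_tensorKernel (H := H) (m := m)
  let Φ : (Fin m → ℝ) → (Fin m → ℝ) → ℝ≥0∞ := fun s u => ∏ i, rieszFactor H (s i - u i)
  have hΦ : Measurable (Function.uncurry Φ) := by
    simp only [Φ, Function.uncurry_def]
    fun_prop
  have hΦs : ∀ s, Measurable (Φ s) := fun s => hΦ.comp measurable_prodMk_left
  have hΦu : ∀ u, Measurable fun s => Φ s u := fun u => hΦ.comp measurable_prodMk_right
  have h1 : rieszConst H ^ m * kernelEnergy H F =
      ∫⁻ s, ∫⁻ t, (∫⁻ u, (F s * Φ s u) * (F t * Φ t u)) ∂(cubeMeasure m) ∂(cubeMeasure m) := by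
    unfold kernelEnergy
    rw [← lintegral_const_mul]
    · refine lintegral_congr fun s => ?_
      rw [← lintegral_const_mul]
      · refine lintegral_congr_ae ?_
        filter_upwards [ae_cubeMeasure_ne s] with t ht
        have : ∀ u, (F s * Φ s u) * (F t * Φ t u) = (F s * F t) * (Φ s u * Φ t u) :=
          fun u => by ring
        simp_rw [this]
        have hm2 : Measurable fun u => Φ s u * Φ t u := (hΦs s).mul (hΦs t)
        rw [lintegral_const_mul _ hm2, lintegral_prod_rieszFactor ht]
        ring
      · have := measurable_tensorKernel_left (H := H) s
        fun_prop
    · refine Measurable.lintegral_prod_right' (f := fun p : (Fin m → ℝ) × (Fin m → ℝ) =>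
        F p.1 * F p.2 * ENNReal.ofReal (tensorKernel H p.1 p.2)) ?_
      fun_prop
  rw [h1]
  have hFΦ : ∀ u, Measurable fun t => F t * Φ t u := fun u => hFm.mul (hΦu u)
  have h2 : ∀ s, ∫⁻ t, (∫⁻ u, (F s * Φ s u) * (F t * Φ t u)) ∂(cubeMeasure m) =
      ∫⁻ u, (F s * Φ s u) * ∫⁻ t, F t * Φ t u ∂(cubeMeasure m) := by
    intro s
    rw [lintegral_lintegral_swap]
    · refine lintegral_congr fun u => ?_
      rw [lintegral_const_mul _ (hFΦ u)]
    · refine Measurable.aemeasurable ?_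
      refine Measurable.mul ?_ ?_
      · exact ((hΦs s).comp measurable_snd).const_mul _
      · exact (hFm.comp measurable_fst).mul hΦ
  simp_rw [h2]
  have hJ : Measurable fun u => ∫⁻ t, F t * Φ t u ∂(cubeMeasure m) :=
    Measurable.lintegral_prod_left' (f := fun p : (Fin m → ℝ) × (Fin m → ℝ) => F p.1 * Φ p.1 p.2)
      ((hFm.comp measurable_fst).mul hΦ)
  rw [lintegral_lintegral_swap]
  · refine lintegral_congr fun u => ?_
    rw [lintegral_mul_const _ (hFΦ u), sq]
  · exact (((hFm.comp measurable_fst).mul hΦ).mul (hJ.comp measurable_snd)).aemeasurable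

/-- Bounding every term by the largest one costs a factor equal to the cardinality compared with
Cauchy–Schwarz, which is harmless here. -/
lemma sq_sum_le_card_sq_mul_sum_sq {ι : Type*} (s : Finset ι) (x : ι → ℝ≥0∞) :
    (∑ i ∈ s, x i) ^ 2 ≤ (s.card : ℝ≥0∞) ^ 2 * ∑ i ∈ s, x i ^ 2 := by
  rcases s.eq_empty_or_nonempty with rfl | hs
  · simp
  obtain ⟨j, hj, hmax⟩ := s.exists_max_image x hs
  calc (∑ i ∈ s, x i) ^ 2 ≤ (s.card * x j) ^ 2 := by
        gcongr
        simpa using Finset.sum_le_card_nsmul s x (x j) hmax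
    _ = (s.card : ℝ≥0∞) ^ 2 * x j ^ 2 := mul_pow _ _ _
    _ ≤ _ := by
        gcongr
        exact Finset.single_le_sum (f := fun i => x i ^ 2) (fun _ _ => zero_le) hj

/-- The potential is linear in F, so the elementary inequality for squares applies at each u under
the L² representation. The constant, being finite and nonzero, cancels. -/
lemma kernelEnergy_sum_le (hH : 1 / 2 < H) (hH' : H < 1) {ι : Type*} (s : Finset ι)
    {F : ι → (Fin m → ℝ) → ℝ≥0∞} (hF : ∀ i ∈ s, AEMeasurable (F i) (cubeMeasure m)) :
    kernelEnergy H (fun t => ∑ i ∈ s, F i t) ≤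
      (s.card : ℝ≥0∞) ^ 2 * ∑ i ∈ s, kernelEnergy H (F i) := by
  have h0 : rieszConst H ^ m ≠ 0 := pow_ne_zero _ rieszConst_ne_zero
  have ht : rieszConst H ^ m ≠ ∞ := ENNReal.pow_ne_top (rieszConst_ne_top hH hH')
  rw [← ENNReal.mul_le_mul_iff_right h0 ht, kernelEnergy_eq_lintegral_sq
    (Finset.aemeasurable_fun_sum s hF), mul_left_comm, Finset.mul_sum]
  have e : ∀ i ∈ s, rieszConst H ^ m * kernelEnergy H (F i) = _ :=
    fun i hi => kernelEnergy_eq_lintegral_sq (hF i hi)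
  rw [Finset.sum_congr rfl e]
  have hΦ : ∀ u : Fin m → ℝ, Measurable fun s : Fin m → ℝ => ∏ i, rieszFactor H (s i - u i) :=
    fun u => by fun_prop
  calc _ = ∫⁻ u : Fin m → ℝ, (∑ i ∈ s, ∫⁻ t, F i t * ∏ j, rieszFactor H (t j - u j)
          ∂(cubeMeasure m)) ^ 2 := by
        refine lintegral_congr fun u => ?_
        simp_rw [Finset.sum_mul]
        have hm2 : ∀ i ∈ s, AEMeasurable (fun t => F i t * ∏ j, rieszFactor H (t j - u j))
            (cubeMeasure m) := fun i hi => (hF i hi).mul (hΦ u).aemeasurable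
        rw [lintegral_finsetSum' _ hm2]
    _ ≤ ∫⁻ u : Fin m → ℝ, (s.card : ℝ≥0∞) ^ 2 * ∑ i ∈ s, (∫⁻ t, F i t *
          ∏ j, rieszFactor H (t j - u j) ∂(cubeMeasure m)) ^ 2 :=
        lintegral_mono fun u => sq_sum_le_card_sq_mul_sum_sq s _
    _ = _ := by
        rw [lintegral_const_mul' _ _ (by finiteness)]
        rw [lintegral_finsetSum']
        intro i hi
        refine AEMeasurable.pow_const ?_ 2
        have hm := hF i hi
        have : (fun u : Fin m → ℝ => ∫⁻ t, F i t * ∏ j, rieszFactor H (t j - u j)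
            ∂(cubeMeasure m)) = fun u => ∫⁻ t, hm.mk _ t * ∏ j, rieszFactor H (t j - u j)
            ∂(cubeMeasure m) := by
          ext u
          refine lintegral_congr_ae ?_
          filter_upwards [hm.ae_eq_mk] with t ht
          rw [ht]
        rw [this]
        refine Measurable.aemeasurable (Measurable.lintegral_prod_left'
          (f := fun p : (Fin m → ℝ) × (Fin m → ℝ) =>
            hm.mk _ p.1 * ∏ j, rieszFactor H (p.1 j - p.2 j)) ?_)
        have := hm.measurable_mk
        fun_prop

lemma kernelEnergy_add_le (hH : 1 / 2 < H) (hH' : H < 1) {F G : (Fin m → ℝ) → ℝ≥0∞}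
    (hF : AEMeasurable F (cubeMeasure m)) (hG : AEMeasurable G (cubeMeasure m)) :
    kernelEnergy H (fun t => F t + G t) ≤ 4 * (kernelEnergy H F + kernelEnergy H G) := by
  have h := kernelEnergy_sum_le hH hH' (Finset.univ : Finset (Fin 2)) (F := ![F, G])
    (by intro i _; fin_cases i <;> simpa)
  simp only [Fin.sum_univ_two, Finset.card_univ, Fintype.card_fin] at h
  norm_num at h
  exact h

lemma kernelEnergy_perm (σ : Equiv.Perm (Fin m)) {F : (Fin m → ℝ) → ℝ≥0∞} :
    kernelEnergy H (fun t => F fun i => t (σ i)) = kernelEnergy H F := by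
  have hσ := measurePreserving_perm_cubeMeasure σ
  have hemb : MeasurableEmbedding (fun (t : Fin m → ℝ) i => t (σ i)) :=
    (MeasurableEquiv.arrowCongr' σ.symm (MeasurableEquiv.refl ℝ)).measurableEmbedding
  unfold kernelEnergy
  conv_rhs => rw [← hσ.lintegral_comp_emb hemb]
  refine lintegral_congr fun s => ?_
  conv_rhs => rw [← hσ.lintegral_comp_emb hemb]
  simp_rw [tensorKernel_perm]

lemma exists_lintegral_tensorKernel_le (hH : 1 / 2 < H) (m : ℕ) :
    ∃ B : ℝ≥0∞, B ≠ ∞ ∧ ∀ᵐ s ∂(cubeMeasure m),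
      ∫⁻ t, ENNReal.ofReal (tensorKernel H s t) ∂(cubeMeasure m) ≤ B := by
  obtain ⟨B, hB, h⟩ := exists_lintegral_kernel_le hH
  refine ⟨B ^ m, ENNReal.pow_ne_top hB, ?_⟩
  filter_upwards [ae_cubeMeasure_mem m] with s hs
  have e : ∀ t, ENNReal.ofReal (tensorKernel H s t) =
      ∏ i, ENNReal.ofReal (|s i - t i| ^ (2 * H - 2)) := fun t =>
    ENNReal.ofReal_prod_of_nonneg fun i _ => by positivity
  simp_rw [e]
  rw [cubeMeasure_eq_pi, lintegral_fin_prod_eq_prod _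
    (fun i t => ENNReal.ofReal (|s i - t| ^ (2 * H - 2)))
    fun i => (by fun_prop : Measurable _).aemeasurable]
  calc _ ≤ ∏ _i : Fin m, B := Finset.prod_le_prod' fun i _ => h _ ⟨(hs i).1.le, (hs i).2⟩
    _ = B ^ m := by simp

/-- The energy is controlled by the `L²` norm. -/
lemma exists_kernelEnergy_le_lintegral_sq (hH : 1 / 2 < H) (m : ℕ) :
    ∃ B : ℝ≥0∞, B ≠ ∞ ∧ ∀ F : (Fin m → ℝ) → ℝ≥0∞, AEMeasurable F (cubeMeasure m) →
      kernelEnergy H F ≤ B * ∫⁻ s, F s ^ 2 ∂(cubeMeasure m) := by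
  obtain ⟨B, hB, h⟩ := exists_lintegral_tensorKernel_le hH m
  refine ⟨2 * B, by finiteness, fun F hF => ?_⟩
  have hK := measurable_tensorKernel (H := H) (m := m)
  -- A Schur test: F(s)F(t) is split into two squares, and each is integrated against the kernel in
  -- the free variable, which costs the uniform bound B.
  have hxy : ∀ x y : ℝ≥0∞, x * y ≤ x ^ 2 + y ^ 2 := by
    intro x y
    rcases le_total x y with hxy | hxy
    · exact le_trans (by rw [sq]; gcongr) le_add_self
    · exact le_trans (by rw [sq]; gcongr) le_self_add
  have hA : ∫⁻ s, ∫⁻ t, F s ^ 2 * ENNReal.ofReal (tensorKernel H s t) ∂(cubeMeasure m)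
      ∂(cubeMeasure m) ≤ B * ∫⁻ s, F s ^ 2 ∂(cubeMeasure m) := by
    rw [← lintegral_const_mul'' _ (hF.pow_const 2)]
    refine lintegral_mono_ae ?_
    filter_upwards [h] with s hs
    rw [lintegral_const_mul _ (measurable_tensorKernel_left s).ennreal_ofReal, mul_comm]
    gcongr
  have hswap : ∫⁻ s, ∫⁻ t, F t ^ 2 * ENNReal.ofReal (tensorKernel H s t) ∂(cubeMeasure m)
      ∂(cubeMeasure m) = ∫⁻ s, ∫⁻ t, F s ^ 2 * ENNReal.ofReal (tensorKernel H s t)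
      ∂(cubeMeasure m) ∂(cubeMeasure m) := by
    rw [lintegral_lintegral_swap]
    · simp_rw [tensorKernel_comm]
    · exact ((hF.comp_snd.pow_const 2).mul hK.ennreal_ofReal.aemeasurable)
  calc kernelEnergy H F ≤ ∫⁻ s, ∫⁻ t, (F s ^ 2 * ENNReal.ofReal (tensorKernel H s t) +
        F t ^ 2 * ENNReal.ofReal (tensorKernel H s t)) ∂(cubeMeasure m) ∂(cubeMeasure m) := by
        refine lintegral_mono fun s => lintegral_mono fun t => ?_
        rw [← add_mul]
        gcongr
        exact hxy _ _
    _ = ∫⁻ s, (∫⁻ t, F s ^ 2 * ENNReal.ofReal (tensorKernel H s t) ∂(cubeMeasure m) +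
        ∫⁻ t, F t ^ 2 * ENNReal.ofReal (tensorKernel H s t) ∂(cubeMeasure m))
        ∂(cubeMeasure m) := by
        refine lintegral_congr fun s => ?_
        rw [lintegral_add_left]
        exact (measurable_tensorKernel_left s).ennreal_ofReal.const_mul _
    _ ≤ _ := by
        rw [lintegral_add_left', hswap, mul_assoc, two_mul]
        · exact add_le_add hA hA
        · refine AEMeasurable.lintegral_prod_right' (f := fun p : (Fin m → ℝ) × (Fin m → ℝ) =>
            F p.1 ^ 2 * ENNReal.ofReal (tensorKernel H p.1 p.2)) ?_
          exact ((hF.comp_fst.pow_const 2).mul hK.ennreal_ofReal.aemeasurable)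

/-- On the unit cube |s_i - t_i| ≤ 1 and the exponent is negative, so the kernel is at least 1.
Hence elements of |𝓗|^{⊗m} are integrable and their box averages are genuine. -/
lemma sq_lintegral_le_kernelEnergy (hH' : H < 1) {F : (Fin m → ℝ) → ℝ≥0∞}
    (hF : AEMeasurable F (cubeMeasure m)) :
    (∫⁻ s, F s ∂(cubeMeasure m)) ^ 2 ≤ kernelEnergy H F := by
  rw [sq, ← lintegral_mul_const'' _ hF]
  refine lintegral_mono_ae ?_
  filter_upwards [ae_cubeMeasure_mem m] with s hs
  rw [← lintegral_const_mul'' _ hF]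
  refine lintegral_mono_ae ?_
  filter_upwards [ae_cubeMeasure_mem m, ae_cubeMeasure_ne s] with t ht hst
  conv_lhs => rw [← mul_one (F s * F t)]
  gcongr
  rw [ENNReal.one_le_ofReal]
  refine Finset.prod_induction _ (fun x : ℝ => 1 ≤ x)
    (fun a b ha hb => one_le_mul_of_one_le_of_one_le ha hb) le_rfl fun i _ => ?_
  refine Real.one_le_rpow_of_pos_of_le_one_of_nonpos (abs_pos.2 (sub_ne_zero.2 (hst i))) ?_
    (by linarith)
  rw [abs_le]
  constructor <;> linarith [(hs i).1, (hs i).2, (ht i).1, (ht i).2]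

end Energy

/-! ### The space `|𝓗|^{⊗ m}` -/

section Space

variable {H : ℝ} {m : ℕ}

lemma memAbsHTensor_iff {f : (Fin m → ℝ) → ℝ} :
    MemAbsHTensor H f ↔
      AEMeasurable f (cubeMeasure m) ∧ kernelEnergy H (fun s => ‖f s‖ₑ) < ∞ := by
  have : ∫⁻ s in Set.Icc (0 : Fin m → ℝ) 1, ∫⁻ t in Set.Icc (0 : Fin m → ℝ) 1,
      ENNReal.ofReal (|f s * f t| * tensorKernel H s t) = kernelEnergy H (fun s => ‖f s‖ₑ) := by
    refine lintegral_congr fun s => lintegral_congr fun t => ?_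
    simp only [Real.enorm_eq_ofReal_abs]
    rw [ENNReal.ofReal_mul (abs_nonneg _), abs_mul, ENNReal.ofReal_mul (abs_nonneg _)]
  rw [MemAbsHTensor, this]

namespace MemAbsHTensor

variable {f g : (Fin m → ℝ) → ℝ}

lemma aemeasurable (hf : MemAbsHTensor H f) : AEMeasurable f (cubeMeasure m) := hf.1

lemma energy_lt_top (hf : MemAbsHTensor H f) : kernelEnergy H (fun s => ‖f s‖ₑ) < ∞ :=
  (memAbsHTensor_iff.1 hf).2

lemma of_abs_le (hf : MemAbsHTensor H f) (hg : AEMeasurable g (cubeMeasure m))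
    (h : ∀ᵐ s ∂(cubeMeasure m), |g s| ≤ |f s|) : MemAbsHTensor H g := by
  refine memAbsHTensor_iff.2 ⟨hg, lt_of_le_of_lt (kernelEnergy_mono ?_) hf.energy_lt_top⟩
  filter_upwards [h] with s hs
  rw [Real.enorm_eq_ofReal_abs, Real.enorm_eq_ofReal_abs]
  exact ENNReal.ofReal_le_ofReal hs

lemma add (hH : 1 / 2 < H) (hH' : H < 1) (hf : MemAbsHTensor H f) (hg : MemAbsHTensor H g) :
    MemAbsHTensor H (fun t => f t + g t) := by
  refine memAbsHTensor_iff.2 ⟨hf.1.add hg.1, ?_⟩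
  refine lt_of_le_of_lt (kernelEnergy_mono (Eventually.of_forall fun s => enorm_add_le _ _)) ?_
  refine lt_of_le_of_lt (kernelEnergy_add_le hH hH' hf.1.enorm hg.1.enorm) ?_
  have h1 := hf.energy_lt_top
  have h2 := hg.energy_lt_top
  finiteness

lemma const_mul (hf : MemAbsHTensor H f) (a : ℝ) : MemAbsHTensor H (fun t => a * f t) := by
  refine memAbsHTensor_iff.2 ⟨hf.1.const_mul a, ?_⟩
  simp_rw [enorm_mul]
  rw [kernelEnergy_const_mul _ (by finiteness)]
  have h1 := hf.energy_lt_top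
  finiteness

lemma sub (hH : 1 / 2 < H) (hH' : H < 1) (hf : MemAbsHTensor H f) (hg : MemAbsHTensor H g) :
    MemAbsHTensor H (fun t => f t - g t) := by
  have := hf.add hH hH' (hg.const_mul (-1))
  simpa [sub_eq_add_neg] using this

lemma zero : MemAbsHTensor H (fun _ : Fin m → ℝ => 0) :=
  memAbsHTensor_iff.2 ⟨aemeasurable_const, by simp [kernelEnergy]⟩

lemma sum (hH : 1 / 2 < H) (hH' : H < 1) {ι : Type*} (s : Finset ι)
    {F : ι → (Fin m → ℝ) → ℝ} (hF : ∀ i ∈ s, MemAbsHTensor H (F i)) :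
    MemAbsHTensor H (fun t => ∑ i ∈ s, F i t) := by
  classical
  induction s using Finset.induction_on with
  | empty => simpa using zero
  | insert i s hi ih =>
    simp_rw [Finset.sum_insert hi]
    exact (hF i (Finset.mem_insert_self _ _)).add hH hH'
      (ih fun j hj => hF j (Finset.mem_insert_of_mem hj))

lemma perm (hf : MemAbsHTensor H f) (σ : Equiv.Perm (Fin m)) :
    MemAbsHTensor H (fun t => f fun i => t (σ i)) := by
  refine memAbsHTensor_iff.2 ⟨hf.aemeasurable.comp_quasiMeasurePreserving
    (measurePreserving_perm_cubeMeasure σ).quasiMeasurePreserving, ?_⟩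
  have := kernelEnergy_perm (H := H) σ (F := fun s => ‖f s‖ₑ)
  rw [this]
  exact hf.energy_lt_top

lemma symmetrization (hH : 1 / 2 < H) (hH' : H < 1) (hf : MemAbsHTensor H f) :
    MemAbsHTensor H (symmetrization f) :=
  (sum hH hH' Finset.univ fun σ _ => hf.perm σ).const_mul _

lemma integrable_kernel_self (hf : MemAbsHTensor H f) :
    Integrable (fun p : (Fin m → ℝ) × (Fin m → ℝ) => f p.1 * f p.2 * tensorKernel H p.1 p.2)
      ((cubeMeasure m).prod (cubeMeasure m)) := by
  have hm : AEMeasurable (fun p : (Fin m → ℝ) × (Fin m → ℝ) =>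
      f p.1 * f p.2 * tensorKernel H p.1 p.2) ((cubeMeasure m).prod (cubeMeasure m)) :=
    (hf.1.comp_fst.mul hf.1.comp_snd).mul measurable_tensorKernel.aemeasurable
  refine ⟨hm.aestronglyMeasurable, ?_⟩
  rw [HasFiniteIntegral, lintegral_prod _ hm.enorm]
  refine lt_of_le_of_lt (le_of_eq ?_) hf.energy_lt_top
  refine lintegral_congr fun s => lintegral_congr fun t => ?_
  rw [enorm_mul, enorm_mul, Real.enorm_of_nonneg (tensorKernel_nonneg s t)]

/-- The mixed product is dominated by the diagonal one of |f| + |g|, whose energy is finite because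
the space is closed under addition. -/
lemma integrable_kernel (hH : 1 / 2 < H) (hH' : H < 1) (hf : MemAbsHTensor H f)
    (hg : MemAbsHTensor H g) :
    Integrable (fun p : (Fin m → ℝ) × (Fin m → ℝ) => f p.1 * g p.2 * tensorKernel H p.1 p.2)
      ((cubeMeasure m).prod (cubeMeasure m)) := by
  have hf' : MemAbsHTensor H (fun t => |f t|) :=
    hf.of_abs_le hf.1.abs (Eventually.of_forall fun s => by simp)
  have hg' : MemAbsHTensor H (fun t => |g t|) :=
    hg.of_abs_le hg.1.abs (Eventually.of_forall fun s => by simp)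
  refine (hf'.add hH hH' hg').integrable_kernel_self.mono'
    ((hf.1.comp_fst.mul hg.1.comp_snd).mul
      measurable_tensorKernel.aemeasurable).aestronglyMeasurable
    (Eventually.of_forall fun p => ?_)
  rw [Real.norm_eq_abs, abs_mul, abs_mul, abs_of_nonneg (tensorKernel_nonneg p.1 p.2)]
  refine mul_le_mul_of_nonneg_right ?_ (tensorKernel_nonneg _ _)
  exact mul_le_mul (le_add_of_nonneg_right (abs_nonneg _)) (le_add_of_nonneg_left (abs_nonneg _))
    (abs_nonneg _) (by positivity)

lemma integrable (hH' : H < 1) (hf : MemAbsHTensor H f) : Integrable f (cubeMeasure m) := by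
  refine ⟨hf.1.aestronglyMeasurable, ?_⟩
  have h := lt_of_le_of_lt (sq_lintegral_le_kernelEnergy hH' hf.1.enorm) hf.energy_lt_top
  by_contra hc
  rw [HasFiniteIntegral, not_lt, top_le_iff] at hc
  rw [hc] at h
  simp at h

end MemAbsHTensor

/-- The inner product of `|𝓗|^{⊗ m}`. -/
def innerHTensor (H : ℝ) (f g : (Fin m → ℝ) → ℝ) : ℝ :=
  ∫ p, f p.1 * g p.2 * tensorKernel H p.1 p.2 ∂((cubeMeasure m).prod (cubeMeasure m))

variable {f g : (Fin m → ℝ) → ℝ}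

lemma normSqHTensor_eq_inner (hf : MemAbsHTensor H f) :
    normSqHTensor H f = innerHTensor H f f :=
  (integral_prod _ hf.integrable_kernel_self).symm

/-- Reduces approximation for the signed form to the monotone energy of absolute values. -/
lemma ofReal_abs_normSqHTensor_le (hf : MemAbsHTensor H f) :
    ENNReal.ofReal |normSqHTensor H f| ≤ kernelEnergy H (fun s => ‖f s‖ₑ) := by
  rw [normSqHTensor_eq_inner hf, innerHTensor, ← Real.norm_eq_abs, ofReal_norm]
  refine (enorm_integral_le_lintegral_enorm _).trans (le_of_eq ?_)
  rw [lintegral_prod _ hf.integrable_kernel_self.aemeasurable.enorm]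
  refine lintegral_congr fun s => lintegral_congr fun t => ?_
  rw [enorm_mul, enorm_mul, Real.enorm_of_nonneg (tensorKernel_nonneg s t)]

lemma innerHTensor_comm (f g : (Fin m → ℝ) → ℝ) : innerHTensor H f g = innerHTensor H g f := by
  unfold innerHTensor
  rw [← integral_prod_swap]
  refine integral_congr_ae (Eventually.of_forall fun p => ?_)
  simp only [Prod.fst_swap, Prod.snd_swap]
  rw [tensorKernel_comm, mul_comm (f _)]

lemma normSqHTensor_add (hH : 1 / 2 < H) (hH' : H < 1) (hf : MemAbsHTensor H f)
    (hg : MemAbsHTensor H g) :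
    normSqHTensor H (fun t => f t + g t) =
      normSqHTensor H f + 2 * innerHTensor H f g + normSqHTensor H g := by
  rw [normSqHTensor_eq_inner hf, normSqHTensor_eq_inner hg,
    normSqHTensor_eq_inner (hf.add hH hH' hg)]
  have e : innerHTensor H (fun t => f t + g t) (fun t => f t + g t) =
      (innerHTensor H f f + innerHTensor H f g) +
        (innerHTensor H g f + innerHTensor H g g) := by
    unfold innerHTensor
    rw [← integral_add hf.integrable_kernel_self (hf.integrable_kernel hH hH' hg),
      ← integral_add (hg.integrable_kernel hH hH' hf) hg.integrable_kernel_self,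
      ← integral_add]
    · refine integral_congr_ae (Eventually.of_forall fun p => ?_)
      simp only
      ring
    · exact hf.integrable_kernel_self.add (hf.integrable_kernel hH hH' hg)
    · exact (hg.integrable_kernel hH hH' hf).add hg.integrable_kernel_self
  rw [e, innerHTensor_comm g f]
  ring

lemma innerHTensor_neg_right (f g : (Fin m → ℝ) → ℝ) :
    innerHTensor H f (fun t => -g t) = -innerHTensor H f g := by
  unfold innerHTensor
  rw [← integral_neg]
  refine integral_congr_ae (Eventually.of_forall fun p => ?_)
  simp only
  ring

lemma normSqHTensor_neg (f : (Fin m → ℝ) → ℝ) :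
    normSqHTensor H (fun t => -f t) = normSqHTensor H f := by
  simp [normSqHTensor]

/-- The parallelogram law. Once the form is known to be nonnegative, dropping the last term yields a
quasi-triangle inequality. -/
lemma normSqHTensor_sub_eq (hH : 1 / 2 < H) (hH' : H < 1) (hf : MemAbsHTensor H f)
    (hg : MemAbsHTensor H g) :
    normSqHTensor H (fun t => f t - g t) =
      2 * normSqHTensor H f + 2 * normSqHTensor H g - normSqHTensor H (fun t => f t + g t) := by
  have hg' : MemAbsHTensor H (fun t => -g t) := by simpa using hg.const_mul (-1)
  have h1 := normSqHTensor_add hH hH' hf hg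
  have h2 := normSqHTensor_add hH hH' hf hg'
  rw [innerHTensor_neg_right, normSqHTensor_neg] at h2
  simp only [← sub_eq_add_neg] at h2
  rw [h1, h2]
  ring

/-! ### Elementary tensors -/

/-- Both the function and the kernel factor over the coordinates, so the energy is the m-th power of
the one-dimensional energy. -/
lemma memAbsHTensor_tensorPower (h : AbsH H) (m : ℕ) :
    MemAbsHTensor H (fun t : Fin m → ℝ => ∏ i, h.1 (t i)) := by
  obtain ⟨h, hm, he⟩ := h
  refine memAbsHTensor_iff.2 ⟨?_, ?_⟩
  · rw [cubeMeasure_eq_pi]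
    refine Finset.aemeasurable_fun_prod _ fun i _ => ?_
    exact hm.comp_quasiMeasurePreserving (Measure.quasiMeasurePreserving_eval _ i)
  · have hk : ∀ s : Fin m → ℝ,
        ∫⁻ t, ‖∏ i, h (s i)‖ₑ * ‖∏ i, h (t i)‖ₑ * ENNReal.ofReal (tensorKernel H s t)
          ∂(cubeMeasure m) = ∏ i, ∫⁻ t in Set.Icc (0 : ℝ) 1,
            ENNReal.ofReal (|h (s i) * h t| * |s i - t| ^ (2 * H - 2)) := by
      intro s
      rw [cubeMeasure_eq_pi, ← lintegral_fin_prod_eq_prod _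
        (fun i t => ENNReal.ofReal (|h (s i) * h t| * |s i - t| ^ (2 * H - 2)))]
      · refine lintegral_congr fun t => ?_
        rw [tensorKernel, ← enorm_mul, ← Finset.prod_mul_distrib, Real.enorm_eq_ofReal_abs,
          ← ENNReal.ofReal_mul (abs_nonneg _), Finset.abs_prod, ← Finset.prod_mul_distrib,
          ENNReal.ofReal_prod_of_nonneg]
        intro i _
        positivity
      · intro i
        have : Measurable fun t => |s i - t| ^ (2 * H - 2) := by fun_prop
        exact ((hm.const_mul _).abs.mul this.aemeasurable).ennreal_ofReal
    unfold kernelEnergy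
    simp_rw [hk]
    have hme : AEMeasurable (fun s => ∫⁻ t in Set.Icc (0 : ℝ) 1,
        ENNReal.ofReal (|h s * h t| * |s - t| ^ (2 * H - 2)))
        (volume.restrict (Set.Icc (0 : ℝ) 1)) := by
      refine AEMeasurable.lintegral_prod_right' (f := fun p : ℝ × ℝ =>
        ENNReal.ofReal (|h p.1 * h p.2| * |p.1 - p.2| ^ (2 * H - 2))) ?_
      have : Measurable fun p : ℝ × ℝ => |p.1 - p.2| ^ (2 * H - 2) := by fun_prop
      exact ((hm.comp_fst.mul hm.comp_snd).abs.mul this.aemeasurable).ennreal_ofReal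
    rw [cubeMeasure_eq_pi, lintegral_fin_prod_eq_prod _ (fun _ s => ∫⁻ t in Set.Icc (0 : ℝ) 1,
        ENNReal.ofReal (|h s * h t| * |s - t| ^ (2 * H - 2))) (fun _ => hme)]
    simp only [Finset.prod_const]
    exact ENNReal.pow_lt_top he

lemma memAbsHTensor_elementaryTensor (hH : 1 / 2 < H) (hH' : H < 1) (m : ℕ) (c : AbsH H →₀ ℝ) :
    MemAbsHTensor H (elementaryTensor m c) :=
  MemAbsHTensor.sum hH hH' c.support fun h _ => (memAbsHTensor_tensorPower h m).const_mul (c h)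

lemma innerHTensor_tensorPower (hH : 1 / 2 < H) (hH' : H < 1) (h g : AbsH H) (m : ℕ) :
    innerHTensor H (fun t : Fin m → ℝ => ∏ i, h.1 (t i)) (fun t => ∏ i, g.1 (t i)) =
      innerH H h.1 g.1 ^ m := by
  unfold innerHTensor innerH
  rw [integral_prod _ ((memAbsHTensor_tensorPower h m).integrable_kernel hH hH'
    (memAbsHTensor_tensorPower g m))]
  have e : ∀ s : Fin m → ℝ, ∫ t, (∏ i, h.1 (s i)) * (∏ i, g.1 (t i)) * tensorKernel H s t
      ∂(cubeMeasure m) = ∏ i, ∫ t in Set.Icc (0 : ℝ) 1,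
        h.1 (s i) * g.1 t * |s i - t| ^ (2 * H - 2) := by
    intro s
    rw [cubeMeasure_eq_pi, ← integral_fintype_prod_eq_prod
      (fun i t => h.1 (s i) * g.1 t * |s i - t| ^ (2 * H - 2))]
    refine integral_congr_ae (Eventually.of_forall fun t => ?_)
    simp only [tensorKernel, Finset.prod_mul_distrib]
  simp only [e]
  rw [cubeMeasure_eq_pi, integral_fintype_prod_eq_prod
    (fun _ s => ∫ t in Set.Icc (0 : ℝ) 1, h.1 s * g.1 t * |s - t| ^ (2 * H - 2))]
  simp

lemma normSqHTensor_elementaryTensor (hH : 1 / 2 < H) (hH' : H < 1) (m : ℕ) (c : AbsH H →₀ ℝ) :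
    normSqHTensor H (elementaryTensor m c) =
      ∑ h ∈ c.support, ∑ g ∈ c.support, c h * c g * innerH H h.1 g.1 ^ m := by
  rw [normSqHTensor_eq_inner (memAbsHTensor_elementaryTensor hH hH' m c), innerHTensor]
  have hi : ∀ h g : AbsH H, Integrable (fun p : (Fin m → ℝ) × (Fin m → ℝ) => c h * c g *
      ((∏ i, h.1 (p.1 i)) * (∏ i, g.1 (p.2 i)) * tensorKernel H p.1 p.2))
      ((cubeMeasure m).prod (cubeMeasure m)) := fun h g =>
    ((memAbsHTensor_tensorPower h m).integrable_kernel hH hH'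
      (memAbsHTensor_tensorPower g m)).const_mul _
  have e : ∀ p : (Fin m → ℝ) × (Fin m → ℝ), elementaryTensor m c p.1 * elementaryTensor m c p.2 *
      tensorKernel H p.1 p.2 = ∑ h ∈ c.support, ∑ g ∈ c.support, c h * c g *
      ((∏ i, h.1 (p.1 i)) * (∏ i, g.1 (p.2 i)) * tensorKernel H p.1 p.2) := by
    intro p
    simp only [elementaryTensor, Finsupp.sum]
    rw [Finset.sum_mul_sum, Finset.sum_mul]
    refine Finset.sum_congr rfl fun h _ => ?_
    rw [Finset.sum_mul]
    exact Finset.sum_congr rfl fun g _ => by ring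
  simp_rw [e]
  rw [integral_finsetSum _ fun h _ => integrable_finsetSum _ fun g _ => hi h g]
  refine Finset.sum_congr rfl fun h _ => ?_
  rw [integral_finsetSum _ fun g _ => hi h g]
  refine Finset.sum_congr rfl fun g _ => ?_
  rw [integral_const_mul, ← innerHTensor_tensorPower hH hH' h g m, innerHTensor]

lemma elementaryTensor_perm (m : ℕ) (c : AbsH H →₀ ℝ) (σ : Equiv.Perm (Fin m)) (t : Fin m → ℝ) :
    elementaryTensor m c (fun i => t (σ i)) = elementaryTensor m c t := by
  unfold elementaryTensor Finsupp.sum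
  refine Finset.sum_congr rfl fun h _ => ?_
  exact congrArg (c h * ·) (Equiv.prod_comp σ fun i => h.1 (t i))

lemma symmetrization_perm (f : (Fin m → ℝ) → ℝ) (σ : Equiv.Perm (Fin m)) (t : Fin m → ℝ) :
    symmetrization f (fun i => t (σ i)) = symmetrization f t := by
  unfold symmetrization
  congr 1
  exact Equiv.sum_comp (Equiv.mulLeft σ) fun τ : Equiv.Perm (Fin m) => f fun i => t (τ i)

lemma elementaryTensor_sub (m : ℕ) (c d : AbsH H →₀ ℝ) (t : Fin m → ℝ) :
    elementaryTensor m (c - d) t = elementaryTensor m c t - elementaryTensor m d t :=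
  Finsupp.sum_sub_index fun _ _ _ => sub_mul _ _ _

/-- Bounded measurable functions belong to `|𝓗|`. -/
lemma memAbsH_of_bounded (hH : 1 / 2 < H) {h : ℝ → ℝ} (hm : Measurable h) {M : ℝ}
    (hM : ∀ t, |h t| ≤ M) : MemAbsH H h := by
  obtain ⟨B, hB, hBle⟩ := exists_lintegral_kernel_le hH
  refine ⟨hm.aemeasurable, ?_⟩
  have hM0 : 0 ≤ M := (abs_nonneg _).trans (hM 0)
  calc _ ≤ ∫⁻ _s in Set.Icc (0 : ℝ) 1, ENNReal.ofReal (M * M) * B := by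
        refine setLIntegral_mono measurable_const fun s hs => ?_
        calc _ ≤ ∫⁻ t in Set.Icc (0 : ℝ) 1,
              ENNReal.ofReal (M * M) * ENNReal.ofReal (|s - t| ^ (2 * H - 2)) := by
              refine lintegral_mono fun t => ?_
              rw [← ENNReal.ofReal_mul (by positivity), abs_mul]
              refine ENNReal.ofReal_le_ofReal ?_
              gcongr
              exacts [hM s, hM t]
          _ ≤ _ := by
              rw [lintegral_const_mul _ (by fun_prop)]
              gcongr
              exact hBle s hs
    _ < ∞ := by
        rw [setLIntegral_const]
        simp only [Real.volume_Icc]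
        finiteness

end Space

/-! ### Cells of the grid -/

/-- The interval `(i/N, (i+1)/N]`. -/
def gridCell (N : ℕ) (i : Fin N) : Set ℝ := Set.Ioc (((i : ℕ) : ℝ) / N) ((((i : ℕ) : ℝ) + 1) / N)

/-- The indicator function of a cell. -/
def cellInd (N : ℕ) (i : Fin N) : ℝ → ℝ := (gridCell N i).indicator fun _ => 1

lemma measurableSet_gridCell (N : ℕ) (i : Fin N) : MeasurableSet (gridCell N i) :=
  measurableSet_Ioc

@[fun_prop]
lemma measurable_cellInd (N : ℕ) (i : Fin N) : Measurable (cellInd N i) :=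
  measurable_const.indicator (measurableSet_gridCell N i)

lemma cellInd_nonneg (N : ℕ) (i : Fin N) (s : ℝ) : 0 ≤ cellInd N i s :=
  Set.indicator_nonneg (fun _ _ => zero_le_one) s

lemma cellInd_le_one (N : ℕ) (i : Fin N) (s : ℝ) : cellInd N i s ≤ 1 :=
  Set.indicator_le' (fun _ _ => le_rfl) (fun _ _ => zero_le_one) s

lemma exists_mem_gridCell {N : ℕ} (hN : 0 < N) {s : ℝ} (hs : s ∈ Set.Ioc (0 : ℝ) 1) :
    ∃ i : Fin N, s ∈ gridCell N i := by
  have hN' : (0 : ℝ) < N := by exact_mod_cast hN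
  have hpos : 0 < (N : ℝ) * s := mul_pos hN' hs.1
  have hc : 0 < ⌈(N : ℝ) * s⌉₊ := Nat.ceil_pos.2 hpos
  have hcN : ⌈(N : ℝ) * s⌉₊ ≤ N := Nat.ceil_le.2 (mul_le_of_le_one_right hN'.le hs.2)
  -- Cells are closed on the right, so the index is a ceiling minus one and not a floor.
  refine ⟨⟨⌈(N : ℝ) * s⌉₊ - 1, by omega⟩, ?_, ?_⟩
  · rw [div_lt_iff₀ hN', mul_comm s]
    exact Nat.lt_ceil.1 (by simp only; omega)
  · rw [le_div_iff₀ hN', mul_comm s]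
    have h := Nat.le_ceil ((N : ℝ) * s)
    have : ((⌈(N : ℝ) * s⌉₊ - 1 : ℕ) : ℝ) + 1 = ⌈(N : ℝ) * s⌉₊ := by
      rw [Nat.cast_sub hc]; simp
    simp only
    rw [this]
    exact h

lemma eq_of_mem_gridCell {N : ℕ} {i j : Fin N} {s : ℝ} (hi : s ∈ gridCell N i)
    (hj : s ∈ gridCell N j) : i = j := by
  have hN : (0 : ℝ) < N := by exact_mod_cast i.pos
  have h1 : ((i : ℕ) : ℝ) / N < (((j : ℕ) : ℝ) + 1) / N := hi.1.trans_le hj.2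
  have h2 : ((j : ℕ) : ℝ) / N < (((i : ℕ) : ℝ) + 1) / N := hj.1.trans_le hi.2
  rw [div_lt_div_iff_of_pos_right hN] at h1 h2
  have h1' : (i : ℕ) < (j : ℕ) + 1 := by exact_mod_cast h1
  have h2' : (j : ℕ) < (i : ℕ) + 1 := by exact_mod_cast h2
  ext
  omega

lemma cellInd_eq_ite {N : ℕ} {i j : Fin N} {s : ℝ} (hi : s ∈ gridCell N i) :
    cellInd N j s = if j = i then 1 else 0 := by
  unfold cellInd
  by_cases h : s ∈ gridCell N j
  · rw [Set.indicator_of_mem h, if_pos (eq_of_mem_gridCell h hi)]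
  · rw [Set.indicator_of_notMem h, if_neg]
    rintro rfl
    exact h hi

lemma gridCell_subset {N : ℕ} (i : Fin N) : gridCell N i ⊆ Set.Icc (0 : ℝ) 1 := by
  have hN : (0 : ℝ) < N := by exact_mod_cast i.pos
  intro s hs
  refine ⟨le_trans (by positivity) hs.1.le, hs.2.trans ?_⟩
  rw [div_le_one hN]
  exact_mod_cast i.2

lemma gridBox_eq_pi (N : ℕ) {m : ℕ} (n : Fin m → Fin N) :
    gridBox N n = Set.univ.pi fun k => gridCell N (n k) := rfl

lemma measurableSet_gridBox (N : ℕ) {m : ℕ} (n : Fin m → Fin N) :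
    MeasurableSet (gridBox N n) :=
  MeasurableSet.univ_pi fun k => measurableSet_gridCell N (n k)

lemma gridBox_subset (N : ℕ) {m : ℕ} (n : Fin m → Fin N) :
    gridBox N n ⊆ Set.Icc (0 : Fin m → ℝ) 1 := by
  intro s hs
  have h := fun k => gridCell_subset _ (hs k (Set.mem_univ k))
  exact ⟨fun k => (h k).1, fun k => (h k).2⟩

lemma prod_cellInd (N : ℕ) {m : ℕ} (n : Fin m → Fin N) (s : Fin m → ℝ) :
    ∏ k, cellInd N (n k) (s k) = (gridBox N n).indicator (fun _ => 1) s := by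
  classical
  by_cases h : s ∈ gridBox N n
  · rw [Set.indicator_of_mem h]
    refine Finset.prod_eq_one fun k _ => ?_
    exact Set.indicator_of_mem (h k (Set.mem_univ k)) _
  · rw [Set.indicator_of_notMem h]
    rw [gridBox_eq_pi, Set.mem_univ_pi] at h
    push Not at h
    obtain ⟨k, hk⟩ := h
    exact Finset.prod_eq_zero (Finset.mem_univ k) (Set.indicator_of_notMem hk _)

/-! ### Density of elementary tensors -/

section Density

variable {H : ℝ} {m : ℕ}

lemma elementaryTensor_zero (t : Fin m → ℝ) :
    elementaryTensor m (0 : AbsH H →₀ ℝ) t = 0 := by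
  simp [elementaryTensor]

lemma elementaryTensor_sum {ι : Type*} (s : Finset ι) (c : ι → AbsH H →₀ ℝ) (t : Fin m → ℝ) :
    elementaryTensor m (∑ i ∈ s, c i) t = ∑ i ∈ s, elementaryTensor m (c i) t := by
  classical
  induction s using Finset.induction_on with
  | empty => simp [elementaryTensor_zero]
  | insert i s hi ih =>
    rw [Finset.sum_insert hi, Finset.sum_insert hi, ← ih]
    exact Finsupp.sum_add_index' (by simp) (fun _ _ _ => add_mul _ _ _)

lemma elementaryTensor_single (h : AbsH H) (a : ℝ) (t : Fin m → ℝ) :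
    elementaryTensor m (Finsupp.single h a) t = a * ∏ i, h.1 (t i) := by
  simp [elementaryTensor]

/-- The step function with values `a` on the boxes of the grid. -/
def stepFun (N : ℕ) (a : (Fin m → Fin N) → ℝ) (t : Fin m → ℝ) : ℝ :=
  ∑ n, a n * ∏ k, cellInd N (n k) (t k)

lemma measurable_stepFun (N : ℕ) (a : (Fin m → Fin N) → ℝ) : Measurable (stepFun N a) := by
  unfold stepFun
  fun_prop

/-- Polarization: a symmetrized product of cell indicators is a signed sum of tensor powers of the
functions ∑_{i ∈ S} 1_{cell i}, which are bounded and so lie in |𝓗|. -/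
lemma exists_elementaryTensor_eq_symmetrization_stepFun (hH : 1 / 2 < H) (N : ℕ)
    (a : (Fin m → Fin N) → ℝ) :
    ∃ c : AbsH H →₀ ℝ, elementaryTensor m c = symmetrization (stepFun N a) := by
  classical
  have hmem : ∀ p : (Fin m → Fin N) × Finset (Fin m),
      MemAbsH H (fun t => ∑ i ∈ p.2, cellInd N (p.1 i) t) := by
    intro p
    refine memAbsH_of_bounded hH (by fun_prop) (M := p.2.card) fun t => ?_
    rw [abs_of_nonneg (Finset.sum_nonneg fun _ _ => cellInd_nonneg _ _ _)]
    simpa using Finset.sum_le_card_nsmul p.2 (fun i => cellInd N (p.1 i) t) 1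
      fun i _ => cellInd_le_one _ _ _
  refine ⟨∑ p : (Fin m → Fin N) × Finset (Fin m), Finsupp.single ⟨_, hmem p⟩
    (a p.1 * (((m.factorial : ℝ))⁻¹ * (-1 : ℝ) ^ (m - p.2.card))), ?_⟩
  ext t
  rw [elementaryTensor_sum, Fintype.sum_prod_type]
  simp only [elementaryTensor_single]
  have h : ∀ n : Fin m → Fin N, ∑ S : Finset (Fin m),
      a n * (((m.factorial : ℝ))⁻¹ * (-1 : ℝ) ^ (m - S.card)) *
        ∏ k, ∑ i ∈ S, cellInd N (n i) (t k) =
      ((m.factorial : ℝ))⁻¹ * ∑ σ : Equiv.Perm (Fin m),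
        a n * ∏ k, cellInd N (n k) (t (σ k)) := by
    intro n
    have h1 := sum_neg_one_pow_prod_sum fun i k => cellInd N (n i) (t k)
    calc _ = a n * ((m.factorial : ℝ))⁻¹ * ∑ S : Finset (Fin m), (-1 : ℝ) ^ (m - S.card) *
          ∏ k, ∑ i ∈ S, cellInd N (n i) (t k) := by
          rw [Finset.mul_sum]
          exact Finset.sum_congr rfl fun S _ => by ring
      _ = _ := by
          -- Ryser's formula permutes the cells; replacing σ by its inverse moves the permutation to
          -- the coordinates of t.
          rw [h1, ← Equiv.sum_comp (Equiv.inv (Equiv.Perm (Fin m)))]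
          simp only [Equiv.inv_apply, Finset.mul_sum]
          refine Finset.sum_congr rfl fun σ _ => ?_
          rw [← Equiv.prod_comp σ]
          simp
          ring
  simp_rw [h]
  rw [← Finset.mul_sum, Finset.sum_comm]
  rfl

lemma symmetrization_sub (f g : (Fin m → ℝ) → ℝ) (t : Fin m → ℝ) :
    symmetrization f t - symmetrization g t = symmetrization (fun s => f s - g s) t := by
  simp [symmetrization, Finset.sum_sub_distrib, mul_sub]

/-- There are m! terms of equal energy, and summing them costs (m!)²; the prefactor 1/m! is bounded
by 1. -/
lemma kernelEnergy_symmetrization_le (hH : 1 / 2 < H) (hH' : H < 1) {u : (Fin m → ℝ) → ℝ}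
    (hu : AEMeasurable u (cubeMeasure m)) :
    kernelEnergy H (fun t => ‖symmetrization u t‖ₑ) ≤
      (m.factorial : ℝ≥0∞) ^ 3 * kernelEnergy H (fun t => ‖u t‖ₑ) := by
  have h1 : ∀ t, ‖symmetrization u t‖ₑ ≤ ∑ σ : Equiv.Perm (Fin m), ‖u fun i => t (σ i)‖ₑ := by
    intro t
    rw [symmetrization, enorm_mul]
    refine le_trans (mul_le_of_le_one_left zero_le ?_) (enorm_sum_le _ _)
    rw [Real.enorm_of_nonneg (by positivity), ENNReal.ofReal_le_one]
    exact inv_le_one_of_one_le₀ (by exact_mod_cast Nat.factorial_pos m)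
  refine (kernelEnergy_mono (Eventually.of_forall h1)).trans ?_
  refine (kernelEnergy_sum_le hH hH' _ fun σ _ => (hu.comp_quasiMeasurePreserving
    (measurePreserving_perm_cubeMeasure σ).quasiMeasurePreserving).enorm).trans (le_of_eq ?_)
  have h2 : ∀ σ : Equiv.Perm (Fin m),
      kernelEnergy H (fun t => ‖u fun i => t (σ i)‖ₑ) = kernelEnergy H (fun t => ‖u t‖ₑ) :=
    fun σ => kernelEnergy_perm σ (F := fun t => ‖u t‖ₑ)
  have h3 : ∑ σ : Equiv.Perm (Fin m), kernelEnergy H (fun t => ‖u fun i => t (σ i)‖ₑ) =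
      m.factorial * kernelEnergy H (fun t => ‖u t‖ₑ) := by
    simp only [h2, Finset.sum_const, Finset.card_univ, Fintype.card_perm, Fintype.card_fin,
      nsmul_eq_mul]
  refine (congrArg _ h3).trans ?_
  simp only [Finset.card_univ, Fintype.card_perm, Fintype.card_fin]
  ring

/-- An element of the space need not be square integrable, so the L² bound on the energy is
available only after truncation. The energy of the tails tends to 0 by dominated convergence on the
product space. -/
lemma exists_truncation {f : (Fin m → ℝ) → ℝ} (hf : MemAbsHTensor H f) {ε : ℝ≥0∞} (hε : 0 < ε) :
    ∃ g : (Fin m → ℝ) → ℝ, Measurable g ∧ (∃ M : ℝ, ∀ t, |g t| ≤ M) ∧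
      kernelEnergy H (fun t => ‖f t - g t‖ₑ) < ε := by
  set f' := hf.aemeasurable.mk f with hf'
  have hfm : Measurable f' := hf.aemeasurable.measurable_mk
  have hff' : f =ᵐ[cubeMeasure m] f' := hf.aemeasurable.ae_eq_mk
  let F : ℕ → (Fin m → ℝ) → ℝ≥0∞ := fun n s => if (n : ℝ) < |f' s| then ‖f' s‖ₑ else 0
  have hset : ∀ n : ℕ, MeasurableSet {s | (n : ℝ) < |f' s|} := fun n =>
    measurableSet_lt measurable_const hfm.abs
  have hF : ∀ n, Measurable (F n) := fun n => Measurable.ite (hset n) hfm.enorm measurable_const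
  have hFle : ∀ n s, F n s ≤ ‖f' s‖ₑ := by
    intro n s
    simp only [F]
    split_ifs <;> simp
  have hF0 : ∀ s, ∀ᶠ n in atTop, F n s = 0 := by
    intro s
    obtain ⟨k, hk⟩ := exists_nat_ge |f' s|
    filter_upwards [eventually_ge_atTop k] with n hn
    have : |f' s| ≤ n := hk.trans (by exact_mod_cast hn)
    simp [F, not_lt.2 this]
  have hK := measurable_tensorKernel (H := H) (m := m)
  have hEn : ∀ n, kernelEnergy H (F n) = ∫⁻ p, F n p.1 * F n p.2 *
      ENNReal.ofReal (tensorKernel H p.1 p.2) ∂((cubeMeasure m).prod (cubeMeasure m)) := by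
    intro n
    have := hF n
    rw [lintegral_prod _ (by fun_prop)]
    rfl
  have hlim : Tendsto (fun n => kernelEnergy H (F n)) atTop (𝓝 0) := by
    simp_rw [hEn]
    have hfin : ∫⁻ p, ‖f' p.1‖ₑ * ‖f' p.2‖ₑ * ENNReal.ofReal (tensorKernel H p.1 p.2)
        ∂((cubeMeasure m).prod (cubeMeasure m)) ≠ ∞ := by
      rw [lintegral_prod _ (by fun_prop)]
      have h := hf.energy_lt_top
      rw [kernelEnergy_congr (G := fun s => ‖f' s‖ₑ) (by
        filter_upwards [hff'] with s hs
        rw [hs])] at h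
      exact h.ne
    have := tendsto_lintegral_of_dominated_convergence
      (μ := (cubeMeasure m).prod (cubeMeasure m))
      (F := fun n p => F n p.1 * F n p.2 * ENNReal.ofReal (tensorKernel H p.1 p.2))
      (f := fun _ => 0)
      (fun p => ‖f' p.1‖ₑ * ‖f' p.2‖ₑ * ENNReal.ofReal (tensorKernel H p.1 p.2))
      (fun n => by have := hF n; fun_prop)
      (fun n => Eventually.of_forall fun p => by
        exact mul_le_mul_left (mul_le_mul' (hFle n _) (hFle n _)) _) hfin
      (Eventually.of_forall fun p => by
        refine tendsto_const_nhds.congr' ?_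
        filter_upwards [hF0 p.1] with n hn
        simp [hn])
    simpa using this
  obtain ⟨n, hn⟩ := (hlim.eventually (gt_mem_nhds hε)).exists
  refine ⟨fun s => if (n : ℝ) < |f' s| then 0 else f' s,
    Measurable.ite (hset n) measurable_const hfm, ⟨n, fun t => ?_⟩, ?_⟩
  · simp only
    split_ifs with h
    · simp
    · exact not_lt.1 h
  · refine lt_of_le_of_lt (kernelEnergy_mono ?_) hn
    filter_upwards [hff'] with s hs
    simp only [F, hs]
    split_ifs <;> simp

lemma exists_stepFun_uniform_approx {g : (Fin m → ℝ) → ℝ} (hg : UniformContinuous g) {ε : ℝ}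
    (hε : 0 < ε) :
    ∃ (N : ℕ) (a : (Fin m → Fin N) → ℝ), ∀ t : Fin m → ℝ, (∀ i, t i ∈ Set.Ioc (0 : ℝ) 1) →
      |g t - stepFun N a t| ≤ ε := by
  classical
  obtain ⟨δ, hδ, h⟩ := Metric.uniformContinuous_iff.1 hg ε hε
  obtain ⟨k, hk⟩ := exists_nat_one_div_lt hδ
  refine ⟨k + 1, fun n => g fun i => (((n i : ℕ) : ℝ) + 1) / ((k + 1 : ℕ) : ℝ), fun t ht => ?_⟩
  choose n hn using fun i => exists_mem_gridCell (Nat.succ_pos k) (ht i)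
  have hstep : ∀ a : (Fin m → Fin (k + 1)) → ℝ, stepFun (k + 1) a t = a n := by
    intro a
    unfold stepFun
    rw [Finset.sum_eq_single n]
    · rw [Finset.prod_eq_one, mul_one]
      intro i _
      rw [cellInd_eq_ite (hn i), if_pos rfl]
    · intro b _ hb
      obtain ⟨i, hi⟩ := Function.ne_iff.1 hb
      rw [Finset.prod_eq_zero (Finset.mem_univ i), mul_zero]
      rw [cellInd_eq_ite (hn i), if_neg hi]
    · simp
  rw [hstep, ← Real.dist_eq]
  refine (h ?_).le
  refine lt_of_le_of_lt ?_ hk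
  rw [dist_pi_le_iff (by positivity)]
  intro i
  have h1 := (hn i).1
  have h2 := (hn i).2
  rw [add_div] at h2
  rw [Real.dist_eq, abs_le, add_div]
  push_cast at h1 h2 ⊢
  constructor <;> linarith

/-- A chain of three approximations: by a bounded function in energy, by a compactly supported
continuous function in L², and by a step function uniformly on (0,1]^m. Two uses of the factor 4
give 4(1 + 4 · 2) = 36. -/
lemma exists_stepFun_energy_le (hH : 1 / 2 < H) (hH' : H < 1) {f : (Fin m → ℝ) → ℝ}
    (hf : MemAbsHTensor H f) {ε : ℝ≥0∞} (hε : 0 < ε) :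
    ∃ (N : ℕ) (a : (Fin m → Fin N) → ℝ),
      kernelEnergy H (fun t => ‖f t - stepFun N a t‖ₑ) ≤ 36 * ε := by
  obtain ⟨B, hB, hBle⟩ := exists_kernelEnergy_le_lintegral_sq hH m
  obtain ⟨f₁, hf₁m, ⟨M, hM⟩, hf₁⟩ := exists_truncation hf
    hε
  obtain ⟨δ, hδ, hδB⟩ : ∃ δ : ℝ, 0 < δ ∧ B * ENNReal.ofReal δ ^ 2 ≤ ε := by
    have h : Tendsto (fun δ : ℝ => B * ENNReal.ofReal δ ^ 2) (𝓝 0) (𝓝 (B * ENNReal.ofReal 0 ^ 2)) := by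
      refine ENNReal.Tendsto.const_mul ?_ (Or.inr hB)
      exact ENNReal.Tendsto.pow (ENNReal.continuous_ofReal.tendsto 0)
    have h2 : ∀ᶠ δ : ℝ in 𝓝[>] 0, B * ENNReal.ofReal δ ^ 2 ≤ ε := by
      refine (h.mono_left nhdsWithin_le_nhds).eventually (ge_mem_nhds ?_)
      simpa using hε
    obtain ⟨δ, h3, h4⟩ := (h2.and self_mem_nhdsWithin).exists
    exact ⟨δ, h4, h3⟩
  have hf₁L : MemLp f₁ 2 (cubeMeasure m) :=
    MemLp.of_bound hf₁m.aestronglyMeasurable M (Eventually.of_forall hM)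
  obtain ⟨g, hgc, hgn, hgcont, -⟩ := hf₁L.exists_hasCompactSupport_eLpNorm_sub_le (by simp)
    (ε := ENNReal.ofReal δ) (by simpa using hδ)
  obtain ⟨N, a, ha⟩ := exists_stepFun_uniform_approx
    (hgc.uniformContinuous_of_continuous hgcont) hδ
  refine ⟨N, a, ?_⟩
  have hgm : Measurable g := hgcont.measurable
  have hsm := measurable_stepFun N a
  have e1 : kernelEnergy H (fun t => ‖f₁ t - g t‖ₑ) ≤ ε := by
    refine (hBle _ (by fun_prop)).trans (le_trans ?_ hδB)
    gcongr
    have h := hgn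
    rw [eLpNorm_eq_lintegral_rpow_enorm_toReal (by simp) (by simp)] at h
    have h2 := ENNReal.rpow_le_rpow (z := 2) h (by norm_num)
    rw [← ENNReal.rpow_mul] at h2
    simpa using h2
  have e2 : kernelEnergy H (fun t => ‖g t - stepFun N a t‖ₑ) ≤ ε := by
    refine (hBle _ (by fun_prop)).trans (le_trans ?_ hδB)
    gcongr
    calc _ ≤ ∫⁻ _t, ENNReal.ofReal δ ^ 2 ∂(cubeMeasure m) := by
          refine lintegral_mono_ae ?_
          filter_upwards [ae_cubeMeasure_mem m] with t ht
          gcongr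
          rw [Real.enorm_eq_ofReal_abs]
          exact ENNReal.ofReal_le_ofReal (ha t ht)
      _ = _ := by simp
  have e3 : kernelEnergy H (fun t => ‖f₁ t - stepFun N a t‖ₑ) ≤ 4 * (ε + ε) := by
    calc _ ≤ kernelEnergy H (fun t => ‖f₁ t - g t‖ₑ + ‖g t - stepFun N a t‖ₑ) := by
          refine kernelEnergy_mono (Eventually.of_forall fun t => ?_)
          simp only
          rw [← sub_add_sub_cancel (f₁ t) (g t) (stepFun N a t)]
          exact enorm_add_le _ _
      _ ≤ 4 * (ε + ε) :=
          (kernelEnergy_add_le hH hH' (by fun_prop) (by fun_prop)).trans (by gcongr)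
  have hfae := hf.aemeasurable
  calc _ ≤ kernelEnergy H (fun t => ‖f t - f₁ t‖ₑ + ‖f₁ t - stepFun N a t‖ₑ) := by
        refine kernelEnergy_mono (Eventually.of_forall fun t => ?_)
        simp only
        rw [← sub_add_sub_cancel (f t) (f₁ t) (stepFun N a t)]
        exact enorm_add_le _ _
    _ ≤ 4 * (ε + 4 * (ε + ε)) :=
        (kernelEnergy_add_le hH hH' (by fun_prop) (by fun_prop)).trans (by gcongr)
    _ = 36 * ε := by ring

/-- Elementary tensors are dense among the symmetrizations of elements of `|𝓗|^{⊗ m}`. -/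
lemma exists_elementaryTensor_normSq_lt (hH : 1 / 2 < H) (hH' : H < 1) {f : (Fin m → ℝ) → ℝ}
    (hf : MemAbsHTensor H f) {ε : ℝ} (hε : 0 < ε) :
    ∃ c : AbsH H →₀ ℝ,
      |normSqHTensor H (fun t => elementaryTensor m c t - symmetrization f t)| < ε := by
  have hfac : (0 : ℝ) < (m.factorial : ℝ) ^ 3 := by
    have := Nat.factorial_pos m
    positivity
  -- After the factors 36 and (m!)³ this choice leaves ε/2, which makes the final inequality strict.
  obtain ⟨N, a, ha⟩ := exists_stepFun_energy_le hH hH' hf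
    (ε := ENNReal.ofReal (ε / (72 * (m.factorial : ℝ) ^ 3)))
    (ENNReal.ofReal_pos.2 (by positivity))
  obtain ⟨c, hc⟩ := exists_elementaryTensor_eq_symmetrization_stepFun (H := H) hH N a
  refine ⟨c, ?_⟩
  have hmem := (memAbsHTensor_elementaryTensor hH hH' m c).sub hH hH' (hf.symmetrization hH hH')
  have h := ofReal_abs_normSqHTensor_le hmem
  have h2 : kernelEnergy H (fun t => ‖elementaryTensor m c t - symmetrization f t‖ₑ) <
      ENNReal.ofReal ε := by
    simp_rw [hc, symmetrization_sub]
    refine lt_of_le_of_lt (kernelEnergy_symmetrization_le hH hH'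
      ((measurable_stepFun N a).aemeasurable.sub hf.aemeasurable)) ?_
    have e : kernelEnergy H (fun t => ‖stepFun N a t - f t‖ₑ) =
        kernelEnergy H (fun t => ‖f t - stepFun N a t‖ₑ) := by
      simp_rw [enorm_sub_rev]
    rw [e]
    have e2 : (m.factorial : ℝ≥0∞) ^ 3 *
        (36 * ENNReal.ofReal (ε / (72 * (m.factorial : ℝ) ^ 3))) = ENNReal.ofReal (ε / 2) := by
      rw [← ENNReal.ofReal_natCast, ← ENNReal.ofReal_pow (by positivity),
        show (36 : ℝ≥0∞) = ENNReal.ofReal 36 by simp, ← ENNReal.ofReal_mul (by norm_num),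
        ← ENNReal.ofReal_mul (by positivity)]
      congr 1
      field_simp
      norm_num
    calc _ ≤ ENNReal.ofReal (ε / 2) := by
          rw [← e2]
          gcongr
      _ < ENNReal.ofReal ε := (ENNReal.ofReal_lt_ofReal_iff hε).2 (by linarith)
  exact (ENNReal.ofReal_lt_ofReal_iff hε).1 (h.trans_lt h2)

end Density

/-! ### The coefficients of the U-statistics -/

section Coefficients

variable {H : ℝ} {m : ℕ}

/-- The coefficients of the U-statistic of `f`. -/
def boxCoeff (H : ℝ) (N : ℕ) (f : (Fin m → ℝ) → ℝ) (n : Fin m → Fin N) : ℝ :=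
  ((N : ℝ) ^ (1 - H)) ^ m * ∫ s in gridBox N n, f s

/-- The coefficients of the discretization of `h : [0,1] → ℝ`. -/
def cellCoeff (H : ℝ) (N : ℕ) (h : ℝ → ℝ) (i : Fin N) : ℝ :=
  (N : ℝ) ^ (1 - H) * ∫ s in gridCell N i, h s

lemma volume_real_gridBox {N : ℕ} (hN : 0 < N) (n : Fin m → Fin N) :
    volume.real (gridBox N n) = ((N : ℝ)⁻¹) ^ m := by
  have hN' : (0 : ℝ) < N := by exact_mod_cast hN
  rw [measureReal_def, gridBox, Real.volume_pi_Ioc_toReal]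
  · rw [← Fin.prod_const]
    refine Finset.prod_congr rfl fun k _ => ?_
    field_simp
    ring
  · intro k
    simp only
    gcongr
    linarith

/-- The point n/N is the upper corner of its right-closed box, so exactly one box contributes. -/
lemma gridAverage_gridPoint {N : ℕ} (hN : 0 < N) (f : (Fin m → ℝ) → ℝ) (n : Fin m → Fin N) :
    gridAverage N f (fun k => (((n k : ℕ) : ℝ) + 1) / N) =
      (N : ℝ) ^ m * ∫ s in gridBox N n, f s := by
  have hN' : (0 : ℝ) < N := by exact_mod_cast hN
  have hmem : ∀ k, (((n k : ℕ) : ℝ) + 1) / N ∈ gridCell N (n k) := by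
    intro k
    refine ⟨?_, le_rfl⟩
    gcongr
    linarith
  unfold gridAverage
  rw [Finset.sum_eq_single n]
  · rw [Set.indicator_of_mem (show _ ∈ gridBox N n from fun k _ => hmem k), volume_real_gridBox hN, inv_pow, inv_inv]
  · intro b _ hb
    refine Set.indicator_of_notMem (fun h => hb ?_) _
    ext1 k
    exact eq_of_mem_gridCell (h k (Set.mem_univ k)) (hmem k)
  · simp

/-- The normalization N^{-mH} and the inverse box volume N^m combine into one factor N^{1-H} per
coordinate, compatible with tensor products. -/
lemma uStatistic_eq_sum {Ω : Type*} [MeasurableSpace Ω] (P : Measure Ω) (ω : ℕ+ → Ω → ℝ)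
    {N : ℕ} (hN : 0 < N) (f : (Fin m → ℝ) → ℝ) (x : Ω) :
    uStatistic P H ω f N x = ∑ n : Fin m → Fin N,
      boxCoeff H N f n * wickProduct P (fun k => ω (Nat.succPNat (n k))) x := by
  have hN' : (0 : ℝ) < N := by exact_mod_cast hN
  rw [uStatistic, Finset.mul_sum]
  refine Finset.sum_congr rfl fun n _ => ?_
  rw [gridAverage_gridPoint hN, boxCoeff]
  have : ((N : ℝ) ^ (1 - H)) ^ m = (N : ℝ) ^ (-((m : ℝ) * H)) * (N : ℝ) ^ m := by
    rw [← Real.rpow_natCast, ← Real.rpow_mul hN'.le, ← Real.rpow_natCast (N : ℝ) m,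
      ← Real.rpow_add hN']
    congr 1
    ring
  rw [this]
  ring

lemma integrableOn_gridBox {f : (Fin m → ℝ) → ℝ} (hf : Integrable f (cubeMeasure m)) (N : ℕ)
    (n : Fin m → Fin N) : IntegrableOn f (gridBox N n) :=
  IntegrableOn.mono_set (s := gridBox N n) (t := Set.Icc 0 1) hf (gridBox_subset N n)

lemma integral_gridBox_perm (f : (Fin m → ℝ) → ℝ) (N : ℕ) (n : Fin m → Fin N)
    (σ : Equiv.Perm (Fin m)) :
    ∫ s in gridBox N (fun k => n (σ k)), f s = ∫ s in gridBox N n, f fun k => s (σ k) := by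
  have hσ : MeasurePreserving (MeasurableEquiv.arrowCongr' σ.symm (MeasurableEquiv.refl ℝ))
      (volume : Measure (Fin m → ℝ)) volume :=
    volume_preserving_arrowCongr' σ.symm (MeasurableEquiv.refl ℝ) (MeasurePreserving.id _)
  rw [← hσ.setIntegral_preimage_emb (MeasurableEquiv.measurableEmbedding _)]
  have : (MeasurableEquiv.arrowCongr' σ.symm (MeasurableEquiv.refl ℝ)) ⁻¹'
      gridBox N (fun k => n (σ k)) = gridBox N n := by
    ext t
    simp only [Set.mem_preimage, gridBox_eq_pi, Set.mem_univ_pi]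
    exact (Equiv.forall_congr_right (q := fun k => t k ∈ gridCell N (n k)) σ)
  rw [this]
  rfl

/-- Permuting the indices of a box amounts to permuting the variables of the integrand. -/
lemma symTensor_boxCoeff {f : (Fin m → ℝ) → ℝ} (hf : Integrable f (cubeMeasure m)) (N : ℕ)
    (n : Fin m → Fin N) :
    symTensor (boxCoeff H N f) n = boxCoeff H N (symmetrization f) n := by
  have hi : ∀ σ : Equiv.Perm (Fin m),
      IntegrableOn (fun t => f fun k => t (σ k)) (gridBox N n) := by
    intro σ
    refine integrableOn_gridBox ?_ N n
    exact ((measurePreserving_perm_cubeMeasure σ).integrable_comp_emb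
      (MeasurableEquiv.arrowCongr' σ.symm (MeasurableEquiv.refl ℝ)).measurableEmbedding).2 hf
  unfold symTensor boxCoeff symmetrization
  rw [integral_const_mul, integral_finsetSum _ fun σ _ => hi σ]
  simp_rw [integral_gridBox_perm f N n]
  rw [← Finset.mul_sum]
  ring

lemma boxCoeff_sub {f g : (Fin m → ℝ) → ℝ} (hf : Integrable f (cubeMeasure m))
    (hg : Integrable g (cubeMeasure m)) (N : ℕ) (n : Fin m → Fin N) :
    boxCoeff H N (fun t => f t - g t) n = boxCoeff H N f n - boxCoeff H N g n := by
  unfold boxCoeff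
  rw [integral_sub (integrableOn_gridBox hf N n) (integrableOn_gridBox hg N n), mul_sub]

lemma boxCoeff_elementaryTensor (hH' : H < 1) (N : ℕ) (c : AbsH H →₀ ℝ)
    (n : Fin m → Fin N) :
    boxCoeff H N (elementaryTensor m c) n =
      ∑ h ∈ c.support, c h * ∏ k, cellCoeff H N h.1 (n k) := by
  unfold boxCoeff elementaryTensor Finsupp.sum
  rw [integral_finsetSum _ fun h _ => (integrableOn_gridBox
    ((memAbsHTensor_tensorPower h m).integrable hH') N n).const_mul _, Finset.mul_sum]
  refine Finset.sum_congr rfl fun h _ => ?_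
  rw [integral_const_mul]
  have : ∫ t in gridBox N n, ∏ k, h.1 (t k) = ∏ k, ∫ s in gridCell N (n k), h.1 s := by
    rw [gridBox_eq_pi, volume_pi, Measure.restrict_pi_pi]
    exact integral_fintype_prod_eq_prod (fun _ s => h.1 s)
  rw [this]
  simp only [cellCoeff, Finset.prod_mul_distrib, Finset.prod_const, Finset.card_univ,
    Fintype.card_fin]
  ring

end Coefficients

/-! ### The discretized kernel -/

section Kernel

variable {H : ℝ} {γ : ℤ → ℝ}

/-- The rescaled covariance of the disorder, as a kernel on `(0,1]`. -/
def discreteKernel (H : ℝ) (γ : ℤ → ℝ) (N : ℕ) (s t : ℝ) : ℝ :=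
  ∑ i : Fin N, ∑ j : Fin N,
    cellInd N i s * cellInd N j t * ((N : ℝ) ^ (2 - 2 * H) * γ ((i : ℤ) - (j : ℤ)))

lemma measurable_prod_discreteKernel {m : ℕ} (N : ℕ) :
    Measurable fun p : (Fin m → ℝ) × (Fin m → ℝ) =>
      ∏ k, discreteKernel H γ N (p.1 k) (p.2 k) := by
  unfold discreteKernel
  fun_prop

lemma discreteKernel_of_mem {N : ℕ} {i j : Fin N} {s t : ℝ} (hs : s ∈ gridCell N i)
    (ht : t ∈ gridCell N j) :
    discreteKernel H γ N s t = (N : ℝ) ^ (2 - 2 * H) * γ ((i : ℤ) - (j : ℤ)) := by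
  unfold discreteKernel
  simp [cellInd_eq_ite hs, cellInd_eq_ite ht]

/-- The two factors N^{1-H} per coordinate are absorbed into the kernel. The function g no longer
depends on N, so only the kernel has to converge. -/
lemma sum_boxCoeff_mul_eq_integral {m : ℕ} {g : (Fin m → ℝ) → ℝ}
    (hg : Integrable g (cubeMeasure m)) (γ : ℤ → ℝ) (N : ℕ) :
    ∑ n : Fin m → Fin N, ∑ n' : Fin m → Fin N, boxCoeff H N g n * boxCoeff H N g n' *
        ∏ k, γ ((n k : ℤ) - (n' k : ℤ)) =
      ∫ p, g p.1 * g p.2 * ∏ k, discreteKernel H γ N (p.1 k) (p.2 k)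
        ∂((cubeMeasure m).prod (cubeMeasure m)) := by
  have e : ∀ p : (Fin m → ℝ) × (Fin m → ℝ),
      g p.1 * g p.2 * ∏ k, discreteKernel H γ N (p.1 k) (p.2 k) =
      ∑ n : Fin m → Fin N, ∑ n' : Fin m → Fin N,
        ((gridBox N n).indicator g p.1 * (gridBox N n').indicator g p.2) *
          ∏ k, ((N : ℝ) ^ (2 - 2 * H) * γ ((n k : ℤ) - (n' k : ℤ))) := by
    intro p
    unfold discreteKernel
    rw [Finset.prod_univ_sum, Fintype.piFinset_univ, Finset.mul_sum]
    refine Finset.sum_congr rfl fun n _ => ?_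
    rw [Finset.prod_univ_sum, Fintype.piFinset_univ, Finset.mul_sum]
    refine Finset.sum_congr rfl fun n' _ => ?_
    rw [Finset.prod_mul_distrib, Finset.prod_mul_distrib, prod_cellInd, prod_cellInd]
    have h1 : ∀ (n : Fin m → Fin N) (s : Fin m → ℝ), (gridBox N n).indicator g s =
        g s * (gridBox N n).indicator (fun _ => 1) s := by
      intro n s
      by_cases h : s ∈ gridBox N n <;> simp [h]
    rw [h1, h1]
    ring
  simp_rw [e]
  have hi : ∀ n n' : Fin m → Fin N, Integrable (fun p : (Fin m → ℝ) × (Fin m → ℝ) =>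
      ((gridBox N n).indicator g p.1 * (gridBox N n').indicator g p.2) *
          ∏ k, ((N : ℝ) ^ (2 - 2 * H) * γ ((n k : ℤ) - (n' k : ℤ))))
      ((cubeMeasure m).prod (cubeMeasure m)) := fun n n' =>
    ((hg.indicator (measurableSet_gridBox N n)).mul_prod
      (hg.indicator (measurableSet_gridBox N n'))).mul_const _
  rw [integral_finsetSum _ fun n _ => integrable_finsetSum _ fun n' _ => hi n n']
  refine Finset.sum_congr rfl fun n _ => ?_
  rw [integral_finsetSum _ fun n' _ => hi n n']
  refine Finset.sum_congr rfl fun n' _ => ?_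
  rw [integral_mul_const, integral_prod_mul]
  have h2 : ∀ n : Fin m → Fin N, ∫ s, (gridBox N n).indicator g s ∂(cubeMeasure m) =
      ∫ s in gridBox N n, g s := by
    intro n
    rw [integral_indicator (measurableSet_gridBox N n), cubeMeasure,
      Measure.restrict_restrict (measurableSet_gridBox N n),
      Set.inter_eq_left.2 (gridBox_subset N n)]
  rw [h2, h2, Finset.prod_mul_distrib]
  unfold boxCoeff
  have h3 : ∏ _k : Fin m, (N : ℝ) ^ (2 - 2 * H) =
      ((N : ℝ) ^ (1 - H)) ^ m * ((N : ℝ) ^ (1 - H)) ^ m := by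
    rw [← mul_pow, ← sq, ← Real.rpow_natCast _ 2, ← Real.rpow_mul (by positivity)]
    simp only [Finset.prod_const, Finset.card_univ, Fintype.card_fin]
    congr 2
    push_cast
    ring
  rw [h3]
  ring

/-- A convergent sequence is bounded, and evenness covers negative n. -/
lemma exists_abs_covariance_le (hγs : ∀ n, γ (-n) = γ n)
    (hγl : Tendsto (fun N : ℕ => (N : ℝ) ^ (2 - 2 * H) * γ N) atTop (𝓝 1)) :
    ∃ C : ℝ, 0 < C ∧ |γ 0| ≤ C ∧ ∀ n : ℤ, n ≠ 0 → |γ n| ≤ C * |(n : ℝ)| ^ (2 * H - 2) := by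
  obtain ⟨C, hC⟩ := hγl.abs.bddAbove_range
  have hC' : ∀ N : ℕ, |(N : ℝ) ^ (2 - 2 * H) * γ N| ≤ C := fun N => hC ⟨N, rfl⟩
  refine ⟨max C |γ 0| + 1, by positivity, by linarith [le_max_right C |γ 0|], fun n hn => ?_⟩
  have hn' : 0 < n.natAbs := Int.natAbs_pos.2 hn
  have hnr : (0 : ℝ) < (n.natAbs : ℝ) := by exact_mod_cast hn'
  have hγn : γ n = γ (n.natAbs : ℤ) := by
    rcases Int.natAbs_eq n with h | h
    · rw [← h]
    · conv_lhs => rw [h]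
      rw [hγs]
  have habs : |(n : ℝ)| = (n.natAbs : ℝ) := by
    rw [← Int.cast_abs, Int.abs_eq_natAbs]; simp
  have h := hC' n.natAbs
  rw [abs_mul, abs_of_pos (by positivity)] at h
  rw [hγn, habs, show 2 * H - 2 = -(2 - 2 * H) by ring, Real.rpow_neg hnr.le,
    ← div_eq_mul_inv, le_div_iff₀ (by positivity), mul_comm]
  linarith [le_max_left C |γ 0|]

/-- Points of cells i and j satisfy N|s - t| ≤ |i - j| + 1. For i ≠ j the right side is at most 2|i
- j|, whence the factor 2^{2-2H}; for i = j it says that N ≤ 1/|s - t|. -/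
lemma exists_abs_discreteKernel_le (hγs : ∀ n, γ (-n) = γ n)
    (hγl : Tendsto (fun N : ℕ => (N : ℝ) ^ (2 - 2 * H) * γ N) atTop (𝓝 1))
    (hH' : H < 1) :
    ∃ C : ℝ, 0 ≤ C ∧ ∀ (N : ℕ) (s t : ℝ), s ≠ t → s ∈ Set.Ioc (0 : ℝ) 1 → t ∈ Set.Ioc (0 : ℝ) 1 →
      |discreteKernel H γ N s t| ≤ C * |s - t| ^ (2 * H - 2) := by
  obtain ⟨C, hC0, hCz, hC⟩ := exists_abs_covariance_le hγs hγl
  refine ⟨C * 2 ^ (2 - 2 * H), by positivity, fun N s t hst hs ht => ?_⟩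
  rcases Nat.eq_zero_or_pos N with rfl | hN
  · simp only [discreteKernel, Finset.univ_eq_empty, Finset.sum_empty, abs_zero]
    positivity
  have hN' : (0 : ℝ) < N := by exact_mod_cast hN
  obtain ⟨i, hi⟩ := exists_mem_gridCell hN hs
  obtain ⟨j, hj⟩ := exists_mem_gridCell hN ht
  rw [discreteKernel_of_mem hi hj, abs_mul, abs_of_pos (by positivity)]
  have hd : 0 < |s - t| := abs_pos.2 (sub_ne_zero.2 hst)
  have hdle : (N : ℝ) * |s - t| ≤ |(((i : ℤ) - (j : ℤ) : ℤ) : ℝ)| + 1 := by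
    obtain ⟨h1, h2⟩ := hi
    obtain ⟨h3, h4⟩ := hj
    rw [div_lt_iff₀ hN'] at h1 h3
    rw [le_div_iff₀ hN'] at h2 h4
    rw [← abs_of_pos hN', ← abs_mul]
    push_cast
    have h5 := le_abs_self (((i : ℕ) : ℝ) - ((j : ℕ) : ℝ))
    have h6 := neg_abs_le (((i : ℕ) : ℝ) - ((j : ℕ) : ℝ))
    rw [abs_le]
    constructor <;> linarith
  have h2H : 2 * H - 2 ≤ 0 := by linarith
  have hNk : (N : ℝ) ^ (2 - 2 * H) = ((N : ℝ)⁻¹) ^ (2 * H - 2) := by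
    rw [Real.inv_rpow hN'.le, ← Real.rpow_neg hN'.le]
    congr 1; ring
  have h2k : (2 : ℝ) ^ (2 - 2 * H) = ((2 : ℝ)⁻¹) ^ (2 * H - 2) := by
    rw [Real.inv_rpow (by norm_num), ← Real.rpow_neg (by norm_num)]
    congr 1; ring
  rw [mul_assoc, h2k, ← Real.mul_rpow (by positivity) (by positivity), hNk]
  by_cases hij : (i : ℤ) - (j : ℤ) = 0
  · rw [hij, mul_comm]
    rw [hij] at hdle
    simp only [Int.cast_zero, abs_zero, zero_add] at hdle
    refine mul_le_mul hCz ?_ (by positivity) hC0.le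
    refine Real.rpow_le_rpow_of_nonpos (by positivity) ?_ h2H
    rw [le_inv_comm₀ (by positivity) hN', mul_inv, inv_inv]
    have : (N : ℝ) ≤ |s - t|⁻¹ := by
      rw [le_inv_comm₀ hN' hd, ← one_div, le_div_iff₀ hN', mul_comm]
      exact hdle
    nlinarith [inv_pos.2 hd]
  · have hk : (1 : ℝ) ≤ |(((i : ℤ) - (j : ℤ) : ℤ) : ℝ)| := by
      rw [← Int.cast_abs]
      exact_mod_cast Int.one_le_abs hij
    calc _ ≤ ((N : ℝ)⁻¹) ^ (2 * H - 2) *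
          (C * |(((i : ℤ) - (j : ℤ) : ℤ) : ℝ)| ^ (2 * H - 2)) := by
          gcongr
          exact hC _ hij
      _ = C * ((N : ℝ)⁻¹ * |(((i : ℤ) - (j : ℤ) : ℤ) : ℝ)|) ^ (2 * H - 2) := by
          rw [Real.mul_rpow (by positivity) (by positivity)]; ring
      _ ≤ _ := by
          refine mul_le_mul_of_nonneg_left ?_ hC0.le
          refine Real.rpow_le_rpow_of_nonpos (by positivity) ?_ h2H
          rw [← div_eq_inv_mul, ← div_eq_inv_mul, div_le_div_iff₀ (by norm_num) hN']
          linarith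

/-- With d_N the difference of the cell indices, d_N/N tends to s - t and |d_N| to infinity. The
kernel equals |d_N|^{2-2H} γ(|d_N|) (|d_N|/N)^{2H-2}, so the limit of γ along the integers is
enough. -/
lemma tendsto_discreteKernel (hγs : ∀ n, γ (-n) = γ n)
    (hγl : Tendsto (fun N : ℕ => (N : ℝ) ^ (2 - 2 * H) * γ N) atTop (𝓝 1))
    {s t : ℝ} (hst : s ≠ t) (hs : s ∈ Set.Ioc (0 : ℝ) 1)
    (ht : t ∈ Set.Ioc (0 : ℝ) 1) :
    Tendsto (fun N => discreteKernel H γ N s t) atTop (𝓝 (|s - t| ^ (2 * H - 2))) := by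
  -- For N = 0 there are no cells; the guard allows a sequence defined for every N.
  have hex : ∀ N : ℕ, ∃ d : ℤ, (0 < N → discreteKernel H γ N s t =
      (N : ℝ) ^ (2 - 2 * H) * γ d ∧ |(d : ℝ) / N - (s - t)| ≤ 1 / N) := by
    intro N
    rcases Nat.eq_zero_or_pos N with rfl | hN
    · exact ⟨0, fun h => absurd h (lt_irrefl _)⟩
    have hN' : (0 : ℝ) < N := by exact_mod_cast hN
    obtain ⟨i, hi⟩ := exists_mem_gridCell hN hs
    obtain ⟨j, hj⟩ := exists_mem_gridCell hN ht
    refine ⟨(i : ℤ) - (j : ℤ), fun _ => ⟨discreteKernel_of_mem hi hj, ?_⟩⟩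
    obtain ⟨h1, h2⟩ := hi
    obtain ⟨h3, h4⟩ := hj
    push_cast
    rw [add_div] at h2 h4
    rw [sub_div, abs_le]
    constructor <;> linarith
  choose d hd using hex
  have hdlim : Tendsto (fun N : ℕ => (d N : ℝ) / N) atTop (𝓝 (s - t)) := by
    rw [tendsto_iff_norm_sub_tendsto_zero]
    refine squeeze_zero' (Eventually.of_forall fun N => norm_nonneg _) ?_
      tendsto_one_div_atTop_nhds_zero_nat
    filter_upwards [eventually_gt_atTop 0] with N hN
    exact (hd N hN).2
  have hlim2 : Tendsto (fun N : ℕ => ((d N).natAbs : ℝ) / N) atTop (𝓝 |s - t|) := by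
    refine hdlim.abs.congr fun N => ?_
    rw [abs_div, Nat.abs_cast, ← Int.cast_abs, Int.abs_eq_natAbs]
    simp
  have hst' : 0 < |s - t| := abs_pos.2 (sub_ne_zero.2 hst)
  have hdtop : Tendsto (fun N : ℕ => (d N).natAbs) atTop atTop := by
    rw [← tendsto_natCast_atTop_iff (R := ℝ)]
    have := hlim2.pos_mul_atTop hst' tendsto_natCast_atTop_atTop
    refine this.congr' ?_
    filter_upwards [eventually_gt_atTop 0] with N hN
    have : (N : ℝ) ≠ 0 := by exact_mod_cast hN.ne'
    field_simp
  have hprod := (hγl.comp hdtop).mul (hlim2.rpow_const (p := 2 * H - 2) (Or.inl hst'.ne'))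
  rw [one_mul] at hprod
  refine hprod.congr' ?_
  filter_upwards [eventually_gt_atTop 0, hdtop.eventually (eventually_gt_atTop 0)] with N hN hdN
  have hN' : (0 : ℝ) < N := by exact_mod_cast hN
  have hdN' : (0 : ℝ) < ((d N).natAbs : ℝ) := by exact_mod_cast hdN
  have hγd : γ (d N) = γ ((d N).natAbs : ℤ) := by
    rcases Int.natAbs_eq (d N) with h | h
    · rw [← h]
    · conv_lhs => rw [h]
      rw [hγs]
  rw [(hd N hN).1, hγd, Function.comp_apply, Real.div_rpow hdN'.le hN'.le,
    show 2 - 2 * H = -(2 * H - 2) by ring, Real.rpow_neg hdN'.le, Real.rpow_neg hN'.le]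
  have : ((d N).natAbs : ℝ) ^ (2 * H - 2) ≠ 0 := by positivity
  field_simp

/-- Dominated convergence with majorant C^m |g(s) g(t)| ∏ |s_k - t_k|^{2H-2}; membership in |𝓗|^{⊗m}
is exactly its integrability. -/
lemma tendsto_sum_boxCoeff (hγs : ∀ n, γ (-n) = γ n)
    (hγl : Tendsto (fun N : ℕ => (N : ℝ) ^ (2 - 2 * H) * γ N) atTop (𝓝 1))
    (hH' : H < 1) {m : ℕ}
    {g : (Fin m → ℝ) → ℝ} (hg : MemAbsHTensor H g) :
    Tendsto (fun N => ∑ n : Fin m → Fin N, ∑ n' : Fin m → Fin N,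
      boxCoeff H N g n * boxCoeff H N g n' * ∏ k, γ ((n k : ℤ) - (n' k : ℤ))) atTop
      (𝓝 (normSqHTensor H g)) := by
  simp_rw [sum_boxCoeff_mul_eq_integral (hg.integrable hH') γ]
  rw [normSqHTensor_eq_inner hg, innerHTensor]
  obtain ⟨C, hC0, hC⟩ := exists_abs_discreteKernel_le hγs hγl hH'
  have hae : ∀ᵐ p ∂((cubeMeasure m).prod (cubeMeasure m)), ∀ k, p.1 k ≠ p.2 k ∧
      p.1 k ∈ Set.Ioc (0 : ℝ) 1 ∧ p.2 k ∈ Set.Ioc (0 : ℝ) 1 := by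
    have h1 : ∀ᵐ p ∂((cubeMeasure m).prod (cubeMeasure m)), ∀ k, p.1 k ∈ Set.Ioc (0 : ℝ) 1 :=
      Measure.quasiMeasurePreserving_fst.ae (ae_cubeMeasure_mem m)
    have h2 : ∀ᵐ p ∂((cubeMeasure m).prod (cubeMeasure m)), ∀ k, p.2 k ∈ Set.Ioc (0 : ℝ) 1 :=
      Measure.quasiMeasurePreserving_snd.ae (ae_cubeMeasure_mem m)
    have h3 : ∀ᵐ p ∂((cubeMeasure m).prod (cubeMeasure m)), ∀ k, p.1 k ≠ p.2 k := by
      rw [Measure.ae_prod_iff_ae_ae]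
      · exact Eventually.of_forall fun s => ae_cubeMeasure_ne s
      · rw [Set.ofPred_forall]
        refine MeasurableSet.iInter fun k => ?_
        exact (measurableSet_eq_fun (by fun_prop) (by fun_prop)).compl
    filter_upwards [h1, h2, h3] with p h1 h2 h3 k
    exact ⟨h3 k, h1 k, h2 k⟩
  have hmeas : ∀ N, Measurable fun p : (Fin m → ℝ) × (Fin m → ℝ) =>
      ∏ k, discreteKernel H γ N (p.1 k) (p.2 k) := measurable_prod_discreteKernel
  refine tendsto_integral_of_dominated_convergence
    (fun p => C ^ m * ‖g p.1 * g p.2 * tensorKernel H p.1 p.2‖) (fun N => ?_)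
    (hg.integrable_kernel_self.norm.const_mul _) (fun N => ?_) ?_
  · exact ((hg.aemeasurable.comp_fst.mul hg.aemeasurable.comp_snd).mul
      (hmeas N).aemeasurable).aestronglyMeasurable
  · filter_upwards [hae] with p hp
    rw [norm_mul, norm_mul _ (tensorKernel H p.1 p.2), mul_left_comm]
    refine mul_le_mul_of_nonneg_left ?_ (norm_nonneg _)
    rw [Real.norm_of_nonneg (tensorKernel_nonneg _ _), tensorKernel, norm_prod]
    calc _ ≤ ∏ k, (C * |p.1 k - p.2 k| ^ (2 * H - 2)) :=
          Finset.prod_le_prod (fun _ _ => norm_nonneg _) fun k _ =>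
            hC N _ _ (hp k).1 (hp k).2.1 (hp k).2.2
      _ = _ := by simp [Finset.prod_mul_distrib]
  · filter_upwards [hae] with p hp
    refine Tendsto.const_mul _ ?_
    exact tendsto_finsetProd _ fun k _ =>
      tendsto_discreteKernel hγs hγl (hp k).1 (hp k).2.1 (hp k).2.2

end Kernel

lemma eLpNorm_two_sq_eq {Ω : Type*} [MeasurableSpace Ω] {P : Measure Ω} {X : Ω → ℝ}
    (hX : MemLp X 2 P) : eLpNorm X 2 P ^ 2 = ENNReal.ofReal (∫ x, X x ^ 2 ∂P) := by
  rw [eLpNorm_eq_lintegral_rpow_enorm_toReal (by simp) (by simp),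
    ofReal_integral_eq_lintegral_ofReal hX.integrable_sq (Eventually.of_forall fun _ => sq_nonneg _)]
  rw [← ENNReal.rpow_natCast, ← ENNReal.rpow_mul]
  simp only [ENNReal.toReal_ofNat, Nat.cast_ofNat, one_div]
  rw [inv_mul_cancel₀ (by norm_num), ENNReal.rpow_one]
  refine lintegral_congr fun x => ?_
  rw [ENNReal.rpow_ofNat, Real.enorm_eq_ofReal_abs, ← ENNReal.ofReal_pow (abs_nonneg _), sq_abs]

/-! ### Moments of the disorder -/

namespace IsCorrelatedDisorder

variable {Ω : Type*} [MeasurableSpace Ω] {P : Measure Ω} {H : ℝ} {γ : ℤ → ℝ} {ω : ℕ+ → Ω → ℝ}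

/-- Every integer is a difference of two positive indices, so the symmetry of the covariance reaches
all of γ. -/
lemma covariance_neg (hω : IsCorrelatedDisorder P H γ ω) (n : ℤ) : γ (-n) = γ n := by
  obtain ⟨a, b, hab⟩ : ∃ a b : ℕ+, (a : ℤ) - (b : ℤ) = n := by
    refine ⟨Nat.succPNat n.toNat, Nat.succPNat (-n).toNat, ?_⟩
    simp only [Nat.succPNat_coe, Nat.succ_eq_add_one]
    push_cast
    omega
  have h1 := hω.covariance a b
  have h2 := hω.covariance b a
  rw [← hab, neg_sub, ← h1, ← h2]
  exact integral_congr_ae (Eventually.of_forall fun x => mul_comm _ _)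

lemma tendsto_covariance (hω : IsCorrelatedDisorder P H γ ω) :
    Tendsto (fun N : ℕ => (N : ℝ) ^ (2 - 2 * H) * γ N) atTop (𝓝 1) := by
  simpa using hω.scaling 1 one_ne_zero

lemma hasGaussianLaw_fin (hω : IsCorrelatedDisorder P H γ ω) (N : ℕ) :
    HasGaussianLaw (fun x (n : Fin N) => ω (Nat.succPNat n) x) P := by
  have h := ((hω.gaussian.comp_right fun n : Fin N => Nat.succPNat n).hasGaussianLaw Finset.univ)
  exact h.map_fun (ContinuousLinearMap.pi fun n : Fin N =>
    ContinuousLinearMap.proj (R := ℝ) (φ := fun _ : (Finset.univ : Finset (Fin N)) => ℝ)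
      ⟨n, Finset.mem_univ n⟩)

end IsCorrelatedDisorder

/-- The discretization `N^{-H} ∑ₙ 𝓐_N(h)(n/N) ωₙ`. -/
def discreteNoise {Ω : Type*} (H : ℝ) (ω : ℕ+ → Ω → ℝ) (N : ℕ) (h : ℝ → ℝ) (x : Ω) : ℝ :=
  ∑ i : Fin N, cellCoeff H N h i * ω (Nat.succPNat i) x

/-! ### Second moments of U-statistics and positivity of the form -/

section Disorder

variable {Ω : Type*} [MeasurableSpace Ω] {P : Measure Ω} {H : ℝ} {γ : ℤ → ℝ} {ω : ℕ+ → Ω → ℝ}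
  {m : ℕ}

lemma integral_uStatistic_sub_sq (hH : 1 / 2 < H) (hH' : H < 1)
    (hω : IsCorrelatedDisorder P H γ ω) {f : (Fin m → ℝ) → ℝ} (hf : MemAbsHTensor H f)
    (c : AbsH H →₀ ℝ) {N : ℕ} (hN : 0 < N) :
    ∫ x, (uStatistic P H ω f N x -
        ∑ h ∈ c.support, c h * wickPower P (discreteNoise H ω N h.1) m x) ^ 2 ∂P =
      m.factorial * ∑ n : Fin m → Fin N, ∑ n' : Fin m → Fin N,
        boxCoeff H N (fun t => symmetrization f t - elementaryTensor m c t) n *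
        boxCoeff H N (fun t => symmetrization f t - elementaryTensor m c t) n' *
          ∏ k, γ ((n k : ℤ) - (n' k : ℤ)) := by
  have key := integral_sum_wickProduct_sub_sq c.support c
    (fun h => cellCoeff H N h.1) (hω.hasGaussianLaw_fin N) (fun n => hω.mean_zero _)
    (boxCoeff H N f)
  simp_rw [symTensor_boxCoeff (hf.integrable hH'), ← boxCoeff_elementaryTensor hH',
    ← boxCoeff_sub ((hf.symmetrization hH hH').integrable hH')
      ((memAbsHTensor_elementaryTensor hH hH' m c).integrable hH'), hω.covariance] at key
  simp_rw [uStatistic_eq_sum P ω hN f]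
  refine Eq.trans key ?_
  congr 1
  refine Finset.sum_congr rfl fun n _ => Finset.sum_congr rfl fun n' _ => ?_
  congr 1
  refine Finset.prod_congr rfl fun k _ => ?_
  congr 1
  simp only [Nat.succPNat_coe, Nat.succ_eq_add_one]
  push_cast
  ring

/-- Used in three ways: for approximation by elementary statistics, with c = 0 for nonnegativity of
the form, and with m = 1, f = 0 for the covariances of the discrete noise. -/
lemma tendsto_integral_uStatistic_sub_sq (hH : 1 / 2 < H) (hH' : H < 1)
    (hω : IsCorrelatedDisorder P H γ ω) {f : (Fin m → ℝ) → ℝ} (hf : MemAbsHTensor H f)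
    (c : AbsH H →₀ ℝ) :
    Tendsto (fun N => ∫ x, (uStatistic P H ω f N x -
        ∑ h ∈ c.support, c h * wickPower P (discreteNoise H ω N h.1) m x) ^ 2 ∂P) atTop
      (𝓝 (m.factorial * normSqHTensor H
        (fun t => symmetrization f t - elementaryTensor m c t))) := by
  have h := (tendsto_sum_boxCoeff hω.covariance_neg hω.tendsto_covariance hH'
    ((hf.symmetrization hH hH').sub hH hH'
      (memAbsHTensor_elementaryTensor hH hH' m c))).const_mul (m.factorial : ℝ)
  refine h.congr' ?_
  filter_upwards [eventually_gt_atTop 0] with N hN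
  rw [integral_uStatistic_sub_sq hH hH' hω hf c hN]

lemma symmetrization_eq_self {f : (Fin m → ℝ) → ℝ}
    (hf : ∀ (σ : Equiv.Perm (Fin m)) t, f (fun i => t (σ i)) = f t) : symmetrization f = f := by
  ext t
  have : (m.factorial : ℝ) ≠ 0 := by exact_mod_cast Nat.factorial_ne_zero m
  simp [symmetrization, hf, Fintype.card_perm, this]

/-- The form `normSqHTensor` is nonnegative on symmetric functions. -/
lemma normSqHTensor_nonneg (hH : 1 / 2 < H) (hH' : H < 1)
    (hω : IsCorrelatedDisorder P H γ ω) {f : (Fin m → ℝ) → ℝ} (hf : MemAbsHTensor H f)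
    (hs : ∀ (σ : Equiv.Perm (Fin m)) t, f (fun i => t (σ i)) = f t) :
    0 ≤ normSqHTensor H f := by
  -- The form, times m!, is a limit of second moments of U-statistics.
  have h := tendsto_integral_uStatistic_sub_sq hH hH' hω hf 0
  rw [symmetrization_eq_self hs] at h
  simp only [elementaryTensor_zero, sub_zero] at h
  have h0 := ge_of_tendsto' h fun N => integral_nonneg fun x => sq_nonneg _
  exact nonneg_of_mul_nonneg_right h0 (by exact_mod_cast Nat.factorial_pos m)

lemma normSqHTensor_sub_le (hH : 1 / 2 < H) (hH' : H < 1)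
    (hω : IsCorrelatedDisorder P H γ ω) {f g : (Fin m → ℝ) → ℝ} (hf : MemAbsHTensor H f)
    (hg : MemAbsHTensor H g)
    (hfs : ∀ (σ : Equiv.Perm (Fin m)) t, f (fun i => t (σ i)) = f t)
    (hgs : ∀ (σ : Equiv.Perm (Fin m)) t, g (fun i => t (σ i)) = g t) :
    normSqHTensor H (fun t => f t - g t) ≤ 2 * normSqHTensor H f + 2 * normSqHTensor H g := by
  rw [normSqHTensor_sub_eq hH hH' hf hg]
  have := normSqHTensor_nonneg hH hH' hω (hf.add hH hH' hg) fun σ t => by rw [hfs, hgs]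
  linarith

lemma normSqHTensor_elementaryTensor_sub_le (hH : 1 / 2 < H) (hH' : H < 1)
    (hω : IsCorrelatedDisorder P H γ ω) {f : (Fin m → ℝ) → ℝ} (hf : MemAbsHTensor H f)
    (c d : AbsH H →₀ ℝ) :
    normSqHTensor H (elementaryTensor m (c - d)) ≤
      2 * normSqHTensor H (fun t => elementaryTensor m c t - symmetrization f t) +
      2 * normSqHTensor H (fun t => elementaryTensor m d t - symmetrization f t) := by
  have hs : ∀ c : AbsH H →₀ ℝ, ∀ (σ : Equiv.Perm (Fin m)) t,
      (fun t => elementaryTensor m c t - symmetrization f t) (fun i => t (σ i)) =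
      (fun t => elementaryTensor m c t - symmetrization f t) t := by
    intro c σ t
    simp only [elementaryTensor_perm, symmetrization_perm]
  have hm : ∀ c : AbsH H →₀ ℝ,
      MemAbsHTensor H (fun t => elementaryTensor m c t - symmetrization f t) := fun c =>
    (memAbsHTensor_elementaryTensor hH hH' m c).sub hH hH' (hf.symmetrization hH hH')
  have h := normSqHTensor_sub_le hH hH' hω (hm c) (hm d) (hs c) (hs d)
  simp only [sub_sub_sub_cancel_right, ← elementaryTensor_sub] at h
  exact h

end Disorder

/-! ### Multiple Wiener integrals -/

section Wiener

variable {Ω : Type*} [MeasurableSpace Ω] {P : Measure Ω} {H : ℝ} {W : AbsH H → Ω → ℝ} {m : ℕ}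

lemma memLp_elementaryIntegral (hW : IsGaussianNoise P H W) (m : ℕ) (c : AbsH H →₀ ℝ) :
    MemLp (elementaryIntegral P W m c) 2 P :=
  memLp_finsetSum c.support fun h _ =>
    (memLp_wickPower (hW.gaussian.hasGaussianLaw_eval h) m).const_mul (c h)

lemma elementaryIntegral_sub (m : ℕ) (c d : AbsH H →₀ ℝ) (x : Ω) :
    elementaryIntegral P W m (c - d) x =
      elementaryIntegral P W m c x - elementaryIntegral P W m d x :=
  Finsupp.sum_sub_index fun _ _ _ => sub_mul _ _ _

/-- The Wiener isometry on elementary tensors: both sides expand into powers of the inner products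
⟨h, g⟩. -/
lemma integral_elementaryIntegral_sq (hH : 1 / 2 < H) (hH' : H < 1)
    (hW : IsGaussianNoise P H W) (m : ℕ) (c : AbsH H →₀ ℝ) :
    ∫ x, elementaryIntegral P W m c x ^ 2 ∂P =
      m.factorial * normSqHTensor H (elementaryTensor m c) := by
  rw [normSqHTensor_elementaryTensor hH hH']
  have h := integral_sum_wickPower_sq c.support c W
    (fun i j => hW.gaussian.hasGaussianLaw_prodMk) hW.mean_zero m
  simp_rw [hW.covariance] at h
  exact h

lemma eLpNorm_elementaryIntegral_sub_sq (hH : 1 / 2 < H) (hH' : H < 1)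
    (hW : IsGaussianNoise P H W) (m : ℕ) (c d : AbsH H →₀ ℝ) :
    eLpNorm (elementaryIntegral P W m c - elementaryIntegral P W m d) 2 P ^ 2 =
      ENNReal.ofReal (m.factorial * normSqHTensor H (elementaryTensor m (c - d))) := by
  have e : elementaryIntegral P W m c - elementaryIntegral P W m d =
      elementaryIntegral P W m (c - d) := by
    ext x
    rw [elementaryIntegral_sub]
    rfl
  rw [e, eLpNorm_two_sq_eq (memLp_elementaryIntegral hW m _),
    integral_elementaryIntegral_sq hH hH' hW]

variable {Ω' : Type*} [MeasurableSpace Ω'] {P' : Measure Ω'} {γ : ℤ → ℝ} {ω : ℕ+ → Ω' → ℝ}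

lemma exists_isMultipleWienerIntegral (hH : 1 / 2 < H) (hH' : H < 1)
    (hω : IsCorrelatedDisorder P' H γ ω) (hW : IsGaussianNoise P H W)
    {f : (Fin m → ℝ) → ℝ} (hf : MemAbsHTensor H f) :
    ∃ X, IsMultipleWienerIntegral P W f X := by
  have hfac : (0 : ℝ) < m.factorial := by exact_mod_cast Nat.factorial_pos m
  -- With these errors the squared L² distance beyond rank N is below m! · 4 · 4^{-N}/(8 m!) =
  -- 4^{-N}/2, so the distances are below the summable 2^{-N}.
  choose c hc using fun j : ℕ => exists_elementaryTensor_normSq_lt hH hH' hf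
    (ε := (1 / 4) ^ j / (8 * m.factorial)) (by positivity)
  have hcau : ∀ N n k : ℕ, N ≤ n → N ≤ k →
      eLpNorm (elementaryIntegral P W m (c n) - elementaryIntegral P W m (c k)) 2 P <
        ENNReal.ofReal ((1 / 2) ^ N) := by
    intro N n k hn hk
    rw [← ENNReal.pow_lt_pow_left_iff two_ne_zero, eLpNorm_elementaryIntegral_sub_sq hH hH' hW,
      ← ENNReal.ofReal_pow (by positivity), ENNReal.ofReal_lt_ofReal_iff (by positivity)]
    have h := normSqHTensor_elementaryTensor_sub_le hH hH' hω hf (c n) (c k)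
    have hb : ∀ l, N ≤ l → normSqHTensor H
        (fun t => elementaryTensor m (c l) t - symmetrization f t) <
          (1 / 4) ^ N / (8 * m.factorial) := by
      intro l hl
      refine (le_abs_self _).trans_lt ((hc l).trans_le ?_)
      gcongr ?_ / _
      exact pow_le_pow_of_le_one (by norm_num) (by norm_num) hl
    have h1 := hb n hn
    have h2 := hb k hk
    calc _ < (m.factorial : ℝ) * (4 * ((1 / 4) ^ N / (8 * m.factorial))) := by
          gcongr
          linarith
      _ = (1 / 4 : ℝ) ^ N / 2 := by field_simp; norm_num
      _ ≤ (1 / 4 : ℝ) ^ N := by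
          have : (0 : ℝ) < (1 / 4) ^ N := by positivity
          linarith
      _ = ((1 / 2 : ℝ) ^ N) ^ 2 := by rw [← pow_mul, mul_comm, pow_mul]; norm_num
  obtain ⟨X, hX, hlim⟩ := Lp.cauchy_complete_eLpNorm (by norm_num)
    (fun n => memLp_elementaryIntegral hW m (c n))
    (B := fun N => ENNReal.ofReal ((1 / 2) ^ N))
    ((summable_geometric_of_lt_one (by norm_num) (by norm_num :
      (1 / 2 : ℝ) < 1)).tsum_ofReal_ne_top) hcau
  refine ⟨X, hX, c, ?_, hlim⟩
  refine squeeze_zero_norm (fun j => (hc j).le) ?_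
  have := (tendsto_pow_atTop_nhds_zero_of_lt_one (by norm_num : (0 : ℝ) ≤ 1 / 4)
    (by norm_num)).div_const (8 * (m.factorial : ℝ))
  simpa using this

/-- Two approximating sequences tend to the same f̂, so by the isometry the difference of their
elementary integrals vanishes in L². -/
lemma isMultipleWienerIntegral_ae_unique (hH : 1 / 2 < H) (hH' : H < 1)
    (hω : IsCorrelatedDisorder P' H γ ω) (hW : IsGaussianNoise P H W)
    {f : (Fin m → ℝ) → ℝ} (hf : MemAbsHTensor H f) {X Y : Ω → ℝ}
    (hX : IsMultipleWienerIntegral P W f X) (hY : IsMultipleWienerIntegral P W f Y) :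
    X =ᵐ[P] Y := by
  obtain ⟨hXm, c, hc, hcX⟩ := hX
  obtain ⟨hYm, d, hd, hdY⟩ := hY
  have hsq : Tendsto (fun j => eLpNorm (elementaryIntegral P W m (c j) -
      elementaryIntegral P W m (d j)) 2 P ^ 2) atTop (𝓝 0) := by
    simp_rw [eLpNorm_elementaryIntegral_sub_sq hH hH' hW]
    have h1 := ((hc.const_mul 2).add (hd.const_mul 2)).const_mul (m.factorial : ℝ)
    simp only [mul_zero, add_zero] at h1
    have h2 := (ENNReal.continuous_ofReal.tendsto 0).comp h1
    rw [ENNReal.ofReal_zero] at h2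
    refine tendsto_of_tendsto_of_tendsto_of_le_of_le tendsto_const_nhds h2
      (fun _ => zero_le) fun j => ?_
    refine ENNReal.ofReal_le_ofReal ?_
    exact mul_le_mul_of_nonneg_left
      (normSqHTensor_elementaryTensor_sub_le hH hH' hω hf (c j) (d j)) (Nat.cast_nonneg _)
  have hmid : Tendsto (fun j => eLpNorm (elementaryIntegral P W m (c j) -
      elementaryIntegral P W m (d j)) 2 P) atTop (𝓝 0) := by
    have h := hsq.ennrpow_const (1 / 2)
    rw [ENNReal.zero_rpow_of_pos (by norm_num)] at h
    refine h.congr fun j => ?_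
    rw [← ENNReal.rpow_natCast, ← ENNReal.rpow_mul]
    norm_num
  have hle : ∀ j, eLpNorm (X - Y) 2 P ≤
      eLpNorm (fun x => elementaryIntegral P W m (c j) x - X x) 2 P +
      eLpNorm (elementaryIntegral P W m (c j) - elementaryIntegral P W m (d j)) 2 P +
      eLpNorm (fun x => elementaryIntegral P W m (d j) x - Y x) 2 P := by
    intro j
    have hcm := (memLp_elementaryIntegral hW m (c j))
    have hdm := (memLp_elementaryIntegral hW m (d j))
    have e : X - Y = (X - elementaryIntegral P W m (c j)) +
        (elementaryIntegral P W m (c j) - elementaryIntegral P W m (d j)) +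
        (elementaryIntegral P W m (d j) - Y) := by
      ext x; simp
    have e1 : eLpNorm (X - elementaryIntegral P W m (c j)) 2 P =
        eLpNorm (fun x => elementaryIntegral P W m (c j) x - X x) 2 P :=
      eLpNorm_sub_comm _ _ _ _
    calc _ = eLpNorm ((X - elementaryIntegral P W m (c j)) +
        (elementaryIntegral P W m (c j) - elementaryIntegral P W m (d j)) +
        (elementaryIntegral P W m (d j) - Y)) 2 P := by rw [← e]
      _ ≤ _ := (eLpNorm_add_le ((hXm.sub hcm).add (hcm.sub hdm)).1 (hdm.sub hYm).1
          (by norm_num)).trans (add_le_add_left ((eLpNorm_add_le (hXm.sub hcm).1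
            (hcm.sub hdm).1 (by norm_num)).trans (by rw [e1])) _)
  have hz : eLpNorm (X - Y) 2 P = 0 := by
    have := ge_of_tendsto' ((hcX.add hmid).add hdY) hle
    simpa using this
  have h0 := (eLpNorm_eq_zero_iff (hXm.sub hYm).1 (by norm_num)).1 hz
  filter_upwards [h0] with x hx
  exact sub_eq_zero.1 hx

lemma isMultipleWienerIntegral_multipleWienerIntegral (hH : 1 / 2 < H) (hH' : H < 1)
    (hω : IsCorrelatedDisorder P' H γ ω) (hW : IsGaussianNoise P H W)
    {f : (Fin m → ℝ) → ℝ} (hf : MemAbsHTensor H f) :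
    IsMultipleWienerIntegral P W f (multipleWienerIntegral P W f) := by
  have h := exists_isMultipleWienerIntegral hH hH' hω hW hf
  rw [multipleWienerIntegral, dif_pos h]
  exact h.choose_spec

end Wiener

/-! ### Convergence in distribution -/

lemma charFun_map_of_centred {Ω ι : Type*} [MeasurableSpace Ω] {P : Measure Ω} [Fintype ι]
    {X : Ω → ι → ℝ} (hX : HasGaussianLaw X P)
    (hX0 : ∀ i, ∫ x, X x i ∂P = 0) (ξ : EuclideanSpace ℝ ι) :
    charFun (P.map fun x => (EuclideanSpace.equiv ι ℝ).symm (X x)) ξ =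
      Complex.exp (-((∫ x, (∑ i, ξ i * X x i) ^ 2 ∂P : ℝ) : ℂ) / 2) := by
  have hin : (fun x => inner ℝ ξ ((EuclideanSpace.equiv ι ℝ).symm (X x))) =
      fun x => ∑ i, ξ i * X x i := by
    ext x
    simp [PiLp.inner_apply, mul_comm]
  have hmean : ∫ x, ∑ i, ξ i * X x i ∂P = 0 := integral_linear (X := fun i x => X x i) hX hX0 _
  have hmeas : AEMeasurable (fun x => ∑ i, ξ i * X x i) P := by
    have := hX.aemeasurable
    fun_prop
  have h := (hX.map_fun (EuclideanSpace.equiv ι ℝ).symm.toContinuousLinearMap).charFun_map_eq ξ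
  simp only [ContinuousLinearEquiv.coe_coe] at h
  rw [h, hin, hmean, variance_of_integral_eq_zero hmeas hmean]
  congr 1
  push_cast
  ring

section ConvergenceInDistribution

variable {Ω Ω' : Type*} [MeasurableSpace Ω] [MeasurableSpace Ω'] {P : Measure Ω}
  [IsProbabilityMeasure P] {P' : Measure Ω'} [IsProbabilityMeasure P']

/-- The characteristic function of a centred Gaussian vector depends only on the variances of its
linear forms; Lévy's continuity theorem concludes. -/
lemma tendstoInDistribution_of_hasGaussianLaw {ι : Type*} [Fintype ι] {Y : ℕ → Ω → ι → ℝ}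
    {Z : Ω' → ι → ℝ} (hY : ∀ N, HasGaussianLaw (Y N) P) (hZ : HasGaussianLaw Z P')
    (hY0 : ∀ N i, ∫ x, Y N x i ∂P = 0) (hZ0 : ∀ i, ∫ x, Z x i ∂P' = 0)
    (h : ∀ ξ : ι → ℝ, Tendsto (fun N => ∫ x, (∑ i, ξ i * Y N x i) ^ 2 ∂P) atTop
      (𝓝 (∫ x, (∑ i, ξ i * Z x i) ^ 2 ∂P'))) :
    TendstoInDistribution Y atTop Z (fun _ => P) P' := by
  -- Characteristic functions are taken on the Euclidean space, where an inner product is available,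
  -- and the result is carried back to the product space.
  have hE : TendstoInDistribution (fun N x => (EuclideanSpace.equiv ι ℝ).symm (Y N x)) atTop
      (fun x => (EuclideanSpace.equiv ι ℝ).symm (Z x)) (fun _ => P) P' := by
    have hc := (EuclideanSpace.equiv ι ℝ).symm.continuous.measurable
    refine ⟨fun N => hc.comp_aemeasurable (hY N).aemeasurable,
      hc.comp_aemeasurable hZ.aemeasurable, ?_⟩
    refine ProbabilityMeasure.tendsto_of_tendsto_charFun fun ξ => ?_
    have h' := (Complex.continuous_exp.tendsto _).comp
      (((Complex.continuous_ofReal.tendsto _).comp (h ξ)).neg.div_const 2)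
    exact (congrArg 𝓝 (charFun_map_of_centred hZ hZ0 ξ)) ▸
      h'.congr fun N => (charFun_map_of_centred (hY N) (hY0 N) ξ).symm
  exact hE.continuous_comp (g := EuclideanSpace.equiv ι ℝ) (EuclideanSpace.equiv ι ℝ).continuous

lemma edist_integral_map_le {E : Type*} [PseudoEMetricSpace E] [MeasurableSpace E]
    [BorelSpace E] {f : E → ℝ} {C : ℝ} (hC : ∀ x y, dist (f x) (f y) ≤ C) {L : NNReal}
    (hL : LipschitzWith L f) {X Y : Ω → E} (hX : AEMeasurable X P) (hY : AEMeasurable Y P) :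
    edist (∫ y, f y ∂(P.map X)) (∫ y, f y ∂(P.map Y)) ≤ L * ∫⁻ x, edist (X x) (Y x) ∂P := by
  have hf := hL.continuous.measurable
  obtain ⟨x₀⟩ : Nonempty Ω := P.nonempty_of_neZero
  have hint : ∀ {X : Ω → E}, AEMeasurable X P → Integrable (fun x => f (X x)) P := by
    intro X hX
    refine Integrable.of_bound (hf.comp_aemeasurable hX).aestronglyMeasurable
      (C + ‖f (X x₀)‖) (Eventually.of_forall fun x => ?_)
    have := hC (X x) (X x₀)
    rw [dist_eq_norm] at this
    linarith [norm_sub_norm_le (f (X x)) (f (X x₀))]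
  rw [integral_map hX hf.aestronglyMeasurable, integral_map hY hf.aestronglyMeasurable,
    edist_eq_enorm_sub, ← integral_sub (hint hX) (hint hY), ← lintegral_const_mul' _ _ (by simp)]
  refine (enorm_integral_le_lintegral_enorm _).trans (lintegral_mono fun x => ?_)
  rw [← edist_eq_enorm_sub]
  exact hL _ _

/-- The converging-together theorem, with L¹ distances. Against a bounded L-Lipschitz test function
each of the two replacements costs at most Lε, so an argument in thirds applies. -/
lemma tendstoInDistribution_of_forall_approx {E : Type*} [PseudoEMetricSpace E]
    [MeasurableSpace E] [BorelSpace E] {X : ℕ → Ω → E} {Z : Ω' → E}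
    (hX : ∀ N, AEMeasurable (X N) P) (hZ : AEMeasurable Z P')
    (h : ∀ ε : ℝ≥0∞, 0 < ε → ∃ (Y : ℕ → Ω → E) (T : Ω' → E),
      TendstoInDistribution Y atTop T (fun _ => P) P' ∧
      (∀ᶠ N in atTop, ∫⁻ x, edist (X N x) (Y N x) ∂P ≤ ε) ∧
      ∫⁻ x, edist (T x) (Z x) ∂P' ≤ ε) :
    TendstoInDistribution X atTop Z (fun _ => P) P' := by
  refine ⟨hX, hZ, ?_⟩
  refine tendsto_iff_forall_lipschitz_integral_tendsto.2 ?_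
  rintro f ⟨C, hC⟩ ⟨L, hL⟩
  rw [EMetric.tendsto_nhds]
  intro δ hδ
  have hδ3 : δ / 3 ≠ 0 := (ENNReal.div_pos hδ.ne' (by norm_num)).ne'
  obtain ⟨ε, hε, hεL⟩ := ENNReal.exists_nnreal_pos_mul_lt (a := L) (b := δ / 3) (by simp) hδ3
  obtain ⟨Y, T, hYT, hXY, hTZ⟩ := h ε (by exact_mod_cast hε)
  have hlim := EMetric.tendsto_nhds.1
    (tendsto_iff_forall_lipschitz_integral_tendsto.1 hYT.tendsto f ⟨C, hC⟩ ⟨L, hL⟩) (δ / 3) (pos_iff_ne_zero.2 hδ3)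
  filter_upwards [hXY, hlim] with N hN hN'
  simp only [ProbabilityMeasure.coe_mk] at hN' ⊢
  have h1 := (edist_integral_map_le hC hL (hX N) (hYT.forall_aemeasurable N)).trans
    (mul_le_mul_right hN (L : ℝ≥0∞))
  have h2 := (edist_integral_map_le hC hL hYT.aemeasurable_limit hZ).trans
    (mul_le_mul_right hTZ (L : ℝ≥0∞))
  rw [mul_comm] at h1 h2
  calc _ ≤ _ := edist_triangle4 _ (∫ y, f y ∂(P.map (Y N))) (∫ y, f y ∂(P'.map T)) _
    _ < δ / 3 + δ / 3 + δ / 3 :=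
      ENNReal.add_lt_add (ENNReal.add_lt_add (h1.trans_lt hεL) hN') (h2.trans_lt hεL)
    _ = δ := ENNReal.add_thirds δ

end ConvergenceInDistribution

lemma wickPower_one_ae_eq {Ω : Type*} [MeasurableSpace Ω] {P : Measure Ω} {X : Ω → ℝ}
    (hX : MemLp X 2 P) : wickPower P X 1 =ᵐ[P] X := by
  filter_upwards [wickPower_ae_eq hX 1] with x hx
  rw [hx]
  simp [wickPoly]

lemma normSqHTensor_sub_comm (H : ℝ) {m : ℕ} (f g : (Fin m → ℝ) → ℝ) :
    normSqHTensor H (fun t => f t - g t) = normSqHTensor H (fun t => g t - f t) :=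
  setIntegral_congr_fun measurableSet_Icc fun s _ =>
    setIntegral_congr_fun measurableSet_Icc fun t _ => by
      beta_reduce; ring

lemma lintegral_edist_pi_le {Ω : Type*} [MeasurableSpace Ω] {P : Measure Ω}
    [IsProbabilityMeasure P] {k : ℕ} {X Y : Ω → Fin k → ℝ}
    (hm : ∀ i, AEStronglyMeasurable (fun x => X x i - Y x i) P) {η : ℝ≥0∞}
    (h : ∀ i, eLpNorm (fun x => X x i - Y x i) 2 P ≤ η) :
    ∫⁻ x, edist (X x) (Y x) ∂P ≤ η * k := by
  calc ∫⁻ x, edist (X x) (Y x) ∂P ≤ ∫⁻ x, ∑ i, ‖X x i - Y x i‖ₑ ∂P := by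
        refine lintegral_mono fun x => edist_pi_le_iff.2 fun i => ?_
        rw [edist_eq_enorm_sub]
        exact Finset.single_le_sum (f := fun i => ‖X x i - Y x i‖ₑ) (fun _ _ => zero_le)
          (Finset.mem_univ i)
    _ = ∑ i, ∫⁻ x, ‖X x i - Y x i‖ₑ ∂P := lintegral_finsetSum' _ fun i _ => (hm i).enorm
    _ ≤ ∑ _i : Fin k, η := by
        refine Finset.sum_le_sum fun i _ => ?_
        rw [← eLpNorm_one_eq_lintegral_enorm]
        exact (eLpNorm_le_eLpNorm_of_exponent_le (by norm_num) (hm i)).trans (h i)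
    _ = η * k := by simp [mul_comm]

/-! ### Convergence of the elementary statistics -/

section Elementary

variable {Ω Ω' : Type*} [MeasurableSpace Ω] [MeasurableSpace Ω'] {P : Measure Ω}
  {P' : Measure Ω'} {H : ℝ} {γ : ℤ → ℝ} {ω : ℕ+ → Ω → ℝ} {W : AbsH H → Ω' → ℝ}

lemma hasGaussianLaw_discreteNoise (hω : IsCorrelatedDisorder P H γ ω) {ι : Type*} [Fintype ι]
    (h : ι → ℝ → ℝ) (N : ℕ) : HasGaussianLaw (fun x i => discreteNoise H ω N (h i) x) P := by
  have := (hω.hasGaussianLaw_fin N).map_fun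
    (ContinuousLinearMap.pi fun i => ∑ n, cellCoeff H N (h i) n •
      ContinuousLinearMap.proj (R := ℝ) (φ := fun _ : Fin N => ℝ) n)
  simpa [discreteNoise, Function.comp_def, ContinuousLinearMap.pi_apply, sum_apply] using this

lemma integral_discreteNoise (hω : IsCorrelatedDisorder P H γ ω) (h : ℝ → ℝ) (N : ℕ) :
    ∫ x, discreteNoise H ω N h x ∂P = 0 :=
  integral_linear (X := fun (n : Fin N) x => ω (Nat.succPNat n) x) (hω.hasGaussianLaw_fin N)
    (fun _ => hω.mean_zero _) _

lemma memLp_discreteNoise (hω : IsCorrelatedDisorder P H γ ω) (h : ℝ → ℝ) (N : ℕ) :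
    MemLp (discreteNoise H ω N h) 2 P :=
  ((hasGaussianLaw_discreteNoise hω (fun _ : Unit => h) N).eval ()).memLp_two

lemma memLp_uStatistic (hω : IsCorrelatedDisorder P H γ ω) {m : ℕ} (f : (Fin m → ℝ) → ℝ)
    (N : ℕ) : MemLp (uStatistic P H ω f N) 2 P := by
  have h : ∀ n : Fin m → Fin N, MemLp (wickProduct P fun k => ω (Nat.succPNat (n k))) 2 P :=
    fun n => memLp_wickProduct (X := fun k => ω (Nat.succPNat (n k))) <|
      (hω.hasGaussianLaw_fin N).map_fun (ContinuousLinearMap.pi fun k =>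
        ContinuousLinearMap.proj (R := ℝ) (φ := fun _ : Fin N => ℝ) (n k))
  have h2 : MemLp (fun x => ∑ n : Fin m → Fin N,
      gridAverage N f (fun k => (((n k : ℕ) : ℝ) + 1) / N) *
        wickProduct P (fun k => ω (Nat.succPNat (n k))) x) 2 P :=
    memLp_finsetSum _ fun n _ => (h n).const_mul _
  exact h2.const_mul _

/-- The case m = 1, f = 0 of the second-moment limit, since a first Wick power is the variable
itself. -/
lemma tendsto_integral_sum_discreteNoise_sq (hH : 1 / 2 < H) (hH' : H < 1)
    (hω : IsCorrelatedDisorder P H γ ω) (hW : IsGaussianNoise P' H W) (c : AbsH H →₀ ℝ) :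
    Tendsto (fun N => ∫ x, (c.sum fun h a => a * discreteNoise H ω N h.1 x) ^ 2 ∂P) atTop
      (𝓝 (∫ x, (c.sum fun h a => a * W h x) ^ 2 ∂P')) := by
  have h := tendsto_integral_uStatistic_sub_sq (m := 1) hH hH' hω
    (MemAbsHTensor.zero : MemAbsHTensor H fun _ : Fin 1 → ℝ => 0) c
  have h0 : ∀ N x, uStatistic P H ω (fun _ : Fin 1 → ℝ => 0) N x = 0 := by
    intro N x
    simp [uStatistic, gridAverage]
  have hn : normSqHTensor H (fun t => symmetrization (fun _ : Fin 1 → ℝ => 0) t -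
      elementaryTensor 1 c t) = normSqHTensor H (elementaryTensor 1 c) := by
    simp [normSqHTensor, symmetrization]
  have hlim : ∫ x, (c.sum fun h a => a * W h x) ^ 2 ∂P' =
      ∫ x, elementaryIntegral P' W 1 c x ^ 2 ∂P' := by
    refine integral_congr_ae ?_
    filter_upwards [(eventually_all_finset c.support).2 fun h _ =>
      wickPower_one_ae_eq (hW.gaussian.hasGaussianLaw_eval h).memLp_two] with x hx
    have : (c.sum fun h a => a * W h x) = elementaryIntegral P' W 1 c x :=
      Finset.sum_congr rfl fun h hh => by simp only [hx h hh]
    simp only [this]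
  rw [hlim, integral_elementaryIntegral_sq hH hH' hW, ← hn]
  refine h.congr fun N => integral_congr_ae ?_
  filter_upwards [(eventually_all_finset c.support).2 fun h _ =>
    wickPower_one_ae_eq (memLp_discreteNoise hω h.1 N)] with x hx
  rw [h0, zero_sub, neg_sq]
  congr 1
  exact Finset.sum_congr rfl fun h hh => by rw [hx h hh]

lemma tendstoInDistribution_discreteNoise [IsProbabilityMeasure P] [IsProbabilityMeasure P']
    (hH : 1 / 2 < H) (hH' : H < 1)
    (hω : IsCorrelatedDisorder P H γ ω) (hW : IsGaussianNoise P' H W) (T : Finset (AbsH H)) :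
    TendstoInDistribution (fun N x (h : T) => discreteNoise H ω N h.1.1 x) atTop
      (fun x (h : T) => W h.1 x) (fun _ => P) P' := by
  refine tendstoInDistribution_of_hasGaussianLaw
    (hasGaussianLaw_discreteNoise hω fun h : T => h.1.1) (hW.gaussian.hasGaussianLaw T)
    (fun N h => integral_discreteNoise hω _ N) (fun h => hW.mean_zero _) fun ξ => ?_
  have hs : ∀ F : AbsH H → ℝ, (∑ h : T, Finsupp.single h.1 (ξ h)).sum (fun h a => a * F h) =
      ∑ h : T, ξ h * F h.1 := by
    intro F
    rw [← Finsupp.sum_finsetSum_index (fun _ => zero_mul _) fun _ _ _ => add_mul _ _ _]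
    exact Finset.sum_congr rfl fun h _ => Finsupp.sum_single_index (zero_mul _)
  have h := tendsto_integral_sum_discreteNoise_sq hH hH' hω hW
    (∑ h : T, Finsupp.single h.1 (ξ h))
  simpa only [hs] using h

lemma tendsto_integral_discreteNoise_sq (hH : 1 / 2 < H) (hH' : H < 1)
    (hω : IsCorrelatedDisorder P H γ ω) (hW : IsGaussianNoise P' H W) (h : AbsH H) :
    Tendsto (fun N => ∫ x, discreteNoise H ω N h.1 x ^ 2 ∂P) atTop
      (𝓝 (∫ x, W h x ^ 2 ∂P')) := by
  simpa using tendsto_integral_sum_discreteNoise_sq hH hH' hω hW (Finsupp.single h 1)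

/-- All the h that occur lie in one finite set T. The statistics are a fixed continuous function of
the noise on T and of its variances; as the variances are deterministic and converge, Slutsky's
theorem and continuous mapping give joint convergence. -/
lemma tendstoInDistribution_elementary [IsProbabilityMeasure P] [IsProbabilityMeasure P']
    (hH : 1 / 2 < H) (hH' : H < 1) (hω : IsCorrelatedDisorder P H γ ω)
    (hW : IsGaussianNoise P' H W) {k : ℕ} (l : Fin k → ℕ) (c : Fin k → AbsH H →₀ ℝ) :
    TendstoInDistribution (fun N x i => ∑ h ∈ (c i).support,
        c i h * wickPower P (discreteNoise H ω N h.1) (l i) x) atTop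
      (fun x i => elementaryIntegral P' W (l i) (c i) x) (fun _ => P) P' := by
  classical
  set T : Finset (AbsH H) := Finset.univ.biUnion fun i => (c i).support with hT
  have hsum : ∀ i (F : AbsH H → ℝ), ∑ h : T, c i h.1 * F h.1 =
      ∑ h ∈ (c i).support, c i h * F h := by
    intro i F
    rw [Finset.sum_coe_sort T fun h => c i h * F h]
    refine (Finset.sum_subset (Finset.subset_biUnion_of_mem (fun i => (c i).support)
      (Finset.mem_univ i)) fun h _ hh => ?_).symm
    rw [Finsupp.notMem_support_iff.1 hh, zero_mul]
  have hv : Tendsto (fun N (h : T) => ∫ x, discreteNoise H ω N h.1.1 x ^ 2 ∂P) atTop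
      (𝓝 fun h => ∫ x, W h.1 x ^ 2 ∂P') :=
    tendsto_pi_nhds.2 fun h => tendsto_integral_discreteNoise_sq hH hH' hω hW h.1
  have hg : Continuous fun (p : (T → ℝ) × (T → ℝ)) (i : Fin k) =>
      ∑ h : T, c i h.1 * (wickPoly (p.2 h) (l i)).eval (p.1 h) := by
    refine continuous_pi fun i => continuous_finsetSum _ fun h _ => continuous_const.mul ?_
    have hp : Continuous fun p : (T → ℝ) × (T → ℝ) => (p.2 h, p.1 h) := by fun_prop
    exact (continuous_eval_wickPoly (l i)).comp hp
  have key := (tendstoInDistribution_discreteNoise hH hH' hω hW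
    T).continuous_comp_prodMk_of_tendstoInMeasure_const hg
    (Y := fun N _ (h : T) => ∫ x, discreteNoise H ω N h.1.1 x ^ 2 ∂P)
    (c := fun h => ∫ x, W h.1 x ^ 2 ∂P')
    (tendstoInMeasure_of_tendsto_ae (fun _ => aestronglyMeasurable_const)
      (Eventually.of_forall fun _ => hv))
    (fun _ => aemeasurable_const)
  refine key.congr (fun N => ?_) ?_
  · filter_upwards [eventually_all.2 fun i => (eventually_all_finset (c i).support).2 fun h _ =>
      wickPower_ae_eq (memLp_discreteNoise hω h.1 N) (l i)] with x hx
    ext i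
    rw [hsum i fun h => (wickPoly (∫ x, discreteNoise H ω N h.1 x ^ 2 ∂P) (l i)).eval
      (discreteNoise H ω N h.1 x)]
    exact Finset.sum_congr rfl fun h hh => by rw [hx i h hh]
  · filter_upwards [eventually_all.2 fun i => (eventually_all_finset (c i).support).2 fun h _ =>
      wickPower_ae_eq (hW.gaussian.hasGaussianLaw_eval h).memLp_two (l i)] with x hx
    ext i
    rw [hsum i fun h => (wickPoly (∫ x, W h x ^ 2 ∂P') (l i)).eval (W h x)]
    exact Finset.sum_congr rfl fun h hh => by simp only [hx i h hh]

/-- Joint convergence of the U-statistics to the multiple Wiener integrals. -/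
lemma tendstoInDistribution_uStatistic [IsProbabilityMeasure P] [IsProbabilityMeasure P']
    (hH : 1 / 2 < H) (hH' : H < 1) (hω : IsCorrelatedDisorder P H γ ω)
    (hW : IsGaussianNoise P' H W) {k : ℕ} (l : Fin k → ℕ)
    (f : (i : Fin k) → (Fin (l i) → ℝ) → ℝ) (hf : ∀ i, MemAbsHTensor H (f i)) :
    TendstoInDistribution (fun (N : ℕ) (x : Ω) (i : Fin k) => uStatistic P H ω (f i) N x) atTop
      (fun (x : Ω') (i : Fin k) => multipleWienerIntegral P' W (f i) x) (fun _ => P) P' := by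
  have hI := fun i => isMultipleWienerIntegral_multipleWienerIntegral hH hH' hω hW (hf i)
  refine tendstoInDistribution_of_forall_approx
    (fun N => aemeasurable_pi_lambda _ fun i => (memLp_uStatistic hω (f i) N).1.aemeasurable)
    (aemeasurable_pi_lambda _ fun i => (hI i).1.1.aemeasurable) fun ε hε => ?_
  -- The distance between vectors is bounded by the sum over k coordinates, so each coordinate gets
  -- an error η with ηk < ε.
  obtain ⟨η, hη, hηε⟩ := ENNReal.exists_nnreal_pos_mul_lt (a := k) (b := ε) (by simp) hε.ne'
  -- A single elementary tensor serves both probability spaces: its distance to f̂ controls the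
  -- U-statistics for large N, and its integral is close to the Wiener integral in L².
  have hc : ∀ i, ∃ c : AbsH H →₀ ℝ, ((l i).factorial : ℝ) * normSqHTensor H
      (fun t => symmetrization (f i) t - elementaryTensor (l i) c t) < (η : ℝ) ^ 2 ∧
      eLpNorm (fun x => elementaryIntegral P' W (l i) c x -
        multipleWienerIntegral P' W (f i) x) 2 P' < η := by
    intro i
    obtain ⟨-, c, hc, hcI⟩ := hI i
    have hc' := hc.const_mul ((l i).factorial : ℝ)
    rw [mul_zero] at hc'
    obtain ⟨j, h1, h2⟩ := ((hc'.eventually_lt_const (by positivity : (0 : ℝ) < (η : ℝ) ^ 2)).and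
      (hcI.eventually_lt_const (by exact_mod_cast hη : (0 : ℝ≥0∞) < η))).exists
    refine ⟨c j, ?_, h2⟩
    rwa [normSqHTensor_sub_comm]
  choose c hc hcI using hc
  refine ⟨_, _, tendstoInDistribution_elementary hH hH' hω hW l c, ?_, ?_⟩
  · have hd : ∀ i N, MemLp (fun x => uStatistic P H ω (f i) N x - ∑ h ∈ (c i).support,
        c i h * wickPower P (discreteNoise H ω N h.1) (l i) x) 2 P := fun i N =>
      (memLp_uStatistic hω (f i) N).sub (memLp_finsetSum _ fun h _ => (memLp_wickPower
        ((hasGaussianLaw_discreteNoise hω (fun _ : Unit => h.1) N).eval ()) _).const_mul _)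
    have hev : ∀ i, ∀ᶠ N in atTop, ∫ x, (uStatistic P H ω (f i) N x - ∑ h ∈ (c i).support,
        c i h * wickPower P (discreteNoise H ω N h.1) (l i) x) ^ 2 ∂P < (η : ℝ) ^ 2 := fun i =>
      (tendsto_integral_uStatistic_sub_sq hH hH' hω (hf i) (c i)).eventually_lt_const (hc i)
    filter_upwards [eventually_all.2 hev] with N hN
    refine (lintegral_edist_pi_le (fun i => (hd i N).1) fun i => ?_).trans hηε.le
    rw [← ENNReal.pow_le_pow_left_iff two_ne_zero, eLpNorm_two_sq_eq (hd i N)]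
    refine (ENNReal.ofReal_le_ofReal (hN i).le).trans ?_
    rw [ENNReal.ofReal_pow (by positivity), ENNReal.ofReal_coe_nnreal]
  · exact (lintegral_edist_pi_le (fun i => ((memLp_elementaryIntegral hW _ _).sub (hI i).1).1)
      fun i => (hcI i).le).trans hηε.le

end Elementary

end

/-- The first conjunct says that the limit object is well defined (it exists and is unique up to
null sets); the second is the convergence of one functional, the third the joint convergence. -/
theorem proposition2p2 {Ω Ω' : Type*} [MeasurableSpace Ω] [MeasurableSpace Ω']
    (P : Measure Ω) [IsProbabilityMeasure P] (P' : Measure Ω') [IsProbabilityMeasure P']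
    (H : ℝ) (hH : 1 / 2 < H) (hH' : H < 1) (γ : ℤ → ℝ)
    (ω : ℕ+ → Ω → ℝ) (hω : IsCorrelatedDisorder P H γ ω)
    (W : AbsH H → Ω' → ℝ) (hW : IsGaussianNoise P' H W) :
    (∀ (m : ℕ), 1 ≤ m → ∀ f : (Fin m → ℝ) → ℝ, MemAbsHTensor H f →
      IsMultipleWienerIntegral P' W f (multipleWienerIntegral P' W f) ∧
      ∀ X, IsMultipleWienerIntegral P' W f X → X =ᵐ[P'] multipleWienerIntegral P' W f) ∧
    (∀ (m : ℕ), 1 ≤ m → ∀ f : (Fin m → ℝ) → ℝ, MemAbsHTensor H f →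
      TendstoInDistribution (fun N : ℕ => uStatistic P H ω f N) atTop
        (multipleWienerIntegral P' W f) (fun _ => P) P') ∧
    (∀ (k : ℕ), 1 ≤ k → ∀ (l : Fin k → ℕ), (∀ i, 1 ≤ l i) →
      ∀ f : (i : Fin k) → (Fin (l i) → ℝ) → ℝ, (∀ i, MemAbsHTensor H (f i)) →
      TendstoInDistribution (fun (N : ℕ) (x : Ω) (i : Fin k) => uStatistic P H ω (f i) N x) atTop
        (fun (x : Ω') (i : Fin k) => multipleWienerIntegral P' W (f i) x)
        (fun _ => P) P') := by
  refine ⟨fun m _ f hf => ⟨isMultipleWienerIntegral_multipleWienerIntegral hH hH' hω hW hf,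
    fun X hX => isMultipleWienerIntegral_ae_unique hH hH' hω hW hf hX
      (isMultipleWienerIntegral_multipleWienerIntegral hH hH' hω hW hf)⟩, fun m _ f hf => ?_,
    fun k _ l _ f hf => tendstoInDistribution_uStatistic hH hH' hω hW l f hf⟩
  -- Convergence of one functional is the joint statement for a vector of length one, followed by
  -- the coordinate map.
  exact (tendstoInDistribution_uStatistic hH hH' hω hW (fun _ : Fin 1 => m) (fun _ => f)
    fun _ => hf).continuous_comp (g := fun y : Fin 1 → ℝ => y 0) (continuous_apply 0)
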